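/- Let $C$ be a set of $m\ge 1$ candidates and let there be $n\ge 0$ voters. A positional scoring rule $r$ gives for each $m$ an integer vector $r(m,1)\ge\dots\ge r(m,m)$, with $r(m,1)>r(m,m)$ when $m\ge 2$; as usual, $r(m,j)$ is assumed to be computable in time polynomial in $m$. Plurality is the rule $(1,0,\dots,0)$ and veto is the rule $(1,\dots,1,0)$. In a profile $\mathbf T=(T_1,\dots,T_n)$ of linear orders on $C$, the score of a candidate $c$ is $s(\mathbf T,c)=\sum_{i=1}^n r(m,j_i)$, where $j_i$ is the position of $c$ in $T_i$ (position $1$ being the most preferred). Given a tie breaker, i.e. a linear order $\triangleright$ on $C$, the candidates are ranked by decreasing score, where among candidates with equal scores $a$ precedes $b$ if $a\triangleright b$; the top-$k$ winners are the candidates in the first $k$ positions of this ranking. A completion of a partial profile $\mathbf P=(P_1,\dots,P_n)$ of partial orders on $C$ is a profile $\mathbf T$ in which each $T_i$ is a linear extension of $P_i$. A set $C'\subseteq C$ is a necessary (respectively, possible) top-$k$ set for $\mathbf P$ if $C'$ is exactly the set of top-$k$ winners in every (respectively, at least one) completion of $\mathbf P$. Theorem. Given a partial profile $\mathbf P$,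 a tie breaker $\triangleright$ and a set $C'\subseteq C$ of $k\ge 1$ candidates, one can decide in time $k\cdot\mathrm{poly}(n,m)$ (on a random access machine with addition and subtraction and logarithmic costs, the orders and the set being given by their $0/1$ incidence tables): (1) for every positional scoring rule $r$ as above, fixed in advance, whether $C'$ is a necessary top-$k$ set under $r$; (2) for $r$ plurality and for $r$ veto, whether $C'$ is a possible top-$k$ set under $r$. -/

import Mathlib

/-! ### Machine model: random access machines with logarithmic cost -/

namespace RAM

/-- A memory state: integer registers `x₀, x₁, …` and integer arrays `A₀, A₁, …` whose cells are
addressed by integers. A program mentions only finitely many registers and arrays. -/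
structure State where
  reg : ℕ → ℤ
  arr : ℕ → ℤ → ℤ

/-- The state with register `x` set to `z`. -/
def State.setReg (σ : State) (x : ℕ) (z : ℤ) : State where
  reg := Function.update σ.reg x z
  arr := σ.arr

/-- The state with cell `i` of array `a` set to `z`. -/
def State.setArr (σ : State) (a : ℕ) (i z : ℤ) : State where
  reg := σ.reg
  arr := Function.update σ.arr a (Function.update (σ.arr a) i z)

/-- Random access programs with structured control. The only arithmetic operations are addition
and subtraction. -/
inductive Prog : Type
  /-- `x := c` -/
  | const (x : ℕ) (c : ℤ)
  /-- `x := y + z` -/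
  | add (x y z : ℕ)
  /-- `x := y - z` -/
  | sub (x y z : ℕ)
  /-- `x := A[y]` -/
  | load (x a y : ℕ)
  /-- `A[y] := x` -/
  | store (a y x : ℕ)
  /-- `p; q` -/
  | seq (p q : Prog)
  /-- `if 0 < x then p else q` -/
  | ite (x : ℕ) (p q : Prog)
  /-- `while 0 < x do p` -/
  | while (x : ℕ) (p : Prog)

/-- The number of binary digits of `|z|`. -/
def bits (z : ℤ) : ℕ := Nat.size z.natAbs

/-- `Exec p σ t τ`: started in the state `σ`, the program `p` halts in the state `τ` after time
`t`. Each elementary instruction and each test costs one unit plus the bit lengths of the integers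
(operands and addresses) that it handles. -/
inductive Exec : Prog → State → ℕ → State → Prop
  | const (σ : State) (x : ℕ) (c : ℤ) :
      Exec (.const x c) σ (1 + bits c) (σ.setReg x c)
  | add (σ : State) (x y z : ℕ) :
      Exec (.add x y z) σ (1 + bits (σ.reg y) + bits (σ.reg z))
        (σ.setReg x (σ.reg y + σ.reg z))
  | sub (σ : State) (x y z : ℕ) :
      Exec (.sub x y z) σ (1 + bits (σ.reg y) + bits (σ.reg z))
        (σ.setReg x (σ.reg y - σ.reg z))
  | load (σ : State) (x a y : ℕ) :
      Exec (.load x a y) σ (1 + bits (σ.reg y) + bits (σ.arr a (σ.reg y)))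
        (σ.setReg x (σ.arr a (σ.reg y)))
  | store (σ : State) (a y x : ℕ) :
      Exec (.store a y x) σ (1 + bits (σ.reg y) + bits (σ.reg x))
        (σ.setArr a (σ.reg y) (σ.reg x))
  | seq {p q : Prog} {σ τ υ : State} {s t : ℕ} (hp : Exec p σ s τ) (hq : Exec q τ t υ) :
      Exec (.seq p q) σ (s + t) υ
  | ite_pos {x : ℕ} {p q : Prog} {σ τ : State} {t : ℕ} (hx : 0 < σ.reg x) (hp : Exec p σ t τ) :
      Exec (.ite x p q) σ (1 + bits (σ.reg x) + t) τ
  | ite_neg {x : ℕ} {p q : Prog} {σ τ : State} {t : ℕ} (hx : ¬ 0 < σ.reg x) (hq : Exec q σ t τ) :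
      Exec (.ite x p q) σ (1 + bits (σ.reg x) + t) τ
  | while_pos {x : ℕ} {p : Prog} {σ τ υ : State} {s t : ℕ} (hx : 0 < σ.reg x)
      (hp : Exec p σ s τ) (hw : Exec (.while x p) τ t υ) :
      Exec (.while x p) σ (1 + bits (σ.reg x) + s + t) υ
  | while_neg {x : ℕ} {p : Prog} {σ : State} (hx : ¬ 0 < σ.reg x) :
      Exec (.while x p) σ (1 + bits (σ.reg x)) σ

/-- The state whose first two registers hold `a` and `b` and that is `0` elsewhere. -/
def pairInput (a b : ℕ) : State where
  reg := fun x => if x = 0 then (a : ℤ) else if x = 1 then (b : ℤ) else 0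
  arr := fun _ _ => 0

end RAM

/-! ### Voting -/

namespace Voting

/-- A positional scoring rule: for each number `m` of candidates, the non-increasing vector
`score m 1 ≥ … ≥ score m m` of integers, with `score m 1 > score m m` as soon as `m ≥ 2`.
(The values `score m j` with `j = 0` or `m < j` are never used.) -/
structure PositionalScoringRule where
  score : ℕ → ℕ → ℤ
  score_le : ∀ m i j : ℕ, 1 ≤ i → i ≤ j → j ≤ m → score m j ≤ score m i
  score_lt : ∀ m : ℕ, 2 ≤ m → score m m < score m 1

/-- The scores `score m j` are computable in time polynomial in `m`. -/
def PositionalScoringRule.PolyTimeComputable (r : PositionalScoringRule) : Prop :=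
  ∃ (prog : RAM.Prog) (p : Polynomial ℕ), ∀ m j : ℕ, 1 ≤ j → j ≤ m →
    ∃ (t : ℕ) (τ : RAM.State), RAM.Exec prog (RAM.pairInput m j) t τ ∧
      τ.reg 0 = r.score m j ∧ t ≤ p.eval m

/-- The plurality rule `(1, 0, …, 0)`. -/
def plurality : PositionalScoringRule where
  score := fun _ j => if j = 1 then 1 else 0
  score_le := by
    intro m i j hi hij hj
    split_ifs <;> omega
  score_lt := by
    intro m hm
    rw [if_neg (by omega), if_pos rfl]
    norm_num

/-- The veto rule `(1, …, 1, 0)`. -/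
def veto : PositionalScoringRule where
  score := fun m j => if j = m then 0 else 1
  score_le := by
    intro m i j hi hij hj
    split_ifs <;> omega
  score_lt := by
    intro m hm
    rw [if_pos rfl, if_neg (by omega)]
    norm_num

/-- A (complete) voting profile of `n` voters on the candidates `Fin m`: each voter has a strict
linear order, `prefers v a b` meaning that `v` ranks `a` above `b`. -/
structure Profile (n m : ℕ) where
  prefers : Fin n → Fin m → Fin m → Prop
  isStrictTotalOrder : ∀ v, IsStrictTotalOrder (Fin m) (prefers v)

/-- A partial voting profile: each voter has a strict partial order on the candidates. -/
structure PartialProfile (n m : ℕ) where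
  prefers : Fin n → Fin m → Fin m → Prop
  isStrictOrder : ∀ v, IsStrictOrder (Fin m) (prefers v)

/-- A tie breaker: a strict linear order on the candidates. -/
structure TieBreaker (m : ℕ) where
  before : Fin m → Fin m → Prop
  isStrictTotalOrder : IsStrictTotalOrder (Fin m) before

/-- `T` completes `P`: the order of every voter in `T` extends the one in `P`. -/
def Profile.Completes {n m : ℕ} (T : Profile n m) (P : PartialProfile n m) : Prop :=
  ∀ v a b, P.prefers v a b → T.prefers v a b

/-- The position (in `1, …, m`) of candidate `c` in the ranking of voter `v`. -/
noncomputable def Profile.position {n m : ℕ} (T : Profile n m) (v : Fin n) (c : Fin m) : ℕ :=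
  Set.ncard {a : Fin m | T.prefers v a c} + 1

/-- The total score of candidate `c`. -/
noncomputable def Profile.totalScore {n m : ℕ} (T : Profile n m) (r : PositionalScoringRule)
    (c : Fin m) : ℤ :=
  ∑ v : Fin n, r.score m (T.position v c)

/-- `a` comes before `b` in the final ranking: it has a higher score, or the same score and the
tie breaker puts it first. -/
def Profile.Defeats {n m : ℕ} (T : Profile n m) (r : PositionalScoringRule) (tie : TieBreaker m)
    (a b : Fin m) : Prop :=
  T.totalScore r b < T.totalScore r a ∨
    (T.totalScore r a = T.totalScore r b ∧ tie.before a b)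

/-- The position (in `1, …, m`) of `c` in the final ranking. -/
noncomputable def Profile.rank {n m : ℕ} (T : Profile n m) (r : PositionalScoringRule)
    (tie : TieBreaker m) (c : Fin m) : ℕ :=
  Set.ncard {a : Fin m | T.Defeats r tie a c} + 1

/-- `c` is a top-`k` winner. -/
def Profile.IsTopWinner {n m : ℕ} (T : Profile n m) (r : PositionalScoringRule)
    (tie : TieBreaker m) (k : ℕ) (c : Fin m) : Prop :=
  T.rank r tie c ≤ k

/-- `D` is a necessary top-`k` set: it is the set of top-`k` winners in every completion. -/
def IsNecessaryTopSet {n m : ℕ} (r : PositionalScoringRule) (P : PartialProfile n m)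
    (tie : TieBreaker m) (k : ℕ) (D : Finset (Fin m)) : Prop :=
  ∀ T : Profile n m, T.Completes P → ∀ c, c ∈ D ↔ T.IsTopWinner r tie k c

/-- `D` is a possible top-`k` set: it is the set of top-`k` winners in some completion. -/
def IsPossibleTopSet {n m : ℕ} (r : PositionalScoringRule) (P : PartialProfile n m)
    (tie : TieBreaker m) (k : ℕ) (D : Finset (Fin m)) : Prop :=
  ∃ T : Profile n m, T.Completes P ∧ ∀ c, c ∈ D ↔ T.IsTopWinner r tie k c

/-! ### The decision problems -/

open Classical in
/-- The input as it lies in memory: the registers `x₀, x₁` hold `n, m`; the array `A₀` holds the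
`0/1`-matrices of the `n` partial orders one after the other, row by row; `A₁` holds the
`0/1`-matrix of the tie breaker row by row; `A₂` holds the `0/1`-vector of the set `D`; everything
else is `0`. -/
noncomputable def encode {n m : ℕ} (P : PartialProfile n m) (tie : TieBreaker m)
    (D : Finset (Fin m)) : RAM.State where
  reg := fun x => if x = 0 then (n : ℤ) else if x = 1 then (m : ℤ) else 0
  arr := fun A i =>
    if A = 0 then
      if ∃ (v : Fin n) (a b : Fin m),
          i = (((v : ℕ) * m + (a : ℕ)) * m + (b : ℕ) : ℕ) ∧ P.prefers v a b then 1 else 0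
    else if A = 1 then
      if ∃ a b : Fin m, i = ((a : ℕ) * m + (b : ℕ) : ℕ) ∧ tie.before a b then 1 else 0
    else if A = 2 then
      if ∃ a : Fin m, i = (a : ℕ) ∧ a ∈ D then 1 else 0
    else 0

open Classical in
/-- A decision problem about triples `(P, tie, D)`, where `D` is a set of `k ≥ 1` candidates, is
decidable in time `k · poly(n, m)`: one program answers it (`1` for yes, `0` for no, in register
`x₀`) on all inputs, within time `k · p(n, m)` for a fixed polynomial `p`. -/
def DecidableInTime (Q : ∀ {n m : ℕ}, PartialProfile n m → TieBreaker m → Finset (Fin m) → Prop) :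
    Prop :=
  ∃ (prog : RAM.Prog) (p : MvPolynomial (Fin 2) ℕ),
    ∀ (n m : ℕ) (P : PartialProfile n m) (tie : TieBreaker m) (D : Finset (Fin m)), D.Nonempty →
      ∃ (t : ℕ) (τ : RAM.State), RAM.Exec prog (encode P tie D) t τ ∧
        τ.reg 0 = (if Q P tie D then 1 else 0) ∧
        t ≤ D.card * MvPolynomial.eval ![n, m] p

end Voting

/-! A set `D` of `k` candidates is the top-`k` set exactly if each of its members defeats each
outsider (`forall_mem_iff_isTopWinner`), so only pairs `c ∈ D`, `d ∉ D` matter.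

Necessary sets. The set fails if for some pair a completion lets `d` overtake `c`. Voters complete
their orders independently, so the largest value of score of `d` minus score of `c` is the sum of
the largest values for the single voters (`gain_spec`). If a voter does not have `c` above `d`, then
`d` can take its highest and `c` its lowest possible position at the same time (`exists_extreme`).
If `c` is above `d`, then at best only the candidates forced between them separate them, and this
block can slide over an interval of positions (`exists_block`), of which the best is found by trying
all.

Possible sets. A plurality profile matters only through the first choices, and any choice of
candidates that may come first is realised by a completion. So voters are to be assigned to allowed
candidates such that `D` leads. Guessing the weakest member of `D` and its number of voters turns
this into lower bounds on `D` and upper bounds elsewhere (`leadFeasible_iff`). An additional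
candidate that absorbs the surplus voters of `D` turns the lower bounds into capacities
(`boundFeasible_iff`). The capacity problem is solved by a push-relabel algorithm; when it is stuck
with an overfull candidate, a gap in the heights gives a Hall-type obstruction
(`Invariant.feasible_iff`). Veto is the same with last places, the complement of `D` and the
reversed tie breaker.

Running time. Bit lengths grow by at most one per instruction, so polynomially many steps have
polynomial logarithmic cost (`Steps.exec`). Step bounds come from a calculus of functions computable
relative to a memory layout (`Layout.Comp`), closed under arithmetic, case distinction, bounded sums
and search, and iteration of array updates (`Comp.iterate`). The given program for the scores is run
as a subroutine on relocated memory to fill a table (`exists_tabulate`). The resulting bound is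
polynomial in `n` and `m` alone, and the factor `k ≥ 1` is harmless. -/

namespace RAM

/-! ### Counting instructions -/

/-- `Steps p σ t τ`: started in `σ`, the program `p` halts in `τ` after `t` instructions and
tests. -/
inductive Steps : Prog → State → ℕ → State → Prop
  | const (σ : State) (x : ℕ) (c : ℤ) : Steps (.const x c) σ 1 (σ.setReg x c)
  | add (σ : State) (x y z : ℕ) : Steps (.add x y z) σ 1 (σ.setReg x (σ.reg y + σ.reg z))
  | sub (σ : State) (x y z : ℕ) : Steps (.sub x y z) σ 1 (σ.setReg x (σ.reg y - σ.reg z))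
  | load (σ : State) (x a y : ℕ) : Steps (.load x a y) σ 1 (σ.setReg x (σ.arr a (σ.reg y)))
  | store (σ : State) (a y x : ℕ) :
      Steps (.store a y x) σ 1 (σ.setArr a (σ.reg y) (σ.reg x))
  | seq {p q : Prog} {σ τ υ : State} {s t : ℕ} (hp : Steps p σ s τ) (hq : Steps q τ t υ) :
      Steps (.seq p q) σ (s + t) υ
  | ite_pos {x : ℕ} {p q : Prog} {σ τ : State} {t : ℕ} (hx : 0 < σ.reg x) (hp : Steps p σ t τ) :
      Steps (.ite x p q) σ (1 + t) τ
  | ite_neg {x : ℕ} {p q : Prog} {σ τ : State} {t : ℕ} (hx : ¬ 0 < σ.reg x)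
      (hq : Steps q σ t τ) : Steps (.ite x p q) σ (1 + t) τ
  | while_pos {x : ℕ} {p : Prog} {σ τ υ : State} {s t : ℕ} (hx : 0 < σ.reg x)
      (hp : Steps p σ s τ) (hw : Steps (.while x p) τ t υ) :
      Steps (.while x p) σ (1 + s + t) υ
  | while_neg {x : ℕ} {p : Prog} {σ : State} (hx : ¬ 0 < σ.reg x) :
      Steps (.while x p) σ 1 σ

/-- Each instruction and each test costs at least one unit. This makes the time bound of the given
score program usable as a bound on steps. -/
theorem Exec.steps {p : Prog} {σ τ : State} {t : ℕ} (h : Exec p σ t τ) :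
    ∃ s ≤ t, Steps p σ s τ := by
  induction h with
  | const σ x c => exact ⟨1, by omega, .const ..⟩
  | add σ x y z => exact ⟨1, by omega, .add ..⟩
  | sub σ x y z => exact ⟨1, by omega, .sub ..⟩
  | load σ x a y => exact ⟨1, by omega, .load ..⟩
  | store σ a y x => exact ⟨1, by omega, .store ..⟩
  | seq _ _ ih₁ ih₂ =>
    obtain ⟨s₁, h₁, k₁⟩ := ih₁
    obtain ⟨s₂, h₂, k₂⟩ := ih₂
    exact ⟨_, by omega, .seq k₁ k₂⟩
  | ite_pos hx _ ih =>
    obtain ⟨s, h, k⟩ := ih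
    exact ⟨_, by omega, .ite_pos hx k⟩
  | ite_neg hx _ ih =>
    obtain ⟨s, h, k⟩ := ih
    exact ⟨_, by omega, .ite_neg hx k⟩
  | while_pos hx _ _ ih₁ ih₂ =>
    obtain ⟨s₁, h₁, k₁⟩ := ih₁
    obtain ⟨s₂, h₂, k₂⟩ := ih₂
    exact ⟨_, by omega, .while_pos hx k₁ k₂⟩
  | while_neg hx => exact ⟨1, by omega, .while_neg hx⟩

/-- Every number in memory has at most `B` binary digits. -/
def State.BitsLe (σ : State) (B : ℕ) : Prop :=
  (∀ x, bits (σ.reg x) ≤ B) ∧ ∀ a i, bits (σ.arr a i) ≤ B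

theorem State.BitsLe.mono {σ : State} {B B' : ℕ} (h : σ.BitsLe B) (hB : B ≤ B') :
    σ.BitsLe B' :=
  ⟨fun x => (h.1 x).trans hB, fun a i => (h.2 a i).trans hB⟩

theorem State.BitsLe.setReg {σ : State} {B x : ℕ} {z : ℤ} (h : σ.BitsLe B) (hz : bits z ≤ B) :
    (σ.setReg x z).BitsLe B := by
  refine ⟨fun y => ?_, h.2⟩
  simp only [State.setReg, Function.update_apply]
  split_ifs
  exacts [hz, h.1 y]

theorem State.BitsLe.setArr {σ : State} {B a : ℕ} {i z : ℤ} (h : σ.BitsLe B) (hz : bits z ≤ B) :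
    (σ.setArr a i z).BitsLe B := by
  refine ⟨h.1, fun b j => ?_⟩
  simp only [State.setArr, Function.update_apply]
  split_ifs
  · simp only [Function.update_apply]
    split_ifs
    exacts [hz, h.2 a j]
  · exact h.2 b j

/-- Two numbers below `2 ^ B` in absolute value combine to less than `2 ^ (B + 1)`: addition and
subtraction lengthen numbers by at most one digit. -/
theorem bits_le_succ_of_natAbs_le {x y z : ℤ} {B : ℕ} (h : z.natAbs ≤ x.natAbs + y.natAbs)
    (hx : bits x ≤ B) (hy : bits y ≤ B) : bits z ≤ B + 1 := by
  rw [bits, Nat.size_le] at *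
  rw [pow_succ]
  omega

/-- The largest bit length of a constant in a program. -/
def Prog.constBits : Prog → ℕ
  | .const _ c => bits c
  | .seq p q => max p.constBits q.constBits
  | .ite _ p q => max p.constBits q.constBits
  | .while _ p => p.constBits
  | _ => 0

/-- A computation of few steps is cheap, since bit lengths grow by at most one per step. -/
theorem Steps.exec {p : Prog} {σ τ : State} {s : ℕ} (h : Steps p σ s τ) :
    ∀ B, p.constBits ≤ B → σ.BitsLe B →
      τ.BitsLe (B + s) ∧ ∃ t ≤ s * (1 + 2 * (B + s)), Exec p σ t τ := by
  induction h with
  | const σ x c =>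
    intro B hp hB
    have h1 : bits c ≤ B := hp
    exact ⟨(hB.mono (Nat.le_succ B)).setReg (by omega), _, by omega, .const ..⟩
  | add σ x y z =>
    intro B hp hB
    have h1 := hB.1 y
    have h2 := hB.1 z
    exact ⟨(hB.mono (Nat.le_succ B)).setReg
      (bits_le_succ_of_natAbs_le (Int.natAbs_add_le _ _) h1 h2), _, by omega, .add ..⟩
  | sub σ x y z =>
    intro B hp hB
    have h1 := hB.1 y
    have h2 := hB.1 z
    exact ⟨(hB.mono (Nat.le_succ B)).setReg
      (bits_le_succ_of_natAbs_le (Int.natAbs_sub_le _ _) h1 h2), _, by omega, .sub ..⟩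
  | load σ x a y =>
    intro B hp hB
    have h1 := hB.1 y
    have h2 := hB.2 a (σ.reg y)
    exact ⟨(hB.mono (Nat.le_succ B)).setReg (by omega), _, by omega, .load ..⟩
  | store σ a y x =>
    intro B hp hB
    have h1 := hB.1 y
    have h2 := hB.1 x
    exact ⟨(hB.mono (Nat.le_succ B)).setArr (by omega), _, by omega, .store ..⟩
  | @seq p q σ τ υ s t _ _ ih₁ ih₂ =>
    intro B hp hB
    obtain ⟨b₁, t₁, l₁, e₁⟩ := ih₁ B ((le_max_left _ _).trans hp) hB
    obtain ⟨b₂, t₂, l₂, e₂⟩ := ih₂ (B + s) (((le_max_right _ _).trans hp).trans (by omega)) b₁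
    -- The costs add up because each step of either part costs at most `1 + 2 * (B + s + t)`.
    exact ⟨b₂.mono (by omega), _, by nlinarith, .seq e₁ e₂⟩
  | @ite_pos x p q σ τ s hx _ ih =>
    intro B hp hB
    obtain ⟨b, t, l, e⟩ := ih B ((le_max_left _ _).trans hp) hB
    have := hB.1 x
    exact ⟨b.mono (by omega), _, by nlinarith, .ite_pos hx e⟩
  | @ite_neg x p q σ τ s hx _ ih =>
    intro B hp hB
    obtain ⟨b, t, l, e⟩ := ih B ((le_max_right _ _).trans hp) hB
    have := hB.1 x
    exact ⟨b.mono (by omega), _, by nlinarith, .ite_neg hx e⟩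
  | @while_pos x p σ τ υ s t hx _ _ ih₁ ih₂ =>
    intro B hp hB
    obtain ⟨b₁, t₁, l₁, e₁⟩ := ih₁ B hp hB
    obtain ⟨b₂, t₂, l₂, e₂⟩ := ih₂ (B + s) (hp.trans (by omega)) b₁
    have := hB.1 x
    exact ⟨b₂.mono (by omega), _, by nlinarith, .while_pos hx e₁ e₂⟩
  | @while_neg x p σ hx =>
    intro B hp hB
    have := hB.1 x
    exact ⟨hB.mono (by omega), _, by omega, .while_neg hx⟩

/-- `p` leads from `σ` to `τ` in at most `t` steps. -/
def Runs (p : Prog) (σ : State) (t : ℕ) (τ : State) : Prop := ∃ s ≤ t, Steps p σ s τ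

namespace Runs

theorem mono {p : Prog} {σ τ : State} {t t' : ℕ} (h : Runs p σ t τ) (ht : t ≤ t') :
    Runs p σ t' τ :=
  let ⟨s, hs, k⟩ := h
  ⟨s, hs.trans ht, k⟩

theorem const (σ : State) (x : ℕ) (c : ℤ) : Runs (.const x c) σ 1 (σ.setReg x c) :=
  ⟨1, le_rfl, .const ..⟩

theorem add (σ : State) (x y z : ℕ) :
    Runs (.add x y z) σ 1 (σ.setReg x (σ.reg y + σ.reg z)) :=
  ⟨1, le_rfl, .add ..⟩

theorem sub (σ : State) (x y z : ℕ) :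
    Runs (.sub x y z) σ 1 (σ.setReg x (σ.reg y - σ.reg z)) :=
  ⟨1, le_rfl, .sub ..⟩

theorem load (σ : State) (x a y : ℕ) :
    Runs (.load x a y) σ 1 (σ.setReg x (σ.arr a (σ.reg y))) :=
  ⟨1, le_rfl, .load ..⟩

theorem store (σ : State) (a y x : ℕ) :
    Runs (.store a y x) σ 1 (σ.setArr a (σ.reg y) (σ.reg x)) :=
  ⟨1, le_rfl, .store ..⟩

theorem seq {p q : Prog} {σ τ υ : State} {s t : ℕ} (hp : Runs p σ s τ) (hq : Runs q τ t υ) :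
    Runs (.seq p q) σ (s + t) υ :=
  let ⟨_, h, k⟩ := hp
  let ⟨_, h', k'⟩ := hq
  ⟨_, add_le_add h h', .seq k k'⟩

theorem ite_pos {x : ℕ} {p q : Prog} {σ τ : State} {t : ℕ} (hx : 0 < σ.reg x)
    (hp : Runs p σ t τ) : Runs (.ite x p q) σ (1 + t) τ :=
  let ⟨_, h, k⟩ := hp
  ⟨_, by omega, .ite_pos hx k⟩

theorem ite_neg {x : ℕ} {p q : Prog} {σ τ : State} {t : ℕ} (hx : ¬ 0 < σ.reg x)
    (hq : Runs q σ t τ) : Runs (.ite x p q) σ (1 + t) τ :=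
  let ⟨_, h, k⟩ := hq
  ⟨_, by omega, .ite_neg hx k⟩

/-- A loop with an invariant that counts the rounds. -/
theorem while_of_invariant {x : ℕ} {p : Prog} (I : ℕ → State → Prop) {B T : ℕ}
    (hstep : ∀ j < B, ∀ σ, I j σ → 0 < σ.reg x ∧ ∃ τ, Runs p σ T τ ∧ I (j + 1) τ)
    (hend : ∀ σ, I B σ → ¬ 0 < σ.reg x) {σ : State} (hσ : I 0 σ) :
    ∃ τ, Runs (.while x p) σ (B * (T + 1) + 1) τ ∧ I B τ := by
  suffices H : ∀ k j, j + k = B → ∀ σ, I j σ →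
      ∃ τ, Runs (.while x p) σ (k * (T + 1) + 1) τ ∧ I B τ from H B 0 (by omega) σ hσ
  intro k
  induction k with
  | zero =>
    intro j hj σ hσ
    obtain rfl : j = B := by omega
    exact ⟨σ, ⟨1, by omega, .while_neg (hend σ hσ)⟩, hσ⟩
  | succ k ih =>
    intro j hj σ hσ
    obtain ⟨hx, τ, ⟨s, hs, hp⟩, hτ⟩ := hstep j (by omega) σ hσ
    obtain ⟨υ, ⟨t, ht, hw⟩, hυ⟩ := ih (j + 1) (by omega) τ hτ
    exact ⟨υ, ⟨_, by rw [Nat.succ_mul]; omega, .while_pos hx hp hw⟩, hυ⟩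

end Runs

end RAM

/-! ### Protected memory and counting loops. -/

namespace RAM

/-- Registers below `d` and arrays below `e` agree. -/
def Preserves (d e : ℕ) (σ τ : State) : Prop :=
  (∀ x < d, τ.reg x = σ.reg x) ∧ ∀ a < e, τ.arr a = σ.arr a

namespace Preserves

theorem refl (d e : ℕ) (σ : State) : Preserves d e σ σ := ⟨fun _ _ => rfl, fun _ _ => rfl⟩

theorem trans {d e : ℕ} {σ τ υ : State} (h : Preserves d e σ τ) (h' : Preserves d e τ υ) :
    Preserves d e σ υ :=
  ⟨fun x hx => (h'.1 x hx).trans (h.1 x hx), fun a ha => (h'.2 a ha).trans (h.2 a ha)⟩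

theorem mono {d e d' e' : ℕ} {σ τ : State} (h : Preserves d e σ τ) (hd : d' ≤ d) (he : e' ≤ e) :
    Preserves d' e' σ τ :=
  ⟨fun x hx => h.1 x (hx.trans_le hd), fun a ha => h.2 a (ha.trans_le he)⟩

theorem setReg {d e x : ℕ} {σ τ : State} {z : ℤ} (h : Preserves d e σ τ) (hx : d ≤ x) :
    Preserves d e σ (τ.setReg x z) :=
  ⟨fun y hy => by
    simp only [State.setReg]
    rw [Function.update_of_ne (by omega), h.1 y hy], h.2⟩

end Preserves

@[simp]
theorem State.setReg_reg (σ : State) (x y : ℕ) (z : ℤ) :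
    (σ.setReg x z).reg y = if y = x then z else σ.reg y := by
  simp [State.setReg, Function.update_apply]

@[simp]
theorem State.setReg_arr (σ : State) (x : ℕ) (z : ℤ) : (σ.setReg x z).arr = σ.arr := rfl

@[simp]
theorem State.setArr_reg (σ : State) (a : ℕ) (i z : ℤ) : (σ.setArr a i z).reg = σ.reg := rfl

@[simp]
theorem State.setArr_arr (σ : State) (a b : ℕ) (i j z : ℤ) :
    (σ.setArr a i z).arr b j = if b = a ∧ j = i then z else σ.arr b j := by
  by_cases h : b = a
  · subst h
    simp [State.setArr, Function.update_apply]
  · simp [State.setArr, h]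

/-- Executes `p` as often as register `d` says, with the number of the round in register
`d + 1`. -/
def Prog.forLoop (d : ℕ) (p : Prog) : Prog :=
  .seq (.const (d + 1) 0) (.while d (.seq p (.seq (.const (d + 3) 1)
    (.seq (.sub d d (d + 3)) (.add (d + 1) (d + 1) (d + 3))))))

theorem Runs.forLoop {d : ℕ} {p : Prog} {B T : ℕ} (J : ℕ → State → Prop)
    (stable : ∀ j σ τ, (∀ x, x ≠ d → x ≠ d + 1 → x ≠ d + 3 → τ.reg x = σ.reg x) →
      τ.arr = σ.arr → J j σ → J j τ)
    (step : ∀ j < B, ∀ σ, J j σ → σ.reg (d + 1) = j →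
      ∃ τ, Runs p σ T τ ∧ J (j + 1) τ ∧ τ.reg d = σ.reg d ∧ τ.reg (d + 1) = σ.reg (d + 1))
    {σ : State} (hB : σ.reg d = B) (h : J 0 σ) :
    ∃ τ, Runs (Prog.forLoop d p) σ (2 + B * (T + 4)) τ ∧ J B τ := by
  -- Register `d` counts down, `d + 1` counts up and `d + 3` holds the constant one; `stable` makes
  -- `J` insensitive to these three. Register `d + 2` remains free for an accumulator.
  obtain ⟨τ, hτ, -, -, h3⟩ := Runs.while_of_invariant (x := d)
    (p := .seq p (.seq (.const (d + 3) 1)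
      (.seq (.sub d d (d + 3)) (.add (d + 1) (d + 1) (d + 3)))))
    (fun j σ => σ.reg d = (B : ℤ) - j ∧ σ.reg (d + 1) = j ∧ J j σ) (B := B) (T := T + 3)
    (by
      rintro j hj σ ⟨h1, h2, h3⟩
      refine ⟨by omega, ?_⟩
      obtain ⟨τ, hτ, hJ, e1, e2⟩ := step j hj σ h3 h2
      refine ⟨_, (hτ.seq ((Runs.const ..).seq ((Runs.sub ..).seq (Runs.add ..)))).mono (by omega),
        ?_, ?_, ?_⟩
      · simp [e1, h1]
        ring
      · simp [e2, h2]
      · refine stable _ τ _ (fun x hx hx' hx'' => ?_) rfl hJ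
        simp [hx, hx', hx''])
    (by
      rintro σ ⟨h1, -, -⟩
      omega)
    (σ := σ.setReg (d + 1) 0)
    ⟨by simp [hB], by simp, stable _ σ _ (fun x hx hx' hx'' => by simp [hx']) rfl h⟩
  exact ⟨τ, ((Runs.const ..).seq hτ).mono (by ring_nf; omega), h3⟩

end RAM

/-! ### Memory layouts and functions computable in polynomially many steps. -/

namespace Voting

open RAM

/-- The data of a decision problem: partial profile, tie breaker, set of candidates, and a table
of scores. -/
structure Input where
  n : ℕ
  m : ℕ
  profile : PartialProfile n m
  tie : TieBreaker m
  set : Finset (Fin m)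
  table : ℕ → ℤ

namespace Input

/-- The size in terms of which running times are measured. -/
def size (I : Input) : ℕ := I.n + I.m + 1

/-- The memory holds the input. -/
structure Holds (I : Input) (σ : State) : Prop where
  reg_zero : σ.reg 0 = I.n
  reg_one : σ.reg 1 = I.m
  arr_zero : σ.arr 0 = (encode I.profile I.tie I.set).arr 0
  arr_one : σ.arr 1 = (encode I.profile I.tie I.set).arr 1
  arr_two : σ.arr 2 = (encode I.profile I.tie I.set).arr 2
  arr_three : ∀ j : ℕ, 1 ≤ j → j ≤ I.m → σ.arr 3 j = I.table j

end Input

/-- A memory layout for values in `Γ`, which occupy registers below `nreg` and arrays below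
`narr`. -/
structure Layout (Γ : Type) where
  input : Γ → Input
  rel : Γ → State → Prop
  nreg : ℕ
  narr : ℕ
  two_le : 2 ≤ nreg
  four_le : 4 ≤ narr
  holds : ∀ {γ σ}, rel γ σ → (input γ).Holds σ
  frame : ∀ {γ σ τ}, Preserves nreg narr σ τ → rel γ σ → rel γ τ

namespace Layout

variable {Γ : Type} (K : Layout Γ)

theorem frame' {d e : ℕ} {γ : Γ} {σ τ : State} (h : Preserves d e σ τ) (hd : K.nreg ≤ d)
    (he : K.narr ≤ e) (hγ : K.rel γ σ) : K.rel γ τ :=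
  K.frame (h.mono hd he) hγ

/-- The layout of the bare input. -/
def base : Layout Input where
  input := id
  rel I σ := I.Holds σ
  nreg := 2
  narr := 4
  two_le := le_rfl
  four_le := le_rfl
  holds := id
  frame := by
    intro I σ τ h hI
    refine ⟨?_, ?_, ?_, ?_, ?_, ?_⟩
    · rw [h.1 0 (by omega), hI.reg_zero]
    · rw [h.1 1 (by omega), hI.reg_one]
    · rw [h.2 0 (by omega), hI.arr_zero]
    · rw [h.2 1 (by omega), hI.arr_one]
    · rw [h.2 2 (by omega), hI.arr_two]
    · rw [h.2 3 (by omega)]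
      exact hI.arr_three

/-- The layout extended by a variable. -/
def pushVar (k : ℕ) : Layout (Γ × ℕ) where
  input γ := K.input γ.1
  rel γ σ := K.rel γ.1 σ ∧ σ.reg (K.nreg + k) = γ.2
  nreg := K.nreg + k + 1
  narr := K.narr
  two_le := by have := K.two_le; omega
  four_le := K.four_le
  holds h := K.holds h.1
  frame := by
    intro γ σ τ h hγ
    exact ⟨K.frame' h (by omega) le_rfl hγ.1, by rw [h.1 _ (by omega), hγ.2]⟩

/-- The layout extended by an array of length `len`. -/
def pushArr (len : Γ → ℕ) (k : ℕ) : Layout (Γ × (ℕ → ℤ)) where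
  input γ := K.input γ.1
  rel γ σ := K.rel γ.1 σ ∧ (∀ i < len γ.1, σ.arr (K.narr + k) (i : ℤ) = γ.2 i) ∧
    ∀ i, len γ.1 ≤ i → γ.2 i = 0
  nreg := K.nreg
  narr := K.narr + k + 1
  two_le := K.two_le
  four_le := by have := K.four_le; omega
  holds h := K.holds h.1
  frame := by
    intro γ σ τ h hγ
    exact ⟨K.frame' h le_rfl (by omega) hγ.1, by rw [h.2 _ (by omega)]; exact hγ.2⟩

/-- `b` is bounded by a polynomial in the size of the input. -/
def PolyBounded (b : Γ → ℕ) : Prop :=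
  ∃ B : Polynomial ℕ, ∀ γ, b γ ≤ B.eval (K.input γ).size

/-- `f` is computable in polynomially many steps, without touching a given part of the memory. -/
def Comp (f : Γ → ℤ) : Prop :=
  ∀ d e, K.nreg ≤ d → K.narr ≤ e → ∃ (p : Prog) (T : Polynomial ℕ), ∀ γ σ, K.rel γ σ →
    ∃ τ, Runs p σ (T.eval (K.input γ).size) τ ∧ Preserves d e σ τ ∧ τ.reg d = f γ

/-- Computability of a function with values in the natural numbers. -/
def CompN (f : Γ → ℕ) : Prop := K.Comp fun γ => (f γ : ℤ)

/-- The array `a` of length `len` is in memory. -/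
def HasArr (len : Γ → ℕ) (a : Γ → ℕ → ℤ) : Prop :=
  ∃ q < K.narr, ∀ γ σ, K.rel γ σ →
    (∀ i < len γ, σ.arr q (i : ℤ) = a γ i) ∧ ∀ i, len γ ≤ i → a γ i = 0

/-- The array with entries `g 0, …, g (len - 1)`. -/
def tab (len : ℕ) (g : ℕ → ℤ) (i : ℕ) : ℤ := if i < len then g i else 0

variable {K}

/-- A function of one layout can be computed from any layout that contains it. -/
theorem Comp.pullback {Γ' : Type} {K' : Layout Γ'} (φ : Γ' → Γ)
    (hrel : ∀ γ σ, K'.rel γ σ → K.rel (φ γ) σ) (hinput : ∀ γ, K'.input γ = K.input (φ γ))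
    (hreg : K.nreg ≤ K'.nreg) (harr : K.narr ≤ K'.narr) {f : Γ → ℤ} (h : K.Comp f) :
    K'.Comp fun γ => f (φ γ) := by
  intro d e hd he
  obtain ⟨p, T, hp⟩ := h d e (hreg.trans hd) (harr.trans he)
  exact ⟨p, T, fun γ σ hγ => by rw [hinput]; exact hp _ σ (hrel γ σ hγ)⟩

theorem Comp.up {f : Γ → ℤ} (h : K.Comp f) {k : ℕ} : (K.pushVar k).Comp fun γ => f γ.1 :=
  Comp.pullback (K := K) Prod.fst (fun _ _ hγ => And.left hγ) (fun _ => rfl) (by simp only [pushVar]; omega) le_rfl h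

theorem Comp.upArr {f : Γ → ℤ} (h : K.Comp f) {len : Γ → ℕ} {k : ℕ} :
    (K.pushArr len k).Comp fun γ => f γ.1 :=
  Comp.pullback (K := K) Prod.fst (fun _ _ hγ => And.left hγ) (fun _ => rfl) le_rfl (by simp only [pushArr]; omega) h

theorem CompN.up {f : Γ → ℕ} (h : K.CompN f) {k : ℕ} : (K.pushVar k).CompN fun γ => f γ.1 :=
  Comp.up h

theorem CompN.upArr {f : Γ → ℕ} (h : K.CompN f) {len : Γ → ℕ} {k : ℕ} :
    (K.pushArr len k).CompN fun γ => f γ.1 :=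
  Comp.upArr h

theorem HasArr.up {len : Γ → ℕ} {a : Γ → ℕ → ℤ} (h : K.HasArr len a) {k : ℕ} :
    (K.pushVar k).HasArr (fun γ => len γ.1) fun γ => a γ.1 :=
  let ⟨q, hq, h⟩ := h
  ⟨q, hq, fun γ σ hγ => h γ.1 σ hγ.1⟩

theorem hasArr_pushArr {len : Γ → ℕ} {k : ℕ} :
    (K.pushArr len k).HasArr (fun γ => len γ.1) fun γ => γ.2 :=
  ⟨K.narr + k, Nat.lt_succ_self _, fun _ _ hγ => hγ.2⟩

theorem PolyBounded.up {b : Γ → ℕ} (h : K.PolyBounded b) {k : ℕ} :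
    (K.pushVar k).PolyBounded fun γ => b γ.1 :=
  let ⟨B, hB⟩ := h
  ⟨B, fun γ => hB γ.1⟩

theorem PolyBounded.upArr {b : Γ → ℕ} (h : K.PolyBounded b) {len : Γ → ℕ} {k : ℕ} :
    (K.pushArr len k).PolyBounded fun γ => b γ.1 :=
  let ⟨B, hB⟩ := h
  ⟨B, fun γ => hB γ.1⟩

theorem polyBounded_const (c : ℕ) : K.PolyBounded fun _ => c :=
  ⟨Polynomial.C c, fun γ => by simp⟩

theorem polyBounded_n : K.PolyBounded fun γ => (K.input γ).n :=
  ⟨Polynomial.X, fun γ => by simp [Input.size]; omega⟩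

theorem polyBounded_m : K.PolyBounded fun γ => (K.input γ).m :=
  ⟨Polynomial.X, fun γ => by simp [Input.size]; omega⟩

theorem PolyBounded.add {a b : Γ → ℕ} (ha : K.PolyBounded a) (hb : K.PolyBounded b) :
    K.PolyBounded fun γ => a γ + b γ :=
  let ⟨A, hA⟩ := ha
  let ⟨B, hB⟩ := hb
  ⟨A + B, fun γ => by simpa using add_le_add (hA γ) (hB γ)⟩

theorem PolyBounded.mul {a b : Γ → ℕ} (ha : K.PolyBounded a) (hb : K.PolyBounded b) :
    K.PolyBounded fun γ => a γ * b γ :=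
  let ⟨A, hA⟩ := ha
  let ⟨B, hB⟩ := hb
  ⟨A * B, fun γ => by simpa using Nat.mul_le_mul (hA γ) (hB γ)⟩

theorem comp_const (c : ℤ) : K.Comp fun _ => c := by
  intro d e hd he
  refine ⟨.const d c, 1, fun γ σ _ => ⟨_, (Runs.const ..).mono (by simp), ?_, by simp⟩⟩
  exact (Preserves.refl d e σ).setReg le_rfl

theorem compN_const (c : ℕ) : K.CompN fun _ => c := comp_const _

/-- The value of a register that the layout protects. -/
theorem comp_reg {f : Γ → ℤ} (x : ℕ) (hx : x < K.nreg) (h : ∀ γ σ, K.rel γ σ → σ.reg x = f γ) :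
    K.Comp f := by
  intro d e hd he
  refine ⟨.seq (.const d 0) (.add d d x), 2, fun γ σ hγ => ⟨_,
    ((Runs.const ..).seq (Runs.add ..)).mono (by simp), ?_, ?_⟩⟩
  · exact ((Preserves.refl d e σ).setReg le_rfl).setReg le_rfl
  · simp [show x ≠ d by omega, h γ σ hγ]

theorem compN_var {k : ℕ} : (K.pushVar k).CompN fun γ => γ.2 :=
  comp_reg (K.nreg + k) (Nat.lt_succ_self _) fun _ _ h => h.2

theorem compN_n : K.CompN fun γ => (K.input γ).n :=
  comp_reg 0 (by have := K.two_le; omega) fun _ _ h => (K.holds h).reg_zero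

theorem compN_m : K.CompN fun γ => (K.input γ).m :=
  comp_reg 1 (by have := K.two_le; omega) fun _ _ h => (K.holds h).reg_one

/-- Two values, in consecutive registers. -/
theorem Comp.pair {f g : Γ → ℤ} (hf : K.Comp f) (hg : K.Comp g) (d e : ℕ) (hd : K.nreg ≤ d)
    (he : K.narr ≤ e) : ∃ (p : Prog) (T : Polynomial ℕ), ∀ γ σ, K.rel γ σ →
    ∃ τ, Runs p σ (T.eval (K.input γ).size) τ ∧ Preserves d e σ τ ∧ τ.reg d = f γ ∧
      τ.reg (d + 1) = g γ := by
  obtain ⟨p, T, hp⟩ := hf d e hd he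
  -- Starting the second scratch area at `d + 1` protects the first value. To allow this, `Comp`
  -- asks for a program for every scratch area.
  obtain ⟨q, U, hq⟩ := hg (d + 1) e (by omega) he
  refine ⟨.seq p q, T + U, fun γ σ hγ => ?_⟩
  obtain ⟨τ, h1, h2, h3⟩ := hp γ σ hγ
  obtain ⟨υ, k1, k2, k3⟩ := hq γ τ (K.frame' h2 hd he hγ)
  exact ⟨υ, (h1.seq k1).mono (by simp), h2.trans (k2.mono (by omega) le_rfl),
    by rw [k2.1 d (by omega), h3], k3⟩

theorem Comp.add {f g : Γ → ℤ} (hf : K.Comp f) (hg : K.Comp g) :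
    K.Comp fun γ => f γ + g γ := by
  intro d e hd he
  obtain ⟨p, T, hp⟩ := hf.pair hg d e hd he
  refine ⟨.seq p (.add d d (d + 1)), T + 1, fun γ σ hγ => ?_⟩
  obtain ⟨τ, h1, h2, h3, h4⟩ := hp γ σ hγ
  exact ⟨_, (h1.seq (Runs.add ..)).mono (by simp), h2.setReg le_rfl, by simp [h3, h4]⟩

theorem Comp.sub {f g : Γ → ℤ} (hf : K.Comp f) (hg : K.Comp g) :
    K.Comp fun γ => f γ - g γ := by
  intro d e hd he
  obtain ⟨p, T, hp⟩ := hf.pair hg d e hd he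
  refine ⟨.seq p (.sub d d (d + 1)), T + 1, fun γ σ hγ => ?_⟩
  obtain ⟨τ, h1, h2, h3, h4⟩ := hp γ σ hγ
  exact ⟨_, (h1.seq (Runs.sub ..)).mono (by simp), h2.setReg le_rfl, by simp [h3, h4]⟩

theorem Comp.ite_pos {c f g : Γ → ℤ} (hc : K.Comp c) (hf : K.Comp f) (hg : K.Comp g) :
    K.Comp fun γ => if 0 < c γ then f γ else g γ := by
  intro d e hd he
  obtain ⟨p, T, hp⟩ := hc d e hd he
  obtain ⟨q, U, hq⟩ := hf d e hd he
  obtain ⟨r, V, hr⟩ := hg d e hd he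
  refine ⟨.seq p (.ite d q r), T + 1 + U + V, fun γ σ hγ => ?_⟩
  obtain ⟨τ, h1, h2, h3⟩ := hp γ σ hγ
  have hτ := K.frame' h2 hd he hγ
  beta_reduce
  split_ifs with h
  · obtain ⟨υ, k1, k2, k3⟩ := hq γ τ hτ
    exact ⟨υ, (h1.seq (k1.ite_pos (by rwa [h3]))).mono (by simp; omega), h2.trans k2, k3⟩
  · obtain ⟨υ, k1, k2, k3⟩ := hr γ τ hτ
    exact ⟨υ, (h1.seq (k1.ite_neg (by rwa [h3]))).mono (by simp; omega), h2.trans k2, k3⟩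

theorem Comp.sum {b : Γ → ℕ} {g : Γ → ℕ → ℤ} (hb : K.CompN b) (hB : K.PolyBounded b)
    (hg : ∀ k, (K.pushVar k).Comp fun γ => g γ.1 γ.2) :
    K.Comp fun γ => ∑ i ∈ Finset.range (b γ), g γ i := by
  intro d e hd he
  obtain ⟨p, T, hp⟩ := hb d e hd he
  -- The gap places the summation variable in `d + 1`, the round number of the loop. The sum is kept
  -- in `d + 2`, and the summand arrives in `d + 3`, which the loop overwrites only after it has
  -- been added.
  obtain ⟨q, U, hq⟩ := hg (d + 1 - K.nreg) (d + 3) e (by simp only [pushVar]; omega) he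
  obtain ⟨B, hB⟩ := hB
  refine ⟨.seq p (.seq (.const (d + 2) 0) (.seq
    (Prog.forLoop d (.seq q (.add (d + 2) (d + 2) (d + 3))))
    (.seq (.const d 0) (.add d d (d + 2))))), T + (B * (U + 1 + 4) + 5), fun γ σ hγ => ?_⟩
  obtain ⟨τ, h1, h2, h3⟩ := hp γ σ hγ
  obtain ⟨υ, k1, k2⟩ := Runs.forLoop (d := d) (B := b γ) (T := U.eval (K.input γ).size + 1)
    (p := .seq q (.add (d + 2) (d + 2) (d + 3)))
    (fun j υ => Preserves d e σ υ ∧ υ.reg (d + 2) = ∑ i ∈ Finset.range j, g γ i)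
    (by
      rintro j σ' τ' hr ha ⟨h1, h2⟩
      exact ⟨⟨fun x hx => by rw [hr x (by omega) (by omega) (by omega), h1.1 x hx],
        fun a haa => by rw [ha, h1.2 a haa]⟩, by rw [hr _ (by omega) (by omega) (by omega), h2]⟩)
    (by
      rintro j hj σ' ⟨h1, h2⟩ hj'
      obtain ⟨τ', l1, l2, l3⟩ := hq (γ, j) σ'
        ⟨K.frame' h1 hd he hγ, by rw [← hj']; congr 1; omega⟩
      refine ⟨_, l1.seq (Runs.add ..), ⟨?_, ?_⟩, ?_, ?_⟩
      · exact (h1.trans (l2.mono (by omega) le_rfl)).setReg (by omega)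
      · simp only [State.setReg_reg, if_true, l3]
        rw [l2.1 _ (by omega), h2, Finset.sum_range_succ]
      · simp [l2.1 d (by omega)]
      · simp [l2.1 (d + 1) (by omega)])
    (σ := τ.setReg (d + 2) 0) (by simp [h3]) ⟨h2.setReg (by omega), by simp⟩
  refine ⟨_, (h1.seq ((Runs.const ..).seq (k1.seq ((Runs.const ..).seq (Runs.add ..))))).mono ?_,
    ?_, ?_⟩
  · have := Nat.mul_le_mul (hB γ) (le_refl (U.eval (K.input γ).size + 1 + 4))
    simp only [Polynomial.eval_add, Polynomial.eval_mul, Polynomial.eval_one,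
      Polynomial.eval_ofNat]
    omega
  · exact (k2.1.setReg le_rfl).setReg le_rfl
  · simp [k2.2]

theorem CompN.sum {b : Γ → ℕ} {g : Γ → ℕ → ℕ} (hb : K.CompN b) (hB : K.PolyBounded b)
    (hg : ∀ k, (K.pushVar k).CompN fun γ => g γ.1 γ.2) :
    K.CompN fun γ => ∑ i ∈ Finset.range (b γ), g γ i := by
  unfold CompN
  push_cast
  exact Comp.sum hb hB hg

/-- Memory beyond `len` is arbitrary while `a` vanishes there, so the index has to be compared with
the length before the access. -/
theorem Comp.load {len : Γ → ℕ} {a : Γ → ℕ → ℤ} {i : Γ → ℕ} (hl : K.CompN len)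
    (ha : K.HasArr len a) (hi : K.CompN i) : K.Comp fun γ => a γ (i γ) := by
  intro d e hd he
  obtain ⟨p, T, hp⟩ := Comp.pair hi hl d e hd he
  obtain ⟨q, hq, ha⟩ := ha
  refine ⟨.seq p (.seq (.sub (d + 1) (d + 1) d) (.ite (d + 1) (.load d q d) (.const d 0))),
    T + 3, fun γ σ hγ => ?_⟩
  obtain ⟨τ, h1, h2, h3, h4⟩ := hp γ σ hγ
  obtain ⟨a1, a2⟩ := ha γ τ (K.frame' h2 hd he hγ)
  by_cases h : i γ < len γ
  · refine ⟨_, (h1.seq ((Runs.sub ..).seq ((Runs.load ..).ite_pos ?_))).mono (by simp), ?_, ?_⟩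
    · simp [h3, h4, h]
    · exact (h2.setReg (by omega)).setReg le_rfl
    · simp [h3, a1 _ h]
  · refine ⟨_, (h1.seq ((Runs.sub ..).seq ((Runs.const ..).ite_neg ?_))).mono (by simp), ?_, ?_⟩
    · simp [h3, h4]
      omega
    · exact (h2.setReg (by omega)).setReg le_rfl
    · simp [a2 _ (not_lt.mp h)]

/-- Writes a computed function into an array. -/
theorem Comp.tabulate {len : Γ → ℕ} {g : Γ → ℕ → ℤ} (hl : K.CompN len) (hB : K.PolyBounded len)
    (hg : ∀ k, (K.pushVar k).Comp fun γ => g γ.1 γ.2) (d e q : ℕ) (hd : K.nreg ≤ d)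
    (he : K.narr ≤ e)
    (hq : ∀ {γ σ τ}, (∀ x < K.nreg, τ.reg x = σ.reg x) →
      (∀ a < K.narr, a ≠ q → τ.arr a = σ.arr a) → K.rel γ σ → K.rel γ τ) : ∃ (p : Prog) (T : Polynomial ℕ), ∀ γ σ, K.rel γ σ →
    ∃ τ, Runs p σ (T.eval (K.input γ).size) τ ∧ (∀ x < d, τ.reg x = σ.reg x) ∧
      (∀ a < e, a ≠ q → τ.arr a = σ.arr a) ∧ ∀ i < len γ, τ.arr q (i : ℤ) = g γ i := by
  -- Protecting the arrays up to `q` keeps the entries already written intact while later ones are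
  -- computed.
  obtain ⟨p, T, hp⟩ := hl d (max e (q + 1)) hd (by omega)
  obtain ⟨r, U, hr⟩ := hg (d + 1 - K.nreg) (d + 3) (max e (q + 1))
    (by simp only [pushVar]; omega) (by simp only [pushVar]; omega)
  obtain ⟨B, hB⟩ := hB
  refine ⟨.seq p (Prog.forLoop d (.seq r (.store q (d + 1) (d + 3)))), T + (B * (U + 1 + 4) + 2),
    fun γ σ hγ => ?_⟩
  obtain ⟨τ, h1, h2, h3⟩ := hp γ σ hγ
  obtain ⟨υ, k1, k2, k3, k4⟩ := Runs.forLoop (d := d) (B := len γ)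
    (T := U.eval (K.input γ).size + 1) (p := .seq r (.store q (d + 1) (d + 3)))
    (fun j υ => (∀ x < d, υ.reg x = σ.reg x) ∧ (∀ a < e, a ≠ q → υ.arr a = σ.arr a) ∧
      ∀ i < j, υ.arr q (i : ℤ) = g γ i)
    (by
      rintro j σ' τ' hr ha ⟨h1, h2, h3⟩
      exact ⟨fun x hx => by rw [hr x (by omega) (by omega) (by omega), h1 x hx],
        fun a haa hq => by rw [ha, h2 a haa hq], by rwa [ha]⟩)
    (by
      rintro j hj σ' ⟨h1, h2, h3⟩ hj'
      obtain ⟨τ', l1, l2, l3⟩ := hr (γ, j) σ'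
        ⟨hq (fun x hx => h1 x (by omega)) (fun a ha => h2 a (by omega)) hγ,
          by rw [← hj']; congr 1; omega⟩
      refine ⟨_, l1.seq (Runs.store ..), ⟨?_, ?_, ?_⟩, ?_, ?_⟩
      · exact fun x hx => by rw [State.setArr_reg, l2.1 x (by omega), h1 x hx]
      · intro a ha haq
        funext i
        rw [State.setArr_arr, if_neg (fun h => haq h.1), l2.2 a (by omega), h2 a ha haq]
      · intro i hi
        rw [State.setArr_arr, l2.1 _ (by omega), hj', l3]
        rcases Nat.lt_succ_iff_lt_or_eq.mp hi with h | rfl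
        · rw [if_neg (by simp; omega), l2.2 q (by omega), h3 i h]
        · simp
      · simp [l2.1 d (by omega)]
      · simp [l2.1 (d + 1) (by omega)])
    (σ := τ) (by simp [h3])
    ⟨h2.1, fun a ha _ => h2.2 a (by omega), by simp⟩
  refine ⟨υ, (h1.seq k1).mono ?_, k2, k3, k4⟩
  have := Nat.mul_le_mul (hB γ) (le_refl (U.eval (K.input γ).size + 1 + 4))
  simp only [Polynomial.eval_add, Polynomial.eval_mul, Polynomial.eval_one,
    Polynomial.eval_ofNat]
  omega

/-- Computations with an array that is updated step by step. -/
theorem Comp.iterate {len T : Γ → ℕ} {g : Γ → ℕ → ℤ} {s : Γ → (ℕ → ℤ) → ℕ → ℤ}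
    {f : Γ → (ℕ → ℤ) → ℤ} (hl : K.CompN len) (hlB : K.PolyBounded len) (hT : K.CompN T)
    (hTB : K.PolyBounded T) (hg : ∀ k, (K.pushVar k).Comp fun γ => g γ.1 γ.2)
    (hs : ∀ j k, ((K.pushArr len j).pushVar k).Comp fun γ => s γ.1.1 γ.1.2 γ.2)
    (hf : ∀ j, (K.pushArr len j).Comp fun γ => f γ.1 γ.2) :
    K.Comp fun γ => f γ ((fun a => tab (len γ) (s γ a))^[T γ] (tab (len γ) (g γ))) := by
  intro d e hd he
  have hj : K.narr + (e - K.narr) = e := by omega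
  -- Double buffering, since `s` may read every old entry: `p₁` fills array `e` with `g`; in each
  -- round `p₃` writes the new values to array `e + 1` and `p₄` copies them back to `e`; `p₅`
  -- evaluates `f` at the end.
  obtain ⟨p₁, T₁, h₁⟩ := Comp.tabulate hl hlB hg d e e hd he
    fun hr ha hγ => K.frame ⟨hr, fun a h => ha a h (by omega)⟩ hγ
  obtain ⟨p₂, T₂, h₂⟩ := hT d (e + 1) hd (by omega)
  obtain ⟨p₃, T₃, h₃⟩ := Comp.tabulate (K := K.pushArr len (e - K.narr)) hl.upArr hlB.upArr
    (g := fun γ => s γ.1 γ.2) (hs (e - K.narr)) (d + 3) (e + 1) (e + 1)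
    (by simp only [pushArr]; omega) (by simp only [pushArr]; omega)
    fun hr ha hγ => frame _ ⟨hr, fun a h => ha a h (by simp only [pushArr] at h; omega)⟩ hγ
  obtain ⟨p₄, T₄, h₄⟩ := Comp.tabulate (K := K.pushArr len (e + 1 - K.narr)) hl.upArr hlB.upArr
    (g := fun γ i => γ.2 i)
    (fun k => Comp.load hl.upArr.up hasArr_pushArr.up compN_var) (d + 3) (e + 2) e
    (by simp only [pushArr]; omega) (by simp only [pushArr]; omega)
    fun {γ σ τ} hr ha hγ => by
      simp only [pushArr] at hr ha hγ ⊢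
      exact ⟨K.frame ⟨hr, fun a h => ha a (by omega) (by omega)⟩ hγ.1,
        by rw [ha _ (by omega) (by omega)]; exact hγ.2⟩
  obtain ⟨p₅, T₅, h₅⟩ := hf (e - K.narr) d (e + 1) hd (by simp only [pushArr]; omega)
  obtain ⟨B, hB⟩ := hTB
  refine ⟨.seq p₁ (.seq p₂ (.seq (Prog.forLoop d (.seq p₃ p₄)) p₅)),
    T₁ + T₂ + (2 + B * (T₃ + T₄ + 4)) + T₅, fun γ σ hγ => ?_⟩
  obtain ⟨τ, h1, h2, h3, h4⟩ := h₁ γ σ hγ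
  have hστ : Preserves d e σ τ := ⟨h2, fun a ha => h3 a ha (by omega)⟩
  obtain ⟨υ, k1, k2, k3⟩ := h₂ γ τ (K.frame' hστ hd he hγ)
  have hrel : ∀ (a : ℕ → ℤ) (ν : State), Preserves d e σ ν →
      (∀ i < len γ, ν.arr e (i : ℤ) = a i) →
      (K.pushArr len (e - K.narr)).rel (γ, tab (len γ) a) ν := by
    intro a ν h h'
    refine ⟨K.frame' h hd he hγ, fun i hi => ?_, fun i hi => if_neg (not_lt.mpr hi)⟩
    rw [hj, h' i hi]
    exact (if_pos hi).symm
  have hrel' : ∀ (a : ℕ → ℤ) (ν : State), Preserves d e σ ν →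
      (∀ i < len γ, ν.arr (e + 1) (i : ℤ) = a i) →
      (K.pushArr len (e + 1 - K.narr)).rel (γ, tab (len γ) a) ν := by
    intro a ν h h'
    refine ⟨K.frame' h hd he hγ, fun i hi => ?_, fun i hi => if_neg (not_lt.mpr hi)⟩
    rw [show K.narr + (e + 1 - K.narr) = e + 1 by omega, h' i hi]
    exact (if_pos hi).symm
  have htab : ∀ (a : ℕ → ℤ), tab (len γ) (tab (len γ) a) = tab (len γ) a := by
    intro a
    funext i
    simp only [tab]
    split_ifs <;> rfl
  set F : (ℕ → ℤ) → ℕ → ℤ := fun a => tab (len γ) (s γ a) with hF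
  -- `pushArr` describes arrays that vanish beyond `len`; every iterate is already of this kind.
  have hiter : ∀ j, tab (len γ) (F^[j] (tab (len γ) (g γ))) = F^[j] (tab (len γ) (g γ)) := by
    intro j
    cases j with
    | zero => exact htab _
    | succ j =>
      rw [Function.iterate_succ_apply', hF]
      exact htab _
  obtain ⟨ν, l1, l2, l3⟩ := Runs.forLoop (d := d) (B := T γ)
    (T := T₃.eval (K.input γ).size + T₄.eval (K.input γ).size) (p := .seq p₃ p₄)
    (fun j ν => Preserves d e σ ν ∧
      ∀ i < len γ, ν.arr e (i : ℤ) = (F^[j] (tab (len γ) (g γ))) i)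
    (by
      rintro j σ' τ' hr ha ⟨h1, h2⟩
      exact ⟨⟨fun x hx => by rw [hr x (by omega) (by omega) (by omega), h1.1 x hx],
        fun a haa => by rw [ha, h1.2 a haa]⟩, by rwa [ha]⟩)
    (by
      rintro j hj σ' ⟨h1, h2⟩ hj'
      obtain ⟨τ', m1, m2, m3, m4⟩ := h₃ _ σ' (hrel _ σ' h1 h2)
      obtain ⟨υ', n1, n2, n3, n4⟩ := h₄ _ τ' (hrel' _ τ'
        (h1.trans ⟨fun x hx => m2 x (by omega), fun a ha => m3 a (by omega) (by omega)⟩) m4)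
      refine ⟨υ', m1.seq n1, ⟨h1.trans (Preserves.trans
        ⟨fun x hx => m2 x (by omega), fun a ha => m3 a (by omega) (by omega)⟩
        ⟨fun x hx => n2 x (by omega), fun a ha => n3 a (by omega) (by omega)⟩), ?_⟩, ?_, ?_⟩
      · intro i hi
        rw [n4 i hi, Function.iterate_succ_apply', hiter]
      · rw [n2 d (by omega), m2 d (by omega)]
      · rw [n2 _ (by omega), m2 _ (by omega)])
    (σ := υ) k3 ⟨hστ.trans (k2.mono le_rfl (by omega)), fun i hi => by
      rw [k2.2 e (by omega), h4 i hi]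
      exact (if_pos hi).symm⟩
  obtain ⟨ω, m1, m2, m3⟩ := h₅ _ ν (hrel _ ν l2 l3)
  refine ⟨ω, (h1.seq (k1.seq (l1.seq m1))).mono ?_, l2.trans (m2.mono le_rfl (by omega)), ?_⟩
  · have := Nat.mul_le_mul (hB γ)
      (le_refl (T₃.eval (K.input γ).size + T₄.eval (K.input γ).size + 4))
    simp only [Polynomial.eval_add, Polynomial.eval_mul, Polynomial.eval_ofNat, pushArr]
    omega
  · rw [m3]
    exact congrArg (f γ) (hiter _)

end Layout

end Voting

/-! ### Decidable predicates, bounded counting and bounded search. -/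

namespace Voting

open RAM

namespace Layout

variable {Γ : Type} {K : Layout Γ}

open Classical in
/-- `p` is decidable in polynomially many steps. -/
def CompP (K : Layout Γ) (p : Γ → Prop) : Prop := K.Comp fun γ => if p γ then 1 else 0

theorem CompP.congr {p q : Γ → Prop} (h : K.CompP p) (hpq : ∀ γ, p γ ↔ q γ) : K.CompP q := by
  rwa [← funext fun γ => propext (hpq γ)]

theorem Comp.congr {f g : Γ → ℤ} (h : K.Comp f) (hfg : ∀ γ, f γ = g γ) : K.Comp g := by
  rwa [← funext hfg]

theorem Comp.ite {p : Γ → Prop} [∀ γ, Decidable (p γ)] {f g : Γ → ℤ} (hp : K.CompP p)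
    (hf : K.Comp f) (hg : K.Comp g) : K.Comp fun γ => if p γ then f γ else g γ :=
  (Comp.ite_pos hp hf hg).congr fun γ => by by_cases h : p γ <;> simp [h]

theorem CompN.ite {p : Γ → Prop} [∀ γ, Decidable (p γ)] {f g : Γ → ℕ} (hp : K.CompP p)
    (hf : K.CompN f) (hg : K.CompN g) : K.CompN fun γ => if p γ then f γ else g γ := by
  refine (Comp.ite hp hf hg).congr fun γ => ?_
  beta_reduce
  split_ifs <;> rfl

theorem CompN.add {f g : Γ → ℕ} (hf : K.CompN f) (hg : K.CompN g) :
    K.CompN fun γ => f γ + g γ :=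
  (Comp.add hf hg).congr fun γ => by push_cast; rfl

theorem CompN.indicator {p : Γ → Prop} [∀ γ, Decidable (p γ)] (hp : K.CompP p) :
    K.CompN fun γ => if p γ then 1 else 0 :=
  CompN.ite hp (compN_const 1) (compN_const 0)

theorem CompP.lt {f g : Γ → ℤ} (hf : K.Comp f) (hg : K.Comp g) : K.CompP fun γ => f γ < g γ :=
  (Comp.ite_pos (hg.sub hf) (comp_const 1) (comp_const 0)).congr fun γ => by
    simp only [sub_pos]
    congr

theorem CompP.not {p : Γ → Prop} (hp : K.CompP p) : K.CompP fun γ => ¬ p γ := by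
  classical
  exact (Comp.ite hp (comp_const 0) (comp_const 1)).congr fun γ => by
    by_cases h : p γ <;> simp [h]

theorem CompP.and {p q : Γ → Prop} (hp : K.CompP p) (hq : K.CompP q) :
    K.CompP fun γ => p γ ∧ q γ := by
  classical
  exact (Comp.ite hp hq (comp_const 0)).congr fun γ => by
    by_cases h : p γ <;> simp [h]

theorem CompP.or {p q : Γ → Prop} (hp : K.CompP p) (hq : K.CompP q) :
    K.CompP fun γ => p γ ∨ q γ :=
  (hp.not.and hq.not).not.congr fun γ => by tauto

theorem CompP.imp {p q : Γ → Prop} (hp : K.CompP p) (hq : K.CompP q) :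
    K.CompP fun γ => p γ → q γ :=
  (hp.and hq.not).not.congr fun γ => by tauto

theorem CompP.le {f g : Γ → ℤ} (hf : K.Comp f) (hg : K.Comp g) : K.CompP fun γ => f γ ≤ g γ :=
  (CompP.lt hg hf).not.congr fun _ => not_lt

theorem CompP.eq {f g : Γ → ℤ} (hf : K.Comp f) (hg : K.Comp g) : K.CompP fun γ => f γ = g γ :=
  ((CompP.le hf hg).and (CompP.le hg hf)).congr fun _ => le_antisymm_iff.symm

theorem CompP.ltN {f g : Γ → ℕ} (hf : K.CompN f) (hg : K.CompN g) :
    K.CompP fun γ => f γ < g γ :=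
  (CompP.lt hf hg).congr fun _ => Nat.cast_lt

theorem CompP.leN {f g : Γ → ℕ} (hf : K.CompN f) (hg : K.CompN g) :
    K.CompP fun γ => f γ ≤ g γ :=
  (CompP.le hf hg).congr fun _ => Nat.cast_le

theorem CompP.eqN {f g : Γ → ℕ} (hf : K.CompN f) (hg : K.CompN g) :
    K.CompP fun γ => f γ = g γ :=
  (CompP.eq hf hg).congr fun _ => Nat.cast_inj

theorem CompP.exists_lt {b : Γ → ℕ} {p : Γ → ℕ → Prop} (hb : K.CompN b) (hB : K.PolyBounded b)
    (hp : ∀ k, (K.pushVar k).CompP fun γ => p γ.1 γ.2) :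
    K.CompP fun γ => ∃ i < b γ, p γ i := by
  classical
  refine (CompP.lt (comp_const 0)
    (Comp.sum (g := fun γ i => if p γ i then 1 else 0) hb hB hp)).congr fun γ => ?_
  rw [Finset.sum_boole, Nat.cast_pos, Finset.card_pos]
  simp [Finset.filter_nonempty_iff]

theorem CompP.forall_lt {b : Γ → ℕ} {p : Γ → ℕ → Prop} (hb : K.CompN b) (hB : K.PolyBounded b)
    (hp : ∀ k, (K.pushVar k).CompP fun γ => p γ.1 γ.2) :
    K.CompP fun γ => ∀ i < b γ, p γ i :=
  (CompP.exists_lt (p := fun γ i => ¬ p γ i) hb hB fun k => (hp k).not).not.congr fun γ => by push Not; rfl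

end Layout

open Classical in
/-- The number of `i < b` with `p i`. -/
noncomputable def countBelow (b : ℕ) (p : ℕ → Prop) : ℕ :=
  ∑ i ∈ Finset.range b, if p i then 1 else 0

theorem countBelow_eq_card (b : ℕ) (p : ℕ → Prop) [DecidablePred p] :
    countBelow b p = ((Finset.range b).filter p).card := by
  rw [countBelow, Finset.card_filter]
  congr! 2

theorem countBelow_fin (b : ℕ) (p : Fin b → Prop) [DecidablePred p] (q : ℕ → Prop)
    (h : ∀ i : Fin b, q i ↔ p i) : countBelow b q = (Finset.univ.filter p).card := by
  rw [countBelow, Finset.card_filter, Finset.sum_range]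
  refine Finset.sum_congr rfl fun i _ => ?_
  by_cases hi : p i <;> simp [h, hi]

/-- The least `i < b` with `p i`, or `b` if there is none. -/
noncomputable def leastBelow (b : ℕ) (p : ℕ → Prop) : ℕ :=
  countBelow b fun j => ∀ i < b, i ≤ j → ¬ p i

/-- The numbers counted by `leastBelow` are exactly those below the first solution. Writing the
minimum as a count reduces the search to bounded sums. -/
theorem leastBelow_spec {b : ℕ} {p : ℕ → Prop} (h : ∃ i < b, p i) :
    leastBelow b p < b ∧ p (leastBelow b p) := by
  classical
  have h1 := Nat.find_spec h
  suffices H : leastBelow b p = Nat.find h by rwa [H]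
  rw [leastBelow, countBelow_eq_card]
  convert Finset.card_range (Nat.find h) using 2
  ext j
  simp only [Finset.mem_filter, Finset.mem_range]
  constructor
  · rintro ⟨-, hj⟩
    by_contra hlt
    exact hj _ h1.1 (not_lt.mp hlt) h1.2
  · exact fun hj => ⟨hj.trans h1.1, fun i hi hij hp => Nat.find_min h (hij.trans_lt hj) ⟨hi, hp⟩⟩

theorem leastBelow_lt_iff {b : ℕ} {p : ℕ → Prop} : leastBelow b p < b ↔ ∃ i < b, p i := by
  classical
  refine ⟨fun h => ?_, fun h => (leastBelow_spec h).1⟩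
  by_contra hne
  push Not at hne
  refine h.ne ?_
  rw [leastBelow, countBelow_eq_card]
  convert Finset.card_range b using 2
  exact Finset.filter_true_of_mem fun j _ i hi _ => hne i hi

namespace Layout

variable {Γ : Type} {K : Layout Γ}

theorem CompN.countBelow {b : Γ → ℕ} {p : Γ → ℕ → Prop} (hb : K.CompN b)
    (hB : K.PolyBounded b) (hp : ∀ k, (K.pushVar k).CompP fun γ => p γ.1 γ.2) :
    K.CompN fun γ => countBelow (b γ) (p γ) := by
  classical
  exact CompN.sum hb hB fun k => CompN.indicator (hp k)

/-- Insertion of an unused variable before the last one. -/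
theorem Comp.skip {f : Γ → ℕ → ℤ} (hf : ∀ k, (K.pushVar k).Comp fun γ => f γ.1 γ.2) {k k' : ℕ} :
    ((K.pushVar k).pushVar k').Comp fun γ => f γ.1.1 γ.2 :=
  -- With this gap the last variable occupies the same register in both layouts.
  Comp.pullback (K := K.pushVar (k + 1 + k')) (fun γ : (Γ × ℕ) × ℕ => (γ.1.1, γ.2))
    (fun _ σ h => ⟨(And.left h).1, (congrArg σ.reg (by simp only [pushVar]; omega)).trans
      (And.right h)⟩) (fun _ => rfl)
    (by simp only [pushVar]; omega) le_rfl (hf _)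

open Classical in
theorem CompP.skip {p : Γ → ℕ → Prop} (hp : ∀ k, (K.pushVar k).CompP fun γ => p γ.1 γ.2)
    {k k' : ℕ} : ((K.pushVar k).pushVar k').CompP fun γ => p γ.1.1 γ.2 :=
  Comp.skip (f := fun γ i => if p γ i then 1 else 0) hp

theorem CompN.leastBelow {b : Γ → ℕ} {p : Γ → ℕ → Prop} (hb : K.CompN b)
    (hB : K.PolyBounded b) (hp : ∀ k, (K.pushVar k).CompP fun γ => p γ.1 γ.2) :
    K.CompN fun γ => leastBelow (b γ) (p γ) := by
  refine CompN.countBelow (p := fun γ j => ∀ i < b γ, i ≤ j → ¬ p γ i) hb hB fun k =>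
    CompP.forall_lt (p := fun γ i => i ≤ γ.2 → ¬ p γ.1 i) hb.up hB.up fun k' =>
      CompP.imp (CompP.leN compN_var compN_var.up) (CompP.not ?_)
  exact CompP.skip hp

/-- Multiplication is repeated addition, so one factor has to be polynomially bounded. -/
theorem CompN.mul {a b : Γ → ℕ} (ha : K.CompN a) (hA : K.PolyBounded a) (hb : K.CompN b) :
    K.CompN fun γ => a γ * b γ := by
  have := CompN.sum (g := fun γ _ => b γ) ha hA fun k => hb.up
  simpa using this

/-! ### Access to the input -/

/-- An entry of an array that the layout protects. -/
theorem comp_arr {f : Γ → ℤ} {i : Γ → ℕ} (a : ℕ) (ha : a < 4) (hi : K.CompN i)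
    (h : ∀ γ σ, K.rel γ σ → σ.arr a (i γ) = f γ) : K.Comp f := by
  intro d e hd he
  obtain ⟨p, T, hp⟩ := hi d e hd he
  refine ⟨.seq p (.load d a d), T + 1, fun γ σ hγ => ?_⟩
  obtain ⟨τ, h1, h2, h3⟩ := hp γ σ hγ
  refine ⟨_, (h1.seq (Runs.load ..)).mono (by simp), h2.setReg le_rfl, ?_⟩
  have := K.four_le
  simp [h3, h2.2 a (by omega), h γ σ hγ]

end Layout

namespace Input

variable (I : Input)

/-- Voter `v` prefers candidate `a` to candidate `b` in the partial profile. -/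
def Prefers (v a b : ℕ) : Prop :=
  ∃ (hv : v < I.n) (ha : a < I.m) (hb : b < I.m), I.profile.prefers ⟨v, hv⟩ ⟨a, ha⟩ ⟨b, hb⟩

/-- The tie breaker puts `a` before `b`. -/
def Before (a b : ℕ) : Prop :=
  ∃ (ha : a < I.m) (hb : b < I.m), I.tie.before ⟨a, ha⟩ ⟨b, hb⟩

/-- Candidate `a` is in the given set. -/
def Mem (a : ℕ) : Prop := ∃ ha : a < I.m, (⟨a, ha⟩ : Fin I.m) ∈ I.set

end Input

namespace Layout

variable {Γ : Type} {K : Layout Γ}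

theorem index_inj {m a a' b b' : ℕ} (hb : b < m) (hb' : b' < m) (h : a * m + b = a' * m + b') :
    a = a' ∧ b = b' := by
  have hm : 0 < m := by omega
  have h1 := congrArg (· / m) h
  have h2 := congrArg (· % m) h
  simp only [Nat.mul_add_mod_self_right, Nat.mod_eq_of_lt hb, Nat.mod_eq_of_lt hb'] at h2
  simp only [add_comm _ b, add_comm _ b', Nat.add_mul_div_right _ _ hm, Nat.div_eq_of_lt hb,
    Nat.div_eq_of_lt hb', zero_add] at h1
  exact ⟨h1, h2⟩

theorem CompN.index {a b : Γ → ℕ} (ha : K.CompN a) (hb : K.CompN b) :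
    K.CompN fun γ => a γ * (K.input γ).m + b γ := by
  refine CompN.add ?_ hb
  have := compN_m.mul polyBounded_m ha
  simpa only [mul_comm] using this

/-- The range tests are needed because a cell index determines its row and column only for entries
below `m`. -/
theorem compP_prefers {v a b : Γ → ℕ} (hv : K.CompN v) (ha : K.CompN a) (hb : K.CompN b) :
    K.CompP fun γ => (K.input γ).Prefers (v γ) (a γ) (b γ) := by
  classical
  have h := (((CompP.ltN hv compN_n).and (CompP.ltN ha compN_m)).and
    (CompP.ltN hb compN_m)).and (CompP.lt (comp_const 0) (comp_arr (K := K)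
      (f := fun γ => (encode (K.input γ).profile (K.input γ).tie (K.input γ).set).arr 0
        (((v γ * (K.input γ).m + a γ) * (K.input γ).m + b γ : ℕ) : ℤ)) 0 (by omega)
      ((hv.index ha).index hb) fun γ σ hγ => by rw [(K.holds hγ).arr_zero]))
  refine h.congr fun γ => ?_
  constructor
  · rintro ⟨⟨⟨h1, h2⟩, h3⟩, h4⟩
    refine ⟨h1, h2, h3, ?_⟩
    by_contra hne
    simp only [encode, if_true] at h4
    rw [if_neg] at h4
    · exact lt_irrefl _ h4
    · rintro ⟨v', a', b', h5, h6⟩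
      obtain ⟨h7, h8⟩ := index_inj h3 b'.2 (by exact_mod_cast h5)
      obtain ⟨h9, h10⟩ := index_inj h2 a'.2 h7
      apply hne
      convert h6
  · rintro ⟨h1, h2, h3, h4⟩
    refine ⟨⟨⟨h1, h2⟩, h3⟩, ?_⟩
    simp only [encode, if_true]
    rw [if_pos ⟨⟨v γ, h1⟩, ⟨a γ, h2⟩, ⟨b γ, h3⟩, rfl, h4⟩]
    exact one_pos

theorem compP_before {a b : Γ → ℕ} (ha : K.CompN a) (hb : K.CompN b) :
    K.CompP fun γ => (K.input γ).Before (a γ) (b γ) := by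
  classical
  have h := ((CompP.ltN ha compN_m).and
    (CompP.ltN hb compN_m)).and (CompP.lt (comp_const 0) (comp_arr (K := K)
      (f := fun γ => (encode (K.input γ).profile (K.input γ).tie (K.input γ).set).arr 1
        ((a γ * (K.input γ).m + b γ : ℕ) : ℤ)) 1 (by omega)
      (ha.index hb) fun γ σ hγ => by rw [(K.holds hγ).arr_one]))
  refine h.congr fun γ => ?_
  constructor
  · rintro ⟨⟨h2, h3⟩, h4⟩
    refine ⟨h2, h3, ?_⟩
    by_contra hne
    simp only [encode, one_ne_zero, if_false, if_true] at h4
    rw [if_neg] at h4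
    · exact lt_irrefl _ h4
    · rintro ⟨a', b', h5, h6⟩
      obtain ⟨h7, h8⟩ := index_inj h3 b'.2 (by exact_mod_cast h5)
      apply hne
      convert h6
  · rintro ⟨h2, h3, h4⟩
    refine ⟨⟨h2, h3⟩, ?_⟩
    simp only [encode, one_ne_zero, if_false, if_true]
    rw [if_pos ⟨⟨a γ, h2⟩, ⟨b γ, h3⟩, rfl, h4⟩]
    exact one_pos

theorem compP_mem {a : Γ → ℕ} (ha : K.CompN a) :
    K.CompP fun γ => (K.input γ).Mem (a γ) := by
  classical
  have h := (CompP.ltN ha compN_m).and (CompP.lt (comp_const 0) (comp_arr (K := K)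
      (f := fun γ => (encode (K.input γ).profile (K.input γ).tie (K.input γ).set).arr 2
        (a γ : ℤ)) 2 (by omega) ha fun γ σ hγ => by rw [(K.holds hγ).arr_two]))
  refine h.congr fun γ => ?_
  constructor
  · rintro ⟨h2, h4⟩
    refine ⟨h2, ?_⟩
    by_contra hne
    simp only [encode, OfNat.ofNat_ne_zero, OfNat.ofNat_ne_one, if_false, if_true] at h4
    rw [if_neg] at h4
    · exact lt_irrefl _ h4
    · rintro ⟨a', h5, h6⟩
      have h7 : a γ = a' := by exact_mod_cast h5
      apply hne
      convert h6
  · rintro ⟨h2, h4⟩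
    refine ⟨h2, ?_⟩
    simp only [encode, OfNat.ofNat_ne_zero, OfNat.ofNat_ne_one, if_false, if_true]
    rw [if_pos ⟨⟨a γ, h2⟩, rfl, h4⟩]
    exact one_pos

open Classical in
/-- The score in the table for position `j`. -/
theorem comp_table {j : Γ → ℕ} (hj : K.CompN j) :
    K.Comp fun γ => if 1 ≤ j γ ∧ j γ ≤ (K.input γ).m then (K.input γ).table (j γ) else 0 := by
  intro d e hd he
  have hp : K.CompP fun γ => 1 ≤ j γ ∧ j γ ≤ (K.input γ).m :=
    (CompP.leN (compN_const 1) hj).and (CompP.leN hj compN_m)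
  obtain ⟨p, T, hp⟩ := Comp.pair hj hp d e hd he
  refine ⟨.seq p (.ite (d + 1) (.load d 3 d) (.const d 0)), T + 2, fun γ σ hγ => ?_⟩
  obtain ⟨τ, h1, h2, h3, h4⟩ := hp γ σ hγ
  have hτ := K.holds (K.frame' h2 hd he hγ)
  beta_reduce
  split_ifs at h4 ⊢ with h
  · refine ⟨_, (h1.seq ((Runs.load ..).ite_pos ?_)).mono (by simp), h2.setReg le_rfl, ?_⟩
    · simp [h4]
    · simp [h3, hτ.arr_three _ h.1 h.2]
  · refine ⟨_, (h1.seq ((Runs.const ..).ite_neg ?_)).mono (by simp), h2.setReg le_rfl, ?_⟩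
    · simp [h4]
    · simp

end Layout

end Voting

/-! ### Running a given program as a subroutine. -/

namespace RAM

/-- A bound for the registers that a program mentions. -/
def Prog.regBound : Prog → ℕ
  | .const x _ => x + 1
  | .add x y z => max (x + 1) (max (y + 1) (z + 1))
  | .sub x y z => max (x + 1) (max (y + 1) (z + 1))
  | .load x _ y => max (x + 1) (y + 1)
  | .store _ y x => max (x + 1) (y + 1)
  | .seq p q => max p.regBound q.regBound
  | .ite x p q => max (x + 1) (max p.regBound q.regBound)
  | .while x p => max (x + 1) p.regBound

/-- The program relocated to the registers from `8` on and to the arrays from `4` on. Every array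
is accompanied by an array of time stamps: a cell counts as `0` unless its stamp is larger than
register `3`; register `2` holds the current time. -/
def Prog.relocate : Prog → Prog
  | .const x c => .const (x + 8) c
  | .add x y z => .add (x + 8) (y + 8) (z + 8)
  | .sub x y z => .sub (x + 8) (y + 8) (z + 8)
  | .load x a y => .seq (.load 6 (2 * a + 5) (y + 8)) (.seq (.sub 6 6 3)
      (.ite 6 (.load (x + 8) (2 * a + 4) (y + 8)) (.const (x + 8) 0)))
  | .store a y x => .seq (.store (2 * a + 4) (y + 8) (x + 8)) (.store (2 * a + 5) (y + 8) 2)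
  | .seq p q => .seq p.relocate q.relocate
  | .ite x p q => .ite (x + 8) p.relocate q.relocate
  | .while x p => .while (x + 8) p.relocate

/-- The state `τ` of the relocated program represents the state `σ` at time `c + 1`. -/
structure Represents (R : ℕ) (c : ℤ) (σ τ : State) : Prop where
  reg : ∀ x < R, τ.reg (x + 8) = σ.reg x
  arr : ∀ a i, σ.arr a i = if c < τ.arr (2 * a + 5) i then τ.arr (2 * a + 4) i else 0
  time : τ.reg 2 = c + 1
  last : τ.reg 3 = c
  stamp : ∀ a i, τ.arr (2 * a + 5) i ≤ c + 1

/-- What a relocated program leaves unchanged. -/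
def Untouched (σ τ : State) : Prop :=
  (∀ x < 8, x ≠ 6 → τ.reg x = σ.reg x) ∧ ∀ a < 4, τ.arr a = σ.arr a

theorem Untouched.trans {σ τ υ : State} (h : Untouched σ τ) (h' : Untouched τ υ) :
    Untouched σ υ :=
  ⟨fun x hx hx' => (h'.1 x hx hx').trans (h.1 x hx hx'),
    fun a ha => (h'.2 a ha).trans (h.2 a ha)⟩

theorem Represents.setReg {R : ℕ} {c : ℤ} {σ τ : State} (h : Represents R c σ τ) (x : ℕ) (z : ℤ) :
    Represents R c (σ.setReg x z) (τ.setReg (x + 8) z) where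
  reg y hy := by
    simp only [State.setReg_reg, add_left_inj]
    split_ifs
    exacts [rfl, h.reg y hy]
  arr := h.arr
  time := by simpa using h.time
  last := by simpa using h.last
  stamp := h.stamp

theorem Represents.scratch {R : ℕ} {c : ℤ} {σ τ : State} (h : Represents R c σ τ) (z : ℤ) :
    Represents R c σ (τ.setReg 6 z) where
  reg y hy := by simpa using h.reg y hy
  arr := h.arr
  time := by simpa using h.time
  last := by simpa using h.last
  stamp := h.stamp

theorem untouched_setReg (τ : State) (x : ℕ) (z : ℤ) : Untouched τ (τ.setReg (x + 8) z) :=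
  ⟨fun y hy _ => by simp; omega, fun _ _ => rfl⟩

theorem untouched_scratch (τ : State) (z : ℤ) : Untouched τ (τ.setReg 6 z) :=
  ⟨fun y _ hy => by simp [hy], fun _ _ => rfl⟩

/-- The factor `4` comes from `load`: read the stamp, subtract the threshold, test, then read the
cell or write `0`. Stamps make it unnecessary to erase the arrays between calls, where the addresses
used are not known in advance. -/
theorem Steps.relocate {p : Prog} {σ σ' : State} {k R : ℕ} {c : ℤ} (h : Steps p σ k σ') :
    p.regBound ≤ R → ∀ τ, Represents R c σ τ →
      ∃ τ', Runs p.relocate τ (4 * k) τ' ∧ Represents R c σ' τ' ∧ Untouched τ τ' := by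
  induction h with
  | const σ x z =>
    intro hp τ h
    exact ⟨_, (Runs.const ..).mono (by omega), h.setReg x z, untouched_setReg ..⟩
  | add σ x y z =>
    intro hp τ h
    simp only [Prog.regBound] at hp
    refine ⟨_, (Runs.add ..).mono (by omega), ?_, untouched_setReg ..⟩
    rw [h.reg y (by omega), h.reg z (by omega)]
    exact h.setReg _ _
  | sub σ x y z =>
    intro hp τ h
    simp only [Prog.regBound] at hp
    refine ⟨_, (Runs.sub ..).mono (by omega), ?_, untouched_setReg ..⟩
    rw [h.reg y (by omega), h.reg z (by omega)]
    exact h.setReg _ _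
  | load σ x a y =>
    intro hp τ h
    simp only [Prog.regBound] at hp
    have hy := h.reg y (by omega)
    have hu : Untouched τ ((τ.setReg 6 (τ.arr (2 * a + 5) (σ.reg y))).setReg 6
        (τ.arr (2 * a + 5) (σ.reg y) - c)) := (untouched_scratch ..).trans (untouched_scratch ..)
    have h1 := Runs.load τ 6 (2 * a + 5) (y + 8)
    rw [hy] at h1
    have h2 := Runs.sub (τ.setReg 6 (τ.arr (2 * a + 5) (σ.reg y))) 6 6 3
    simp only [State.setReg_reg, if_true, show ¬ (3 = 6) by omega, if_false, h.last] at h2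
    by_cases hc : c < τ.arr (2 * a + 5) (σ.reg y)
    · refine ⟨_, (h1.seq (h2.seq ((Runs.load ..).ite_pos ?_))).mono (by omega), ?_,
        hu.trans (untouched_setReg ..)⟩
      · simpa using hc
      · convert ((h.scratch _).scratch _).setReg x _ using 2
        simp only [State.setReg_reg, State.setReg_arr]
        rw [if_neg (by omega), if_neg (by omega), hy, h.arr, if_pos hc]
    · refine ⟨_, (h1.seq (h2.seq ((Runs.const ..).ite_neg ?_))).mono (by omega), ?_,
        hu.trans (untouched_setReg ..)⟩
      · simpa using hc
      · convert ((h.scratch _).scratch _).setReg x _ using 2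
        rw [h.arr, if_neg hc]
  | store σ a y x =>
    intro hp τ h
    simp only [Prog.regBound] at hp
    have hy := h.reg y (by omega)
    have hx := h.reg x (by omega)
    refine ⟨_, ((Runs.store ..).seq (Runs.store ..)).mono (by omega), ⟨?_, ?_, ?_, ?_, ?_⟩,
      ⟨fun _ _ _ => rfl, ?_⟩⟩
    · exact h.reg
    · intro b i
      have e1 : ¬ 2 * b + 5 = 2 * a + 4 := by omega
      have e2 : ¬ 2 * b + 4 = 2 * a + 5 := by omega
      have e3 : 2 * b + 5 = 2 * a + 5 ↔ b = a := by omega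
      have e4 : 2 * b + 4 = 2 * a + 4 ↔ b = a := by omega
      simp only [State.setArr_arr, State.setArr_reg, hy, hx, h.time, e1, e2, e3, e4, false_and,
        if_false]
      by_cases hb : b = a ∧ i = σ.reg y
      · simp [hb]
      · simp only [hb, if_false]
        exact h.arr b i
    · exact h.time
    · exact h.last
    · intro b i
      simp only [State.setArr_arr, State.setArr_reg, h.time]
      split_ifs
      · exact le_rfl
      · omega
      · exact h.stamp b i
    · intro b hb
      funext i
      rw [State.setArr_arr, State.setArr_arr, if_neg (by omega), if_neg (by omega)]
  | @seq p q σ σ' σ'' s t _ _ ih₁ ih₂ =>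
    intro hp τ h
    simp only [Prog.regBound] at hp
    obtain ⟨τ', r, h', u⟩ := ih₁ (by omega) τ h
    obtain ⟨τ'', r', h'', u'⟩ := ih₂ (by omega) τ' h'
    exact ⟨τ'', (r.seq r').mono (by omega), h'', u.trans u'⟩
  | @ite_pos x p q σ σ' t hx _ ih =>
    intro hp τ h
    simp only [Prog.regBound] at hp
    obtain ⟨τ', r, h', u⟩ := ih (by omega) τ h
    exact ⟨τ', (r.ite_pos (by rwa [h.reg x (by omega)])).mono (by omega), h', u⟩
  | @ite_neg x p q σ σ' t hx _ ih =>
    intro hp τ h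
    simp only [Prog.regBound] at hp
    obtain ⟨τ', r, h', u⟩ := ih (by omega) τ h
    exact ⟨τ', (r.ite_neg (by rwa [h.reg x (by omega)])).mono (by omega), h', u⟩
  | @while_pos x p σ σ' σ'' s t hx _ _ ih₁ ih₂ =>
    intro hp τ h
    have hp' := hp
    simp only [Prog.regBound] at hp'
    obtain ⟨τ', ⟨l, hl, r⟩, h', u⟩ := ih₁ (by omega) τ h
    obtain ⟨τ'', ⟨l', hl', r'⟩, h'', u'⟩ := ih₂ hp τ' h'
    exact ⟨τ'', ⟨_, by omega, .while_pos (by rwa [h.reg x (by omega)]) r r'⟩, h'', u.trans u'⟩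
  | @while_neg x p σ hx =>
    intro hp τ h
    simp only [Prog.regBound] at hp
    exact ⟨τ, ⟨1, by omega, .while_neg (by rwa [h.reg x (by omega)])⟩, h,
      ⟨fun _ _ _ => rfl, fun _ _ => rfl⟩⟩

/-- Clears `R` registers from register `8` on. -/
def Prog.clear : ℕ → Prog
  | 0 => .const 6 0
  | R + 1 => .seq (Prog.clear R) (.const (R + 8) 0)

theorem Runs.clear (R : ℕ) (τ : State) :
    ∃ τ', Runs (Prog.clear R) τ (R + 1) τ' ∧ Untouched τ τ' ∧ τ'.arr = τ.arr ∧
      ∀ x < R, τ'.reg (x + 8) = 0 := by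
  induction R with
  | zero => exact ⟨_, Runs.const .., untouched_scratch .., rfl, by simp⟩
  | succ R ih =>
    obtain ⟨τ', h1, h2, h3, h4⟩ := ih
    refine ⟨_, (h1.seq (Runs.const ..)).mono (by omega), h2.trans (untouched_setReg ..), h3, ?_⟩
    intro x hx
    simp only [State.setReg_reg, add_left_inj]
    split_ifs with h
    exacts [rfl, h4 x (by omega)]

/-- Runs a program on the pair of the numbers in registers `1` and `5`, the latter increased by
one, and stores the result in the array `3`. -/
def Prog.callOnPair (p : Prog) : Prog :=
  .seq (.const 6 0) (.seq (.add 3 5 6) (.seq (.const 6 1) (.seq (.add 2 5 6)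
    (.seq (Prog.clear (p.regBound + 2)) (.seq (.const 6 0) (.seq (.add 8 1 6) (.seq (.add 9 2 6)
      (.seq p.relocate (.store 3 2 8)))))))))

/-- Earlier calls left only stamps at most `j`, so with threshold `j` all simulated arrays read as
`0`, and only registers have to be cleared. The number `j + 1` serves as current time, as second
argument and as the cell for the result. -/
theorem Runs.callOnPair {p : Prog} {m j k : ℕ} {σ' : State}
    (h : Steps p (pairInput m (j + 1)) k σ') {τ : State} (h1 : τ.reg 1 = m) (h5 : τ.reg 5 = j)
    (hs : ∀ a i, τ.arr (2 * a + 5) i ≤ j) :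
    ∃ τ', Runs p.callOnPair τ (4 * k + p.regBound + 11) τ' ∧
      (∀ x < 6, x ≠ 2 → x ≠ 3 → τ'.reg x = τ.reg x) ∧ (∀ a < 3, τ'.arr a = τ.arr a) ∧
      (∀ i, τ'.arr 3 i = if i = (j + 1 : ℤ) then σ'.reg 0 else τ.arr 3 i) ∧
      ∀ a i, τ'.arr (2 * a + 5) i ≤ j + 1 := by
  -- The additional `2` covers the input registers and the output register even if the program does
  -- not mention them.
  obtain ⟨τ₁, c1, c2, c3, c4⟩ := Runs.clear (p.regBound + 2)
    ((((τ.setReg 6 0).setReg 3 j).setReg 6 1).setReg 2 (j + 1))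
  have hrep : Represents (p.regBound + 2) (j : ℤ) (pairInput m (j + 1))
      (((τ₁.setReg 6 0).setReg 8 m).setReg 9 (j + 1)) := by
    refine ⟨?_, ?_, ?_, ?_, ?_⟩
    · intro x hx
      simp only [State.setReg_reg, pairInput]
      by_cases h0 : x = 0
      · simp [h0]
      · by_cases h1 : x = 1
        · simp [h1]
        · rw [if_neg (by omega), if_neg (by omega), if_neg (by omega), if_neg h0, if_neg h1,
            c4 x hx]
    · intro a i
      simp only [State.setReg_arr, c3]
      rw [if_neg (not_lt.mpr (hs a i))]
      rfl
    · simp [c2.1 2]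
    · simp [c2.1 3]
    · intro a i
      simp only [State.setReg_arr, c3]
      linarith [hs a i]
  obtain ⟨τ₂, r1, r2, r3⟩ := h.relocate (R := p.regBound + 2) (by omega) _ hrep
  have e1 := Runs.const τ 6 0
  have e2 := Runs.add (τ.setReg 6 0) 3 5 6
  have e3 := Runs.const ((τ.setReg 6 0).setReg 3 j) 6 1
  have e4 := Runs.add (((τ.setReg 6 0).setReg 3 j).setReg 6 1) 2 5 6
  have e5 := Runs.const τ₁ 6 0
  have e6 := Runs.add (τ₁.setReg 6 0) 8 1 6
  have e7 := Runs.add ((τ₁.setReg 6 0).setReg 8 m) 9 2 6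
  simp [h5] at e2 e4
  simp [c2.1 1, h1] at e6
  simp [c2.1 2] at e7
  refine ⟨_, (e1.seq (e2.seq (e3.seq (e4.seq (c1.seq (e5.seq (e6.seq (e7.seq
    (r1.seq (Runs.store ..)))))))))).mono (by omega), ?_, ?_, ?_, ?_⟩
  · intro x hx hx2 hx3
    rw [State.setArr_reg, r3.1 x (by omega) (by omega)]
    simp only [State.setReg_reg]
    rw [if_neg (by omega), if_neg (by omega), if_neg (by omega), c2.1 x (by omega) (by omega)]
    simp only [State.setReg_reg]
    rw [if_neg hx2, if_neg (by omega), if_neg hx3, if_neg (by omega)]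
  · intro a ha
    funext i
    rw [State.setArr_arr, if_neg (by omega), r3.2 a (by omega)]
    simp only [State.setReg_arr, c3]
  · intro i
    rw [State.setArr_arr, r2.time, r2.reg 0 (by omega), r3.2 3 (by omega)]
    simp only [State.setReg_arr, c3, true_and]
  · intro a i
    rw [State.setArr_arr, if_neg (by omega)]
    exact r2.stamp a i

end RAM

/-! ### The table of scores and the passage from steps to logarithmic time. -/

namespace Voting

open RAM

theorem eval_mono (p : Polynomial ℕ) {a b : ℕ} (h : a ≤ b) : p.eval a ≤ p.eval b := by
  rw [Polynomial.eval_eq_sum_range, Polynomial.eval_eq_sum_range]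
  exact Finset.sum_le_sum fun i _ => Nat.mul_le_mul_left _ (Nat.pow_le_pow_left h i)

theorem holds_encode {n m : ℕ} (P : PartialProfile n m) (tie : TieBreaker m)
    (D : Finset (Fin m)) : (⟨n, m, P, tie, D, fun _ => 0⟩ : Input).Holds (encode P tie D) :=
  ⟨rfl, rfl, rfl, rfl, rfl, fun _ _ _ => rfl⟩

/-- The scores of a polynomial-time computable rule can be tabulated. -/
theorem PositionalScoringRule.PolyTimeComputable.exists_tabulate {r : PositionalScoringRule}
    (hr : r.PolyTimeComputable) : ∃ (p : Prog) (T : Polynomial ℕ), ∀ (n m : ℕ)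
      (P : PartialProfile n m) (tie : TieBreaker m) (D : Finset (Fin m)),
      ∃ τ, Runs p (encode P tie D) (T.eval (n + m + 1)) τ ∧
        (⟨n, m, P, tie, D, r.score m⟩ : Input).Holds τ := by
  obtain ⟨π, p, hπ⟩ := hr
  -- The loop counts down a copy of `m` in register `4`. Its round number is in register `5`, where
  -- `callOnPair` expects its argument; it starts at `0`, so round `j` computes the score of
  -- position `j + 1`.
  refine ⟨.seq (.const 4 0) (.seq (.add 4 4 1) (Prog.forLoop 4 π.callOnPair)),
    4 + Polynomial.X * (4 * p + Polynomial.C (π.regBound + 15)), fun n m P tie D => ?_⟩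
  set σ := encode P tie D with hσ
  obtain ⟨τ, h1, h2, h3, h4, h5, h6⟩ := Runs.forLoop (d := 4) (B := m)
    (T := 4 * p.eval m + π.regBound + 11) (p := π.callOnPair)
    -- The last clause bounds all time stamps by the number of finished calls, as the next call
    -- requires.
    (fun j τ => τ.reg 0 = n ∧ τ.reg 1 = m ∧ (∀ a < 3, τ.arr a = σ.arr a) ∧
      (∀ i : ℕ, 1 ≤ i → i ≤ j → τ.arr 3 i = r.score m i) ∧ ∀ a i, τ.arr (2 * a + 5) i ≤ j)
    (by
      rintro j σ' τ' h1 h2 ⟨h3, h4, h5⟩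
      rw [h1 0 (by omega) (by omega) (by omega), h1 1 (by omega) (by omega) (by omega), h2]
      exact ⟨h3, h4, h5⟩)
    (by
      rintro j hj τ ⟨h0, h1, h2, h3, h4⟩ h5
      obtain ⟨t, σ', e1, e2, e3⟩ := hπ m (j + 1) (by omega) (by omega)
      obtain ⟨s, hs, e4⟩ := e1.steps
      obtain ⟨τ', r1, r2, r3, r4, r5⟩ := Runs.callOnPair e4 h1 h5 h4
      refine ⟨τ', r1.mono (by omega), ⟨?_, ?_, ?_, ?_, ?_⟩, ?_, ?_⟩
      · rw [r2 0 (by omega) (by omega) (by omega), h0]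
      · rw [r2 1 (by omega) (by omega) (by omega), h1]
      · intro a ha
        rw [r3 a ha, h2 a ha]
      · intro i hi hi'
        rw [r4]
        split_ifs with h
        · rw [e2]
          congr 1
          omega
        · exact h3 i hi (by omega)
      · intro a i
        push_cast
        exact r5 a i
      · exact r2 4 (by omega) (by omega) (by omega)
      · exact r2 5 (by omega) (by omega) (by omega))
    (σ := (σ.setReg 4 0).setReg 4 m) (by simp)
    ⟨rfl, rfl, fun _ _ => rfl, fun i h h' => by omega, fun a i => by
      simp [hσ, encode]⟩
  have e1 := Runs.const σ 4 0
  have e2 := Runs.add (σ.setReg 4 0) 4 4 1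
  have : σ.reg 1 = m := rfl
  simp [this] at e2
  refine ⟨τ, (e1.seq (e2.seq h1)).mono ?_, h2, h3, h4 0 (by omega), h4 1 (by omega),
    h4 2 (by omega), h5⟩
  have := eval_mono p (show m ≤ n + m + 1 by omega)
  have : m * (4 * p.eval m + π.regBound + 11 + 4) ≤
      (n + m + 1) * (4 * p.eval (n + m + 1) + (π.regBound + 15)) :=
    Nat.mul_le_mul (by omega) (by omega)
  simp only [Polynomial.eval_add, Polynomial.eval_mul, Polynomial.eval_X, Polynomial.eval_C,
    Polynomial.eval_ofNat]
  omega

theorem bitsLe_encode {n m : ℕ} (P : PartialProfile n m) (tie : TieBreaker m)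
    (D : Finset (Fin m)) : (encode P tie D).BitsLe (n + m + 1) := by
  have hb : ∀ k : ℕ, bits k ≤ k := fun k => by
    rw [bits, Nat.size_le]
    exact Nat.lt_two_pow_self
  have h1 : bits 1 ≤ n + m + 1 := (hb 1).trans (by omega)
  have h0 : bits 0 ≤ n + m + 1 := (hb 0).trans (by omega)
  constructor
  · intro x
    simp only [encode]
    split_ifs
    exacts [(hb n).trans (by omega), (hb m).trans (by omega), h0]
  · intro a i
    simp only [encode]
    split_ifs
    all_goals assumption

/-- A problem is decidable in polynomial time if it is computable from the input together with a
table that can be computed beforehand. -/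
theorem decidableInTime_of_compP
    {Q : ∀ {n m : ℕ}, PartialProfile n m → TieBreaker m → Finset (Fin m) → Prop}
    {q : Input → Prop} (hq : Layout.base.CompP q) {table : ℕ → ℕ → ℤ}
    (hpre : ∃ (p : Prog) (T : Polynomial ℕ), ∀ (n m : ℕ)
      (P : PartialProfile n m) (tie : TieBreaker m) (D : Finset (Fin m)),
      ∃ τ, Runs p (encode P tie D) (T.eval (n + m + 1)) τ ∧
        (⟨n, m, P, tie, D, table m⟩ : Input).Holds τ)
    (hQ : ∀ (n m : ℕ) (P : PartialProfile n m) (tie : TieBreaker m) (D : Finset (Fin m)),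
      D.Nonempty → (q ⟨n, m, P, tie, D, table m⟩ ↔ Q P tie D)) :
    DecidableInTime Q := by
  obtain ⟨p, T, hp⟩ := hpre
  obtain ⟨p', U, hp'⟩ := hq 2 4 le_rfl le_rfl
  set π : Prog := .seq p (.seq p' (.seq (.const 3 0) (.add 0 2 3))) with hπ
  -- `S` bounds the number of steps and `W` the logarithmic cost given by `Steps.exec`: the numbers
  -- in the input and in the program have at most `n + m + 1 + π.constBits` digits.
  set S : Polynomial ℕ := T + U + 2 with hS
  set W : Polynomial ℕ := S * (1 + 2 * (Polynomial.X + Polynomial.C π.constBits + S)) with hW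
  refine ⟨π, Polynomial.aeval (MvPolynomial.X 0 + MvPolynomial.X 1 + 1) W,
    fun n m P tie D hD => ?_⟩
  obtain ⟨τ, h1, h2⟩ := hp n m P tie D
  obtain ⟨υ, k1, k2, k3⟩ := hp' _ τ h2
  obtain ⟨s, hs, h⟩ := h1.seq (k1.seq ((Runs.const υ 3 0).seq (Runs.add _ 0 2 3)))
  obtain ⟨-, t, ht, hexec⟩ := h.exec (n + m + 1 + π.constBits) (Nat.le_add_left _ _)
    ((bitsLe_encode P tie D).mono (by omega))
  refine ⟨t, _, hexec, ?_, ?_⟩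
  · simp only [State.setReg_reg, if_true]
    norm_num
    rw [k3]
    have hQ := hQ n m P tie D hD
    beta_reduce
    by_cases hq : Q P tie D
    · rw [if_pos (hQ.2 hq), if_pos hq]
    · rw [if_neg (mt hQ.1 hq), if_neg hq]
  -- The cost is polynomial in `n` and `m` already; the factor `D.card` only has to be positive.
  · have hcard : 1 ≤ D.card := hD.card_pos
    have heval : MvPolynomial.eval ![n, m]
        (Polynomial.aeval (MvPolynomial.X 0 + MvPolynomial.X 1 + 1) W) = W.eval (n + m + 1) := by
      rw [← MvPolynomial.coe_aeval_eq_eval, RingHom.coe_coe, ← Polynomial.aeval_algHom_apply]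
      simp
    rw [heval]
    refine (ht.trans ?_).trans (Nat.le_mul_of_pos_left _ hcard)
    have hs' : s ≤ S.eval (n + m + 1) := by
      refine hs.trans ?_
      simp only [hS, Polynomial.eval_add, Polynomial.eval_ofNat]
      have : (Layout.base.input ⟨n, m, P, tie, D, table m⟩).size = n + m + 1 := rfl
      rw [this]
      omega
    rw [hW]
    simp only [Polynomial.eval_add, Polynomial.eval_mul, Polynomial.eval_X, Polynomial.eval_C,
      Polynomial.eval_ofNat, Polynomial.eval_one]
    exact Nat.mul_le_mul hs' (by omega)

end Voting

namespace Voting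

open Finset

open Classical in
theorem ncard_setOf {α : Type*} [Fintype α] (p : α → Prop) :
    Set.ncard {a | p a} = (univ.filter p).card := by
  rw [← Set.ncard_coe_finset]
  simp

/-! ### Linear extensions with prescribed positions -/

/-- A strict order that is compatible with levels has a linear extension that respects them. -/
theorem exists_linearExtension {α : Type*} (R : α → α → Prop) [IsStrictOrder α R] (g : α → ℕ)
    (hg : ∀ a b, R a b → g a ≤ g b) : ∃ L : α → α → Prop, IsStrictTotalOrder α L ∧
      (∀ a b, R a b → L a b) ∧ ∀ a b, g a < g b → L a b := by
  -- Levels are compared first and `R` only within a level. By `hg` this order contains `R`, and it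
  -- is extended to a linear order.
  let R' : α → α → Prop := fun a b => a = b ∨ g a < g b ∨ (g a = g b ∧ R a b)
  have hR' : IsPartialOrder α R' :=
    { refl := fun a => Or.inl rfl
      trans := by
        rintro a b c (rfl | h | ⟨h, h'⟩) (rfl | k | ⟨k, k'⟩)
        · exact Or.inl rfl
        · exact Or.inr (Or.inl k)
        · exact Or.inr (Or.inr ⟨k, k'⟩)
        · exact Or.inr (Or.inl h)
        · exact Or.inr (Or.inl (h.trans k))
        · exact Or.inr (Or.inl (h.trans_eq k))
        · exact Or.inr (Or.inr ⟨h, h'⟩)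
        · exact Or.inr (Or.inl (h.trans_lt k))
        · exact Or.inr (Or.inr ⟨h.trans k, _root_.trans h' k'⟩)
      antisymm := by
        rintro a b (rfl | h | ⟨h, h'⟩) (k | k | ⟨k, k'⟩)
        any_goals first | rfl | exact k.symm | omega
        exact absurd k' (asymm h') }
  obtain ⟨S, hS, hle⟩ := extend_partialOrder R'
  refine ⟨fun a b => S a b ∧ a ≠ b, ?_, ?_, ?_⟩
  · exact
      { trichotomous := by
          intro a b h h'
          by_contra hne
          rcases hS.total a b with h1 | h1
          · exact h ⟨h1, hne⟩
          · exact h' ⟨h1, Ne.symm hne⟩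
        irrefl := fun a h => h.2 rfl
        trans := by
          rintro a b c ⟨h, h'⟩ ⟨k, k'⟩
          refine ⟨hS.trans _ _ _ h k, ?_⟩
          rintro rfl
          exact h' (hS.antisymm _ _ h k) }
  · intro a b h
    refine ⟨hle _ _ ?_, ne_of_irrefl h⟩
    rcases (hg a b h).lt_or_eq with h' | h'
    · exact Or.inr (Or.inl h')
    · exact Or.inr (Or.inr ⟨h', h⟩)
  · intro a b h
    exact ⟨hle _ _ (Or.inr (Or.inl h)), fun hab => by simp [hab] at h⟩

section Positions

variable {α : Type*} {R L : α → α → Prop}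

/-- An element that is alone on its level has exactly the lower levels before it. -/
theorem rel_iff_level_lt [IsStrictTotalOrder α L] {g : α → ℕ} (hL : ∀ a b, g a < g b → L a b)
    {c : α} (hc : ∀ a, g a = g c → a = c) (a : α) : L a c ↔ g a < g c := by
  refine ⟨fun h => ?_, hL a c⟩
  by_contra hlt
  rcases (not_lt.mp hlt).lt_or_eq with h' | h'
  · exact asymm h (hL c a h')
  · obtain rfl := hc a h'.symm
    exact irrefl _ h

variable [Fintype α]

open Classical

theorem card_before_le (h : ∀ a b, R a b → L a b) (d : α) :
    (univ.filter fun a => R a d).card ≤ (univ.filter fun a => L a d).card :=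
  card_le_card (monotone_filter_right _ fun a _ => h a d)

/-- Neither `c` nor anything before it in `L` can be forced below `c`. -/
theorem card_before_lt [IsStrictTotalOrder α L] (h : ∀ a b, R a b → L a b) (c : α) :
    (univ.filter fun a => L a c).card + 1 ≤ (univ.filter fun a => ¬ R c a).card := by
  have : ((univ.filter fun a => L a c).cons c (by simp [irrefl])).card ≤
      (univ.filter fun a => ¬ R c a).card := by
    refine card_le_card fun a ha => ?_
    simp only [mem_cons, mem_filter, mem_univ, true_and] at ha ⊢
    intro hc
    rcases ha with rfl | ha
    · exact irrefl (r := L) _ (h _ _ hc)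
    · exact asymm ha (h _ _ hc)
  rwa [card_cons] at this

/-- The elements before `c`, the element `c`, and those forced between `c` and `d` are disjoint
families, all before `d` in `L`. -/
theorem card_between_le [IsStrictTotalOrder α L] (h : ∀ a b, R a b → L a b) {c d : α}
    (hcd : R c d) : (univ.filter fun a => L a c).card + 1 +
      (univ.filter fun a => R c a ∧ R a d).card ≤ (univ.filter fun a => L a d).card := by
  have h1 : (univ.filter fun a => a = c).card = 1 :=
    card_eq_one.mpr ⟨c, by ext; simp⟩
  rw [← h1]
  simp only [card_filter, ← sum_add_distrib]
  refine sum_le_sum fun a _ => ?_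
  have e1 := h c d hcd
  by_cases k1 : L a c
  · have k2 : a ≠ c := fun k => irrefl (r := L) c (k ▸ k1)
    have k3 : ¬ R c a := fun k => asymm k1 (h _ _ k)
    have k4 : L a d := _root_.trans k1 e1
    simp [k1, k2, k3, k4]
  · by_cases k2 : a = c
    · subst k2
      have k3 : ¬ R a a := fun k => irrefl (r := L) _ (h _ _ k)
      simp [k1, k3, e1]
    · by_cases k3 : R c a ∧ R a d
      · simp [k1, k2, k3, h _ _ k3.2]
      · simp [k1, k2, k3]

variable [IsStrictOrder α R]

/-- A subset of prescribed size that contains, with each element, the elements before it. -/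
theorem exists_initial_subset (R : α → α → Prop) [IsStrictOrder α R] (F : Finset α) (j : ℕ)
    (hj : j ≤ F.card) : ∃ F₁ ⊆ F, F₁.card = j ∧ ∀ x ∈ F₁, ∀ y ∈ F, R y x → y ∈ F₁ := by
  induction j with
  | zero => exact ⟨∅, by simp, rfl, by simp⟩
  | succ j ih =>
    obtain ⟨F₁, h1, h2, h3⟩ := ih (by omega)
    have hne : (F \ F₁ : Set α).Nonempty := by
      obtain ⟨x, hx, hx'⟩ := exists_mem_notMem_of_card_lt_card (show F₁.card < F.card by omega)
      exact ⟨x, hx, hx'⟩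
    have hwf : WellFounded R := Finite.wellFounded_of_trans_of_irrefl R
    obtain ⟨x, ⟨hx, hx'⟩, hmin⟩ := hwf.has_min _ hne
    refine ⟨F₁.cons x hx', ?_, by rw [card_cons, h2], ?_⟩
    · intro y hy
      rcases mem_cons.mp hy with rfl | hy
      exacts [hx, h1 hy]
    · intro y hy z hz hzy
      rw [mem_cons] at hy ⊢
      right
      rcases hy with rfl | hy
      · by_contra hz'
        exact hmin z ⟨hz, hz'⟩ hzy
      · exact h3 y hy z hz hzy

/-- If `c` is not before `d`, then `d` can be moved to the front and `c` to the back at once. -/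
theorem exists_extreme {c d : α} (hne : c ≠ d) (hcd : ¬ R c d) :
    ∃ L, IsStrictTotalOrder α L ∧ (∀ a b, R a b → L a b) ∧
      (univ.filter fun a => L a d).card = (univ.filter fun a => R a d).card ∧
      (univ.filter fun a => L a c).card + 1 = (univ.filter fun a => ¬ R c a).card := by
  -- In increasing order: elements forced before `d`, then `d`, the free elements, `c`, and the
  -- elements forced after `c`. Since `c` is not before `d`, no element is forced both before `d`
  -- and after `c`.
  let g : α → ℕ := fun a =>
    if a = d then 1 else if a = c then 3 else if R a d then 0 else if R c a then 4 else 2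
  have htr : ∀ {a b c : α}, R a b → R b c → R a c := fun h h' => _root_.trans h h'
  have hirr : ∀ a, ¬ R a a := fun a => irrefl a
  have hg : ∀ a b, R a b → g a ≤ g b := by
    intro a b h
    simp only [g]
    split_ifs <;> first | omega | grind
  obtain ⟨L, hL, hext, hlev⟩ := exists_linearExtension R g hg
  refine ⟨L, hL, hext, ?_, ?_⟩
  · congr 1
    ext a
    simp only [mem_filter, mem_univ, true_and]
    rw [rel_iff_level_lt hlev (fun a ha => by simp only [g] at ha; grind)]
    simp only [g]
    grind
  · have h1 : (univ.filter fun a => a = c).card = 1 :=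
    card_eq_one.mpr ⟨c, by ext; simp⟩
    rw [← h1]
    simp only [card_filter, ← sum_add_distrib]
    refine sum_congr rfl fun a _ => ?_
    rw [rel_iff_level_lt hlev (fun a ha => by simp only [g] at ha; grind)]
    simp only [g]
    grind

/-- If `c` is before `d`, then nothing but the elements between them needs to separate them, and
the resulting block can be moved freely. -/
theorem exists_block {c d : α} (hcd : R c d) {i : ℕ}
    (hi : (univ.filter fun a => R a d).card ≤ i + (univ.filter fun a => R c a ∧ R a d).card)
    (hi' : i ≤ (univ.filter fun a => ¬ R c a).card) :
    ∃ L, IsStrictTotalOrder α L ∧ (∀ a b, R a b → L a b) ∧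
      (univ.filter fun a => L a c).card + 1 = i ∧
      (univ.filter fun a => L a d).card = i + (univ.filter fun a => R c a ∧ R a d).card := by
  have htr : ∀ {a b c : α}, R a b → R b c → R a c := fun h h' => _root_.trans h h'
  have hirr : ∀ a, ¬ R a a := fun a => irrefl a
  have hc1 : (univ.filter fun a => a = c).card = 1 :=
    card_eq_one.mpr ⟨c, by ext; simp⟩
  set F : Finset α := univ.filter fun a => a ≠ c ∧ a ≠ d ∧ ¬ R a d ∧ ¬ R c a with hF
  set U : Finset α := univ.filter fun a => a ≠ c ∧ R a d ∧ ¬ R c a with hU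
  have e1 : (univ.filter fun a => R a d).card =
      U.card + 1 + (univ.filter fun a => R c a ∧ R a d).card := by
    rw [← hc1, hU]
    simp only [card_filter, ← sum_add_distrib]
    refine sum_congr rfl fun a _ => ?_
    grind
  have e2 : (univ.filter fun a => ¬ R c a).card = U.card + 1 + F.card := by
    rw [← hc1, hU, hF]
    simp only [card_filter, ← sum_add_distrib]
    refine sum_congr rfl fun a _ => ?_
    grind
  -- Position `i` for `c` requires `i - 1` elements before it: all of `U`, and a part `F₁` of the
  -- free elements `F`. By `e1` and `e2` the bounds on `i` say that `F₁` has a possible size; being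
  -- initial in `F`, it may be moved before `c`.
  obtain ⟨F₁, h1, h2, h3⟩ := exists_initial_subset R F (i - (U.card + 1)) (by omega)
  have h1' : ∀ a ∈ F₁, a ≠ c ∧ a ≠ d ∧ ¬ R a d ∧ ¬ R c a := fun a ha => by
    simpa [hF] using h1 ha
  have h3' : ∀ x ∈ F₁, ∀ y, y ≠ c → y ≠ d → ¬ R y d → ¬ R c y → R y x → y ∈ F₁ :=
    fun x hx y k1 k2 k3 k4 => h3 x hx y (by simp [hF, k1, k2, k3, k4])
  -- The levels are `U`, `F₁`, `c`, the elements between `c` and `d`, `d`, the rest of `F`, and the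
  -- remaining elements forced after `c`.
  let g : α → ℕ := fun a =>
    if a = c then 2 else if a = d then 4 else if R a d then (if R c a then 3 else 0)
      else if R c a then 6 else if a ∈ F₁ then 1 else 5
  have hg : ∀ a b, R a b → g a ≤ g b := by
    intro a b h
    simp only [g]
    split_ifs <;> first | omega | grind
  obtain ⟨L, hL, hext, hlev⟩ := exists_linearExtension R g hg
  have hF₁ : F₁.card = (univ.filter fun a => a ∈ F₁).card := by simp
  have e3 : (univ.filter fun a => L a c).card = U.card + F₁.card := by
    rw [hF₁, hU]
    simp only [card_filter, ← sum_add_distrib]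
    refine sum_congr rfl fun a _ => ?_
    rw [rel_iff_level_lt hlev (fun a ha => by simp only [g] at ha; grind)]
    simp only [g]
    grind
  have e4 : (univ.filter fun a => L a d).card =
      (univ.filter fun a => L a c).card + 1 + (univ.filter fun a => R c a ∧ R a d).card := by
    rw [← hc1]
    simp only [card_filter, ← sum_add_distrib]
    refine sum_congr rfl fun a _ => ?_
    rw [rel_iff_level_lt hlev (c := c) (fun a ha => by simp only [g] at ha; grind),
      rel_iff_level_lt hlev (c := d) (fun a ha => by simp only [g] at ha; grind)]
    simp only [g]
    grind
  exact ⟨L, hL, hext, by omega, by omega⟩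

end Positions

end Voting

namespace Voting

open Finset

/-! ### Top sets -/

namespace Profile

variable {n m : ℕ} (T : Profile n m) (r : PositionalScoringRule) (tie : TieBreaker m)

theorem defeats_irrefl (a : Fin m) : ¬ T.Defeats r tie a a := by
  have := tie.isStrictTotalOrder
  rintro (h | ⟨-, h⟩)
  exacts [lt_irrefl _ h, irrefl _ h]

variable {T r tie}

theorem Defeats.trans {a b c : Fin m} (h : T.Defeats r tie a b) (h' : T.Defeats r tie b c) :
    T.Defeats r tie a c := by
  have := tie.isStrictTotalOrder
  rcases h with h | ⟨h, k⟩ <;> rcases h' with h' | ⟨h', k'⟩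
  · exact Or.inl (h'.trans h)
  · exact Or.inl (h' ▸ h)
  · exact Or.inl (h ▸ h')
  · exact Or.inr ⟨h.trans h', _root_.trans k k'⟩

theorem defeats_of_not {a b : Fin m} (hne : a ≠ b) (h : ¬ T.Defeats r tie b a) :
    T.Defeats r tie a b := by
  have := tie.isStrictTotalOrder
  simp only [Defeats, not_or, not_and] at h ⊢
  rcases (not_lt.mp h.1).lt_or_eq with h1 | h1
  · exact Or.inl h1
  · refine Or.inr ⟨h1.symm, ?_⟩
    rcases trichotomous_of tie.before a b with h2 | h2 | h2
    exacts [h2, absurd h2 hne, absurd h2 (h.2 h1)]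

open Classical in
/-- A set of `k` candidates is the set of top-`k` winners if and only if its elements defeat all
other candidates. -/
theorem forall_mem_iff_isTopWinner (D : Finset (Fin m)) :
    (∀ c, c ∈ D ↔ T.IsTopWinner r tie D.card c) ↔ ∀ c ∈ D, ∀ d ∉ D, T.Defeats r tie c d := by
  simp only [IsTopWinner, rank, ncard_setOf]
  constructor
  · intro h c hc d hd
    have hc' := (h c).mp hc
    have hd' := mt (h d).mpr hd
    -- If `d` defeated `c`, everything ahead of `d` would be ahead of `c`, so `d` would be ranked at
    -- least as high and be a winner.
    refine defeats_of_not (by rintro rfl; exact hd hc) fun hdc => hd' (le_trans ?_ hc')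
    gcongr with a
    exact fun h => h.trans hdc
  · intro h c
    constructor
    · intro hc
      have : (univ.filter fun a => T.Defeats r tie a c) ⊆ D.erase c := by
        intro a ha
        simp only [mem_filter, mem_univ, true_and] at ha
        refine mem_erase.mpr ⟨?_, ?_⟩
        · rintro rfl
          exact T.defeats_irrefl r tie _ ha
        · by_contra hD
          exact T.defeats_irrefl r tie _ (ha.trans (h c hc a hD))
      have h1 := card_le_card this
      have h2 := card_erase_add_one hc
      omega
    · intro hle
      by_contra hc
      have : D ⊆ univ.filter fun a => T.Defeats r tie a c := fun a ha => by
        simpa using h a ha c hc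
      have := card_le_card this
      omega

end Profile

/-! ### Necessary top sets -/

namespace Input

variable (I : Input)

open Classical in
/-- The score for position `j`. -/
noncomputable def score (j : ℕ) : ℤ := if 1 ≤ j ∧ j ≤ I.m then I.table j else 0

/-- The number of candidates that voter `v` must rank above `d`. -/
noncomputable def above (v d : ℕ) : ℕ := countBelow I.m fun a => I.Prefers v a d

/-- The last position that voter `v` may give to `c`. -/
noncomputable def last (v c : ℕ) : ℕ := countBelow I.m fun a => ¬ I.Prefers v c a

/-- The number of candidates that voter `v` must rank between `c` and `d`. -/
noncomputable def between (v c d : ℕ) : ℕ :=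
  countBelow I.m fun a => I.Prefers v c a ∧ I.Prefers v a d

/-- Voter `v` may put `c` in position `i` and `d` as close as possible below `c`. -/
def IsBlockStart (v c d i : ℕ) : Prop :=
  I.above v d ≤ i + I.between v c d ∧ i ≤ I.last v c

/-- The score of `d` minus the score of `c` in such a ranking. -/
noncomputable def blockGain (v c d i : ℕ) : ℤ :=
  I.score (i + I.between v c d + 1) - I.score i

/-- The best position for `c` in such a ranking. -/
noncomputable def bestBlock (v c d : ℕ) : ℕ :=
  leastBelow (I.m + 1) fun i => I.IsBlockStart v c d i ∧
    ∀ j < I.m + 1, I.IsBlockStart v c d j → I.blockGain v c d j ≤ I.blockGain v c d i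

open Classical in
/-- The largest possible difference of the scores that voter `v` gives to `d` and to `c`. -/
noncomputable def gain (v c d : ℕ) : ℤ :=
  if I.Prefers v c d then I.blockGain v c d (I.bestBlock v c d)
  else I.score (I.above v d + 1) - I.score (I.last v c)

/-- No candidate outside the set can overtake a candidate in the set. -/
def IsNecessary : Prop :=
  ∀ c < I.m, I.Mem c → ∀ d < I.m, ¬ I.Mem d →
    ∑ v ∈ range I.n, I.gain v c d < 0 ∨ (∑ v ∈ range I.n, I.gain v c d = 0 ∧ I.Before c d)

end Input

/-! ### The test for necessary top sets in polynomially many steps. -/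

namespace Layout

variable {Γ : Type} {K : Layout Γ}

theorem comp_score {j : Γ → ℕ} (hj : K.CompN j) : K.Comp fun γ => (K.input γ).score (j γ) :=
  comp_table hj

theorem compN_above {v d : Γ → ℕ} (hv : K.CompN v) (hd : K.CompN d) :
    K.CompN fun γ => (K.input γ).above (v γ) (d γ) :=
  CompN.countBelow compN_m polyBounded_m fun _ => compP_prefers hv.up compN_var hd.up

theorem compN_last {v c : Γ → ℕ} (hv : K.CompN v) (hc : K.CompN c) :
    K.CompN fun γ => (K.input γ).last (v γ) (c γ) :=
  CompN.countBelow (p := fun γ a => ¬ (K.input γ).Prefers (v γ) (c γ) a) compN_m polyBounded_m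
    fun _ => (compP_prefers hv.up hc.up compN_var).not

theorem compN_between {v c d : Γ → ℕ} (hv : K.CompN v) (hc : K.CompN c) (hd : K.CompN d) :
    K.CompN fun γ => (K.input γ).between (v γ) (c γ) (d γ) :=
  CompN.countBelow (p := fun γ a => (K.input γ).Prefers (v γ) (c γ) a ∧
      (K.input γ).Prefers (v γ) a (d γ)) compN_m polyBounded_m
    fun _ => (compP_prefers hv.up hc.up compN_var).and (compP_prefers hv.up compN_var hd.up)

theorem compP_isBlockStart {v c d i : Γ → ℕ} (hv : K.CompN v) (hc : K.CompN c) (hd : K.CompN d)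
    (hi : K.CompN i) : K.CompP fun γ => (K.input γ).IsBlockStart (v γ) (c γ) (d γ) (i γ) :=
  (CompP.leN (compN_above hv hd) (hi.add (compN_between hv hc hd))).and
    (CompP.leN hi (compN_last hv hc))

theorem comp_blockGain {v c d i : Γ → ℕ} (hv : K.CompN v) (hc : K.CompN c) (hd : K.CompN d)
    (hi : K.CompN i) : K.Comp fun γ => (K.input γ).blockGain (v γ) (c γ) (d γ) (i γ) :=
  (comp_score ((hi.add (compN_between hv hc hd)).add (compN_const 1))).sub (comp_score hi)

theorem compN_bestBlock {v c d : Γ → ℕ} (hv : K.CompN v) (hc : K.CompN c) (hd : K.CompN d) :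
    K.CompN fun γ => (K.input γ).bestBlock (v γ) (c γ) (d γ) :=
  CompN.leastBelow (p := fun γ i => (K.input γ).IsBlockStart (v γ) (c γ) (d γ) i ∧
      ∀ j < (K.input γ).m + 1, (K.input γ).IsBlockStart (v γ) (c γ) (d γ) j →
        (K.input γ).blockGain (v γ) (c γ) (d γ) j ≤ (K.input γ).blockGain (v γ) (c γ) (d γ) i)
    (compN_m.add (compN_const 1)) (polyBounded_m.add (polyBounded_const 1)) fun _ =>
      (compP_isBlockStart hv.up hc.up hd.up compN_var).and
        (CompP.forall_lt (compN_m.add (compN_const 1)) (polyBounded_m.add (polyBounded_const 1))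
          fun _ => (compP_isBlockStart hv.up.up hc.up.up hd.up.up compN_var).imp
            (CompP.le (comp_blockGain hv.up.up hc.up.up hd.up.up compN_var)
              (comp_blockGain hv.up.up hc.up.up hd.up.up compN_var.up)))

open Classical in
theorem comp_gain {v c d : Γ → ℕ} (hv : K.CompN v) (hc : K.CompN c) (hd : K.CompN d) :
    K.Comp fun γ => (K.input γ).gain (v γ) (c γ) (d γ) :=
  Comp.ite (compP_prefers hv hc hd) (comp_blockGain hv hc hd (compN_bestBlock hv hc hd))
    ((comp_score ((compN_above hv hd).add (compN_const 1))).sub (comp_score (compN_last hv hc)))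

theorem comp_sum_gain {c d : Γ → ℕ} (hc : K.CompN c) (hd : K.CompN d) :
    K.Comp fun γ => ∑ v ∈ range (K.input γ).n, (K.input γ).gain v (c γ) (d γ) :=
  Comp.sum compN_n polyBounded_n fun _ => comp_gain compN_var hc.up hd.up

theorem compP_isNecessary : K.CompP fun γ => (K.input γ).IsNecessary :=
  CompP.forall_lt compN_m polyBounded_m fun _ => (compP_mem compN_var).imp <|
    CompP.forall_lt compN_m polyBounded_m fun _ => (compP_mem compN_var).not.imp <|
      (CompP.lt (comp_sum_gain compN_var.up compN_var) (comp_const 0)).or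
        ((CompP.eq (comp_sum_gain compN_var.up compN_var) (comp_const 0)).and
          (compP_before compN_var.up compN_var))

end Layout

/-! ### Correctness of the test for necessary top sets. -/

section Correctness

variable {n m : ℕ} {P : PartialProfile n m} {tie : TieBreaker m} {D : Finset (Fin m)}
  {r : PositionalScoringRule}

theorem prefers_iff {table : ℕ → ℤ} (v : Fin n) (a b : Fin m) :
    (⟨n, m, P, tie, D, table⟩ : Input).Prefers v a b ↔ P.prefers v a b :=
  ⟨fun ⟨_, _, _, h⟩ => h, fun h => ⟨v.2, a.2, b.2, h⟩⟩

theorem before_iff {table : ℕ → ℤ} (a b : Fin m) :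
    (⟨n, m, P, tie, D, table⟩ : Input).Before a b ↔ tie.before a b :=
  ⟨fun ⟨_, _, h⟩ => h, fun h => ⟨a.2, b.2, h⟩⟩

theorem mem_iff {table : ℕ → ℤ} (a : Fin m) :
    (⟨n, m, P, tie, D, table⟩ : Input).Mem a ↔ a ∈ D :=
  ⟨fun ⟨_, h⟩ => h, fun h => ⟨a.2, h⟩⟩

open Classical in
/-- The gain is the largest difference of scores in a linear extension. -/
theorem gain_spec (v : Fin n) {c d : Fin m} (hne : c ≠ d) :
    (∀ L, IsStrictTotalOrder (Fin m) L → (∀ a b, P.prefers v a b → L a b) →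
      r.score m ((univ.filter fun a => L a d).card + 1) -
        r.score m ((univ.filter fun a => L a c).card + 1) ≤
          (⟨n, m, P, tie, D, r.score m⟩ : Input).gain v c d) ∧
    ∃ L, IsStrictTotalOrder (Fin m) L ∧ (∀ a b, P.prefers v a b → L a b) ∧
      r.score m ((univ.filter fun a => L a d).card + 1) -
        r.score m ((univ.filter fun a => L a c).card + 1) =
          (⟨n, m, P, tie, D, r.score m⟩ : Input).gain v c d := by
  have := P.isStrictOrder v
  set I : Input := ⟨n, m, P, tie, D, r.score m⟩ with hI
  have ha : ∀ d : Fin m, I.above v d = (univ.filter fun a => P.prefers v a d).card :=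
    fun d => countBelow_fin _ _ _ fun a => prefers_iff v a d
  have hl : ∀ c : Fin m, I.last v c = (univ.filter fun a => ¬ P.prefers v c a).card :=
    fun c => countBelow_fin _ _ _ fun a => not_congr (prefers_iff v c a)
  have hb : I.between v c d = (univ.filter fun a => P.prefers v c a ∧ P.prefers v a d).card :=
    countBelow_fin _ _ _ fun a => and_congr (prefers_iff v c a) (prefers_iff v a d)
  have hlast : ∀ c : Fin m, I.last v c ≤ m := fun c => by
    rw [hl]
    exact (card_filter_le _ _).trans (by simp)
  have hs : ∀ j, 1 ≤ j → j ≤ m → I.score j = r.score m j := fun j h h' => if_pos ⟨h, h'⟩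
  have hpos : ∀ (L : Fin m → Fin m → Prop), IsStrictTotalOrder (Fin m) L → ∀ a,
      (univ.filter fun b => L b a).card + 1 ≤ m := by
    intro L hL a
    have := card_lt_card (s := univ.filter fun b => L b a) (t := univ) (by
      refine ⟨filter_subset _ _, fun h => ?_⟩
      have := h (mem_univ a)
      simp only [mem_filter, mem_univ, true_and] at this
      exact irrefl a this)
    simpa using this
  by_cases hcd : P.prefers v c d
  · have hg : I.gain v c d = I.blockGain v c d (I.bestBlock v c d) :=
      if_pos ((prefers_iff v c d).mpr hcd)
    have hstart : ∀ i, I.IsBlockStart v c d i ↔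
        (univ.filter fun a => P.prefers v a d).card ≤
          i + (univ.filter fun a => P.prefers v c a ∧ P.prefers v a d).card ∧
        i ≤ (univ.filter fun a => ¬ P.prefers v c a).card := by
      intro i
      rw [Input.IsBlockStart, ha, hb, hl]
    have hblock : ∀ i, I.IsBlockStart v c d i →
        ∃ L, IsStrictTotalOrder (Fin m) L ∧ (∀ a b, P.prefers v a b → L a b) ∧
        r.score m ((univ.filter fun a => L a d).card + 1) -
          r.score m ((univ.filter fun a => L a c).card + 1) = I.blockGain v c d i := by
      intro i hi
      obtain ⟨h1, h2⟩ := (hstart i).mp hi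
      obtain ⟨L, hL, hext, h3, h4⟩ := exists_block hcd h1 h2
      refine ⟨L, hL, hext, ?_⟩
      have h5 := hpos L hL d
      -- By `h3` a block start is at least `1`, and `h4`, `h5` keep the position of `d` at most `m`,
      -- so the default value `0` of `Input.score` plays no role.
      rw [Input.blockGain, hb, hs _ (by omega) (by omega), hs _ (by omega) (by omega), h3, h4]
    have hle : ∀ L, IsStrictTotalOrder (Fin m) L → (∀ a b, P.prefers v a b → L a b) →
        ∃ i < m + 1, I.IsBlockStart v c d i ∧ r.score m ((univ.filter fun a => L a d).card + 1) -
          r.score m ((univ.filter fun a => L a c).card + 1) ≤ I.blockGain v c d i := by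
      intro L hL hext
      have h1 := card_before_le hext d
      have h2 := card_before_lt hext c
      have h3 := card_between_le hext hcd
      have h4 := hpos L hL d
      have h5 := hlast c
      rw [hl] at h5
      obtain ⟨L', hL', hext', h6, h7⟩ := exists_extreme hne.symm (asymm hcd)
      have h8 := card_before_le hext' d
      have h9 : (univ.filter fun a => P.prefers v a d).card ≤
          (univ.filter fun a => ¬ P.prefers v c a).card +
            (univ.filter fun a => P.prefers v c a ∧ P.prefers v a d).card := by
        simp only [card_filter, ← sum_add_distrib]
        refine sum_le_sum fun a _ => ?_
        by_cases k1 : P.prefers v c a <;> by_cases k2 : P.prefers v a d <;> simp [k1, k2]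
      -- This is the position of `c` in `L`, raised to the first legal start if necessary. The block
      -- starting there puts `c` no higher than `L` does, and `d` no lower by `h1` and `h3`, so its
      -- gain is at least that of `L`.
      set i := max ((univ.filter fun a => L a c).card + 1)
        ((univ.filter fun a => P.prefers v a d).card -
          (univ.filter fun a => P.prefers v c a ∧ P.prefers v a d).card) with hi
      refine ⟨i, by omega, (hstart i).mpr ⟨by omega, by omega⟩, ?_⟩
      rw [Input.blockGain, hb, hs _ (by omega) (by omega), hs _ (by omega) (by omega)]
      exact sub_le_sub (r.score_le m _ _ (by omega) (by omega) (by omega))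
        (r.score_le m _ _ (by omega) (by omega) (by omega))
    -- Any linear extension provides a legal start, so a best one exists.
    obtain ⟨L₀, hL₀, hext₀, -⟩ := exists_linearExtension (P.prefers v) (fun _ => 0)
      (fun _ _ _ => le_rfl)
    obtain ⟨i₀, hi₀, hi₀', -⟩ := hle L₀ hL₀ hext₀
    have hbest : ∃ i < m + 1, I.IsBlockStart v c d i ∧
        ∀ j < I.m + 1, I.IsBlockStart v c d j → I.blockGain v c d j ≤ I.blockGain v c d i := by
      obtain ⟨i, hi, hmax⟩ := exists_max_image ((range (m + 1)).filter (I.IsBlockStart v c d))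
        (I.blockGain v c d) ⟨i₀, by simp [hi₀, hi₀']⟩
      simp only [mem_filter, mem_range] at hi hmax
      exact ⟨i, hi.1, hi.2, fun j hj hj' => hmax j ⟨hj, hj'⟩⟩
    obtain ⟨-, h1, h2⟩ := leastBelow_spec hbest
    constructor
    · intro L hL hext
      obtain ⟨i, hi, hi', h3⟩ := hle L hL hext
      rw [hg]
      exact h3.trans (h2 i hi hi')
    · rw [hg]
      exact hblock _ h1
  · have hg : I.gain v c d = I.score (I.above v d + 1) - I.score (I.last v c) :=
      if_neg (mt (prefers_iff v c d).mp hcd)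
    obtain ⟨L, hL, hext, h1, h2⟩ := exists_extreme hne hcd
    have h3 := hpos L hL d
    have h4 := hpos L hL c
    rw [hg, ha, hl, ← h2, hs _ (by omega) (by omega), hs _ (by omega) (by omega), ← h1]
    refine ⟨fun L' hL' hext' => ?_, L, hL, hext, rfl⟩
    have h5 := card_before_le hext' d
    have h6 := card_before_lt hext' c
    have h7 := hpos L' hL' d
    exact sub_le_sub (r.score_le m _ _ (by omega) (by omega) (by omega))
      (r.score_le m _ _ (by omega) (by omega) (by omega))

/-- The extensions that realise the gains of the single voters form one completion, so for each pair
the sum of the gains is an attained maximum. If it is `0`, the tie breaker decides. -/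
theorem isNecessary_iff :
    (⟨n, m, P, tie, D, r.score m⟩ : Input).IsNecessary ↔
      IsNecessaryTopSet r P tie D.card D := by
  classical
  simp only [IsNecessaryTopSet, Profile.forall_mem_iff_isTopWinner]
  have key : ∀ c d : Fin m, c ≠ d →
      ((∀ T : Profile n m, T.Completes P → T.Defeats r tie c d) ↔
        (∑ v ∈ range n, (⟨n, m, P, tie, D, r.score m⟩ : Input).gain v c d < 0 ∨
          (∑ v ∈ range n, (⟨n, m, P, tie, D, r.score m⟩ : Input).gain v c d = 0 ∧
            tie.before c d))) := by
    intro c d hne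
    rw [sum_range]
    have hscore : ∀ T : Profile n m, T.totalScore r d - T.totalScore r c =
        ∑ v, (r.score m ((univ.filter fun a => T.prefers v a d).card + 1) -
          r.score m ((univ.filter fun a => T.prefers v a c).card + 1)) := fun T => by
      simp only [Profile.totalScore, Profile.position, ncard_setOf, sum_sub_distrib]
    constructor
    · intro h
      choose L hL hext hgain using fun v => (gain_spec (P := P) (tie := tie) (D := D) (r := r) v
        hne).2
      have h1 := hscore ⟨L, hL⟩
      simp only [hgain] at h1
      rw [← h1]
      rcases h ⟨L, hL⟩ fun v => hext v with h | ⟨h, h'⟩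
      · exact Or.inl (by linarith)
      · exact Or.inr ⟨by linarith, h'⟩
    · intro h T hT
      have h1 : T.totalScore r d - T.totalScore r c ≤
          ∑ v, (⟨n, m, P, tie, D, r.score m⟩ : Input).gain (v : Fin n) c d := by
        rw [hscore]
        exact sum_le_sum fun v _ => (gain_spec v hne).1 _ (T.isStrictTotalOrder v) (hT v)
      rcases h with h | ⟨h, h'⟩
      · exact Or.inl (by linarith)
      · rcases (show T.totalScore r d ≤ T.totalScore r c by linarith).lt_or_eq with h2 | h2
        exacts [Or.inl h2, Or.inr ⟨h2.symm, h'⟩]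
  constructor
  · intro h T hT c hc d hd
    refine (key c d (by rintro rfl; exact hd hc)).mpr ?_ T hT
    simpa only [before_iff] using h c c.2 ((mem_iff c).mpr hc) d d.2 (mt (mem_iff d).mp hd)
  · rintro h c hc ⟨_, hcD⟩ d hd hdD
    have hdD' : (⟨d, hd⟩ : Fin m) ∉ D := fun h => hdD ⟨hd, h⟩
    have := (key ⟨c, hc⟩ ⟨d, hd⟩ (by rintro h; rw [h] at hcD; exact hdD' hcD)).mp
      fun T hT => h T hT _ hcD _ hdD'
    rcases this with h | ⟨h, h'⟩
    exacts [Or.inl h, Or.inr ⟨h, hc, hd, h'⟩]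

theorem decidableInTime_isNecessaryTopSet (hr : r.PolyTimeComputable) :
    DecidableInTime fun P tie D => IsNecessaryTopSet r P tie D.card D :=
  decidableInTime_of_compP (Layout.compP_isNecessary (K := Layout.base)) hr.exists_tabulate
    fun _ _ _ _ _ _ => isNecessary_iff

end Correctness

end Voting

namespace Voting

open Finset

/-! ### Assignments with capacities -/

/-- The `n` voters can be assigned to the `M` candidates, each to an allowed one, so that
the capacities are respected. -/
def CapFeasible (n M : ℕ) (A : ℕ → ℕ → Prop) (cap : ℕ → ℤ) : Prop :=
  ∃ f : ℕ → ℕ, (∀ v < n, f v < M ∧ A v (f v)) ∧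
    ∀ c < M, (((range n).filter fun v => f v = c).card : ℤ) ≤ cap c

namespace PushRelabel

/-- An assignment `f` and a height function `h` with the invariants of the algorithm. -/
structure Invariant (n M : ℕ) (A : ℕ → ℕ → Prop) (cap : ℕ → ℤ) (f : ℕ → ℕ) (h : ℕ → ℤ) :
    Prop where
  lt : ∀ v < n, f v < M
  allowed : ∀ v < n, A v (f v)
  nonneg : ∀ c < M, 0 ≤ h c
  le : ∀ c < M, h c ≤ M
  valid : ∀ v < n, ∀ c < M, A v c → h (f v) ≤ h c + 1
  full : ∀ c < M, 0 < h c → cap c ≤ ((range n).filter fun v => f v = c).card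

/-- The potential that every step decreases. -/
def potential (n M : ℕ) (f : ℕ → ℕ) (h : ℕ → ℤ) : ℤ :=
  ∑ c ∈ range M, (M - h c) * (n + 1) + ∑ v ∈ range n, h (f v)

variable {n M : ℕ} {A : ℕ → ℕ → Prop} {cap : ℕ → ℤ} {f : ℕ → ℕ} {h : ℕ → ℤ}

/-- The move lowers the second sum of the potential by one. Only an overfull candidate loses a
voter, so full candidates stay full, and `v` stays valid since it moves to a lower height. -/
theorem Invariant.push (hI : Invariant n M A cap f h) {v c : ℕ} (hv : v < n) (hc : c < M)
    (hA : A v c) (hh : h c + 1 = h (f v))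
    (hover : cap (f v) < ((range n).filter fun w => f w = f v).card) :
    Invariant n M A cap (Function.update f v c) h ∧
      potential n M (Function.update f v c) h < potential n M f h := by
  refine ⟨⟨?_, ?_, hI.nonneg, hI.le, ?_, ?_⟩, ?_⟩
  · intro w hw
    rw [Function.update_apply]
    split_ifs
    exacts [hc, hI.lt w hw]
  · intro w hw
    rw [Function.update_apply]
    split_ifs with h1
    exacts [h1 ▸ hA, hI.allowed w hw]
  · intro w hw y hy hwy
    rw [Function.update_apply]
    split_ifs with h1
    · subst h1
      have := hI.valid w hw y hy hwy
      omega
    · exact hI.valid w hw y hy hwy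
  · intro y hy hpos
    by_cases hyv : y = f v
    · have hsub : ((range n).filter fun w => f w = y) ⊆
          insert v ((range n).filter fun w => Function.update f v c w = y) := by
        intro w hw
        simp only [mem_filter, mem_range, mem_insert] at hw ⊢
        by_cases h1 : w = v
        · exact Or.inl h1
        · rw [Function.update_of_ne h1]
          exact Or.inr hw
      have := (card_le_card hsub).trans (card_insert_le _ _)
      rw [← hyv] at hover
      omega
    · have hsub : ((range n).filter fun w => f w = y) ⊆
          ((range n).filter fun w => Function.update f v c w = y) := by
        intro w hw
        simp only [mem_filter, mem_range] at hw ⊢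
        rw [Function.update_of_ne (by rintro rfl; exact hyv hw.2.symm)]
        exact hw
      have := card_le_card hsub
      have := hI.full y hy hpos
      omega
  · have h1 := add_sum_erase (range n) (fun w => h (f w)) (mem_range.mpr hv)
    have h2 := add_sum_erase (range n) (fun w => h (Function.update f v c w)) (mem_range.mpr hv)
    have h3 : ∑ w ∈ (range n).erase v, h (Function.update f v c w) =
        ∑ w ∈ (range n).erase v, h (f w) :=
      sum_congr rfl fun w hw => by rw [Function.update_of_ne (ne_of_mem_erase hw)]
    simp only [Function.update_self] at h2
    simp only [potential]
    omega

/-- Raising `x` takes `n + 1` from the first sum of the potential and adds at most `n` to the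
second. By `hstuck` no voter at `x` has an allowed candidate exactly one below, so validity leaves
room for the increase. -/
theorem Invariant.relabel (hI : Invariant n M A cap f h) {x : ℕ} (hx : x < M) (hxM : h x < M)
    (hover : cap x < ((range n).filter fun w => f w = x).card)
    (hstuck : ∀ v < n, f v = x → ∀ c < M, A v c → h c + 1 ≠ h x) :
    Invariant n M A cap f (Function.update h x (h x + 1)) ∧
      potential n M f (Function.update h x (h x + 1)) < potential n M f h := by
  have hle : ∀ y, h y ≤ Function.update h x (h x + 1) y := by
    intro y
    rw [Function.update_apply]
    split_ifs with h1
    · rw [h1]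
      omega
    · exact le_rfl
  refine ⟨⟨hI.lt, hI.allowed, fun c hc => (hI.nonneg c hc).trans (hle c), ?_, ?_, ?_⟩, ?_⟩
  · intro c hc
    rw [Function.update_apply]
    split_ifs
    exacts [by omega, hI.le c hc]
  · intro v hv c hc hA
    have h1 := hI.valid v hv c hc hA
    have h2 := hle c
    by_cases hfx : f v = x
    · have h3 := hstuck v hv hfx c hc hA
      rw [hfx] at h1 ⊢
      rw [Function.update_self]
      omega
    · rw [Function.update_of_ne hfx]
      omega
  · intro c hc hpos
    by_cases hcx : c = x
    · rw [hcx]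
      exact hover.le
    · rw [Function.update_of_ne hcx] at hpos
      exact hI.full c hc hpos
  · have h1 := add_sum_erase (range M) (fun c => (M - h c) * (n + 1)) (mem_range.mpr hx)
    have h2 := add_sum_erase (range M)
      (fun c => (M - Function.update h x (h x + 1) c) * (n + 1)) (mem_range.mpr hx)
    have h3 : ∑ c ∈ (range M).erase x, (M - Function.update h x (h x + 1) c) * (n + 1 : ℤ) =
        ∑ c ∈ (range M).erase x, (M - h c) * (n + 1 : ℤ) :=
      sum_congr rfl fun c hc => by rw [Function.update_of_ne (ne_of_mem_erase hc)]
    have h4 : ∑ v ∈ range n, Function.update h x (h x + 1) (f v) ≤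
        ∑ v ∈ range n, (h (f v) + 1) := by
      refine sum_le_sum fun v _ => ?_
      rw [Function.update_apply]
      split_ifs with h5
      · rw [h5]
      · omega
    rw [sum_add_distrib, sum_const, card_range, nsmul_one] at h4
    simp only [Function.update_self] at h2
    simp only [potential]
    rw [← h1, ← h2, h3]
    nlinarith

/-- If the algorithm is stuck, then its assignment respects the capacities, or none does. -/
theorem Invariant.feasible_iff (hI : Invariant n M A cap f h)
    (hstuck : ∀ c < M, cap c < ((range n).filter fun v => f v = c).card → (M : ℤ) ≤ h c) :
    (∀ c < M, (((range n).filter fun v => f v = c).card : ℤ) ≤ cap c) ↔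
      CapFeasible n M A cap := by
  refine ⟨fun hf => ⟨f, fun v hv => ⟨hI.lt v hv, hI.allowed v hv⟩, hf⟩, ?_⟩
  rintro ⟨g, hg, hcap⟩ x hx
  by_contra hover
  push Not at hover
  have hxM := hstuck x hx hover
  -- Since `x` has height at least `M`, only `M - 1` candidates remain for the `M` heights below
  -- `M`, and some height `l` is not taken.
  obtain ⟨l, hl, hgap⟩ : ∃ l < M, ∀ c < M, h c ≠ l := by
    by_contra hne
    push Not at hne
    have hsub : (range M).image (fun l : ℕ => (l : ℤ)) ⊆ ((range M).erase x).image h := by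
      intro l hl
      obtain ⟨k, hk, rfl⟩ := mem_image.mp hl
      obtain ⟨c, hc, hck⟩ := hne k (mem_range.mp hk)
      refine mem_image.mpr ⟨c, mem_erase.mpr ⟨?_, mem_range.mpr hc⟩, hck⟩
      rintro rfl
      have := mem_range.mp hk
      omega
    have h1 := (card_le_card hsub).trans card_image_le
    rw [card_image_of_injective _ Nat.cast_injective,
      card_erase_of_mem (mem_range.mpr hx), card_range] at h1
    omega
  -- By validity and the gap, a voter assigned into `S` has all its allowed candidates in `S`, so
  -- `g` puts at least as many voters there as `f`. But under `f` all of `S` is full and `x` is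
  -- overfull, so `g` exceeds the total capacity of `S`.
  set S := (range M).filter fun c => (l : ℤ) < h c with hS
  have hsum : ∀ f' : ℕ → ℕ, ((range n).filter fun v => f' v ∈ S).card =
      ∑ c ∈ S, ((range n).filter fun v => f' v = c).card := by
    intro f'
    rw [card_eq_sum_card_fiberwise (f := f') (s := (range n).filter fun v => f' v ∈ S) (t := S)
      fun v hv => (mem_filter.mp hv).2]
    refine sum_congr rfl fun c hc => ?_
    rw [filter_filter]
    congr 1
    ext v
    simp only [mem_filter]
    constructor
    · exact fun ⟨h1, _, h3⟩ => ⟨h1, h3⟩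
    · exact fun ⟨h1, h3⟩ => ⟨h1, h3 ▸ hc, h3⟩
  have h1 : ((range n).filter fun v => f v ∈ S).card ≤
      ((range n).filter fun v => g v ∈ S).card := by
    refine card_le_card fun v hv => ?_
    simp only [hS, mem_filter, mem_range] at hv ⊢
    obtain ⟨k1, k2⟩ := hg v hv.1
    have k3 := hI.valid v hv.1 _ k1 k2
    have k4 := hgap _ k1
    exact ⟨hv.1, k1, by omega⟩
  rw [hsum, hsum] at h1
  have h2 : (∑ c ∈ S, ((range n).filter fun v => g v = c).card : ℤ) ≤ ∑ c ∈ S, cap c :=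
    sum_le_sum fun c hc => hcap c (mem_range.mp (mem_filter.mp hc).1)
  have h3 : ∑ c ∈ S, cap c < (∑ c ∈ S, ((range n).filter fun v => f v = c).card : ℤ) := by
    refine sum_lt_sum (fun c hc => ?_) ⟨x, ?_, hover⟩
    · obtain ⟨k1, k2⟩ := mem_filter.mp hc
      exact hI.full c (mem_range.mp k1) (by omega)
    · exact mem_filter.mpr ⟨mem_range.mpr hx, by omega⟩
  have h4 : (∑ c ∈ S, ((range n).filter fun v => f v = c).card : ℤ) ≤
      ∑ c ∈ S, (((range n).filter fun v => g v = c).card : ℤ) := by exact_mod_cast h1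
  linarith

/-! The algorithm works on an array that holds the assignment, followed by the heights. -/

/-- The number of voters assigned to `c`. -/
noncomputable def load (n : ℕ) (a : ℕ → ℤ) (c : ℕ) : ℕ := countBelow n fun v => a v = c

/-- A candidate above its capacity that can be processed. -/
noncomputable def active (n M : ℕ) (cap : ℕ → ℤ) (a : ℕ → ℤ) : ℕ :=
  leastBelow M fun c => cap c < load n a c ∧ a (n + c) < M

/-- Voter `v` can move down from `x` to `c`. -/
def CanMove (n : ℕ) (A : ℕ → ℕ → Prop) (a : ℕ → ℤ) (x v c : ℕ) : Prop :=
  a v = x ∧ A v c ∧ a (n + c) + 1 = a (n + x)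

/-- A voter that can move down from `x`. -/
noncomputable def mover (n M : ℕ) (A : ℕ → ℕ → Prop) (a : ℕ → ℤ) (x : ℕ) : ℕ :=
  leastBelow n fun v => ∃ c < M, CanMove n A a x v c

/-- A candidate to which voter `v` can move down from `x`. -/
noncomputable def target (n M : ℕ) (A : ℕ → ℕ → Prop) (a : ℕ → ℤ) (x v : ℕ) : ℕ :=
  leastBelow M (CanMove n A a x v)

/-- The effect of processing candidate `x`. -/
noncomputable def process (n M : ℕ) (A : ℕ → ℕ → Prop) (a : ℕ → ℤ) (i x : ℕ) : ℤ :=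
  if x < M then
    if mover n M A a x < n then
      if i = mover n M A a x then target n M A a x (mover n M A a x) else a i
    else if i = n + x then a i + 1 else a i
  else a i

/-- One step of the algorithm. -/
noncomputable def step (n M : ℕ) (A : ℕ → ℕ → Prop) (cap : ℕ → ℤ) (a : ℕ → ℤ) (i : ℕ) : ℤ :=
  process n M A a i (active n M cap a)

/-- The initial array. -/
noncomputable def init (n M : ℕ) (A : ℕ → ℕ → Prop) (i : ℕ) : ℤ :=
  if i < n then leastBelow M (A i) else 0

/-- The array `a` holds the assignment `f` and the heights `h`. -/
def Encodes (n M : ℕ) (a : ℕ → ℤ) (f : ℕ → ℕ) (h : ℕ → ℤ) : Prop :=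
  (∀ v < n, a v = f v) ∧ ∀ c < M, a (n + c) = h c

variable {a : ℕ → ℤ}

theorem Encodes.tab (he : Encodes n M a f h) : Encodes n M (Layout.tab (n + M) a) f h :=
  ⟨fun v hv => by rw [Layout.tab, if_pos (by omega), he.1 v hv],
    fun c hc => by rw [Layout.tab, if_pos (by omega), he.2 c hc]⟩

theorem Encodes.load (he : Encodes n M a f h) (c : ℕ) :
    PushRelabel.load n a c = ((range n).filter fun v => f v = c).card := by
  rw [PushRelabel.load, countBelow_eq_card]
  congr 1
  ext v
  simp only [mem_filter, mem_range]
  refine and_congr_right fun hv => ?_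
  rw [he.1 v hv, Nat.cast_inj]

/-- An active candidate is pushed from if one of its voters can move down and is relabelled
otherwise; without an active candidate the algorithm is stuck and the array stays as it is. -/
theorem Encodes.step (he : Encodes n M a f h) (hI : Invariant n M A cap f h) :
    (∀ c < M, cap c < ((range n).filter fun v => f v = c).card → (M : ℤ) ≤ h c) ∧
      Encodes n M (step n M A cap a) f h ∨
    ¬ (∀ c < M, cap c < ((range n).filter fun v => f v = c).card → (M : ℤ) ≤ h c) ∧
    ∃ f' h', Invariant n M A cap f' h' ∧ Encodes n M (step n M A cap a) f' h' ∧
      potential n M f' h' < potential n M f h := by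
  by_cases hact : ∃ c < M, cap c < PushRelabel.load n a c ∧ a (n + c) < M
  · right
    obtain ⟨hx, hover, hlow⟩ := leastBelow_spec hact
    change active n M cap a < M at hx
    change cap (active n M cap a) < PushRelabel.load n a (active n M cap a) at hover
    change a (n + active n M cap a) < _ at hlow
    have hstep : ∀ i, PushRelabel.step n M A cap a i =
        process n M A a i (active n M cap a) := fun i => rfl
    generalize active n M cap a = x at hx hover hlow hstep
    rw [he.load] at hover
    rw [he.2 x hx] at hlow
    refine ⟨fun hstuck => not_le.mpr hlow (hstuck x hx hover), ?_⟩
    by_cases hmove : ∃ v < n, ∃ c < M, CanMove n A a x v c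
    · obtain ⟨hv, htar⟩ := leastBelow_spec hmove
      change mover n M A a x < n at hv
      change ∃ c < M, CanMove n A a x (mover n M A a x) c at htar
      obtain ⟨hc, h1, h2, h3⟩ := leastBelow_spec htar
      change target n M A a x (mover n M A a x) < M at hc
      have hstep' : ∀ i, PushRelabel.step n M A cap a i =
          if i = mover n M A a x then (target n M A a x (mover n M A a x) : ℤ) else a i := by
        intro i
        rw [hstep, process, if_pos hx, if_pos hv]
      change A _ (target n M A a x (mover n M A a x)) at h2
      change a (n + target n M A a x (mover n M A a x)) + 1 = _ at h3
      generalize target n M A a x (mover n M A a x) = c at hc h2 h3 hstep'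
      generalize mover n M A a x = v at hv h1 h2 hstep'
      rw [he.1 v hv, Nat.cast_inj] at h1
      subst h1
      rw [he.2 _ hc, he.2 _ hx] at h3
      obtain ⟨k1, k2⟩ := hI.push hv hc h2 h3 hover
      refine ⟨_, _, k1, ⟨fun w hw => ?_, fun y hy => ?_⟩, k2⟩
      · rw [hstep', Function.update_apply]
        split_ifs
        exacts [rfl, he.1 w hw]
      · rw [hstep', if_neg (by omega), he.2 y hy]
    · have hv : ¬ mover n M A a x < n := fun hlt => hmove (leastBelow_lt_iff.mp hlt)
      obtain ⟨k1, k2⟩ := hI.relabel hx hlow hover fun v hv hvx c hc hA hh => hmove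
        ⟨v, hv, c, hc, by rw [he.1 v hv, hvx], hA, by rw [he.2 c hc, he.2 x hx, hh]⟩
      refine ⟨_, _, k1, ⟨fun w hw => ?_, fun y hy => ?_⟩, k2⟩
      · rw [hstep, process, if_pos hx, if_neg hv, if_neg (by omega), he.1 w hw]
      · rw [hstep, process, if_pos hx, if_neg hv, Function.update_apply, he.2 y hy]
        by_cases hyx : y = x
        · rw [if_pos (by omega), if_pos hyx, hyx]
        · rw [if_neg (by omega), if_neg hyx]
  · left
    have hx : ¬ active n M cap a < M := fun hlt => hact (leastBelow_lt_iff.mp hlt)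
    have hstep : PushRelabel.step n M A cap a = a := by
      funext i
      rw [PushRelabel.step, process, if_neg hx]
    rw [hstep]
    refine ⟨fun c hc hover => ?_, he⟩
    by_contra hlt
    exact hact ⟨c, hc, by rwa [he.load], by rw [he.2 c hc]; omega⟩

/-- The array after termination. -/
noncomputable def result (n M : ℕ) (A : ℕ → ℕ → Prop) (cap : ℕ → ℤ) : ℕ → ℤ :=
  (fun a => Layout.tab (n + M) (step n M A cap a))^[M * M * (n + 1)]
    (Layout.tab (n + M) (init n M A))

/-- The potential starts at `M * M * (n + 1)` and drops with every step that is not stuck. After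
that many rounds it would be at most `0`, whereas a candidate below height `M` makes it positive; so
the algorithm is stuck by then. The hypothesis `hA` makes the initial assignment allowed. -/
theorem forall_load_result_le_iff (hA : ∀ v < n, ∃ c < M, A v c) :
    (∀ c < M, (load n (result n M A cap) c : ℤ) ≤ cap c) ↔ CapFeasible n M A cap := by
  have key : ∀ j, ∃ f h, Invariant n M A cap f h ∧
      Encodes n M ((fun a => Layout.tab (n + M) (step n M A cap a))^[j]
        (Layout.tab (n + M) (init n M A))) f h ∧
      ((∀ c < M, cap c < ((range n).filter fun v => f v = c).card → (M : ℤ) ≤ h c) ∨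
        potential n M f h ≤ (M * M * (n + 1) : ℕ) - j) := by
    intro j
    induction j with
    | zero =>
      refine ⟨fun v => leastBelow M (A v), fun _ => 0, ⟨fun v hv => (leastBelow_spec (hA v hv)).1,
        fun v hv => (leastBelow_spec (hA v hv)).2, fun _ _ => le_rfl, fun _ _ => by positivity,
        fun _ _ _ _ _ => by norm_num, fun _ _ h => absurd h (lt_irrefl _)⟩,
        Encodes.tab ⟨fun v hv => if_pos hv, fun c _ => if_neg (by omega)⟩, Or.inr ?_⟩
      simp [potential, mul_assoc]
    | succ j ih =>
      obtain ⟨f, h, hI, he, hor⟩ := ih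
      rw [Function.iterate_succ_apply']
      rcases he.step hI with ⟨h1, h2⟩ | ⟨hne, f', h', hI', he', hlt⟩
      · exact ⟨f, h, hI, h2.tab, Or.inl h1⟩
      · rcases hor with h1 | h1
        · exact absurd h1 hne
        · exact ⟨f', h', hI', he'.tab, Or.inr (by push_cast at h1 ⊢; omega)⟩
  obtain ⟨f, h, hI, he, hor⟩ := key (M * M * (n + 1))
  have hstuck : ∀ c < M, cap c < ((range n).filter fun v => f v = c).card → (M : ℤ) ≤ h c := by
    rcases hor with h1 | h1
    · exact h1
    · intro c hc _
      by_contra hlt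
      rw [sub_self] at h1
      refine absurd h1 (not_le.mpr ?_)
      refine add_pos_of_pos_of_nonneg ?_ (sum_nonneg fun v hv =>
        hI.nonneg _ (hI.lt v (mem_range.mp hv)))
      refine sum_pos' (fun y hy => ?_) ⟨c, mem_range.mpr hc, ?_⟩
      · have := hI.le y (mem_range.mp hy)
        exact mul_nonneg (by omega) (by positivity)
      · exact mul_pos (by omega) (by positivity)
  rw [← hI.feasible_iff hstuck]
  refine forall₂_congr fun c _ => ?_
  rw [← he.load]
  rfl

end PushRelabel

end Voting

namespace Voting

open Finset

/-! ### Assignments in which given candidates come first -/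

/-- The voters can be assigned to allowed candidates so that each candidate in `X` has more voters
than each other candidate, or as many and priority. -/
def LeadFeasible (n m : ℕ) (A : ℕ → ℕ → Prop) (X : ℕ → Prop) (B : ℕ → ℕ → Prop) : Prop :=
  ∃ f : ℕ → ℕ, (∀ v < n, f v < m ∧ A v (f v)) ∧ ∀ x < m, X x → ∀ y < m, ¬ X y →
    ((range n).filter fun v => f v = y).card < ((range n).filter fun v => f v = x).card ∨
      ((range n).filter fun v => f v = y).card = ((range n).filter fun v => f v = x).card ∧ B x y

/-- The voters can be assigned to allowed candidates with lower bounds for the candidates in `X`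
and upper bounds for the others. -/
def BoundFeasible (n m : ℕ) (A : ℕ → ℕ → Prop) (X : ℕ → Prop) (L : ℕ → ℕ) (U : ℕ → ℤ) : Prop :=
  ∃ f : ℕ → ℕ, (∀ v < n, f v < m ∧ A v (f v)) ∧
    (∀ x < m, X x → L x ≤ ((range n).filter fun v => f v = x).card) ∧
    ∀ y < m, ¬ X y → (((range n).filter fun v => f v = y).card : ℤ) ≤ U y

open Classical in
/-- The voters needed by `x` if the last candidate of `X` is `e`, with `s` voters. -/
noncomputable def lowerBound (B : ℕ → ℕ → Prop) (s e x : ℕ) : ℕ :=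
  if x = e ∨ B x e then s else s + 1

open Classical in
/-- The voters possible for `y` if the last candidate of `X` is `e`, with `s` voters. -/
noncomputable def upperBound (B : ℕ → ℕ → Prop) (s e y : ℕ) : ℤ :=
  if B e y then s else s - 1

theorem exists_last {m : ℕ} {B : ℕ → ℕ → Prop}
    (htrans : ∀ a < m, ∀ b < m, ∀ c < m, B a b → B b c → B a c)
    (htotal : ∀ a < m, ∀ b < m, a = b ∨ B a b ∨ B b a) {S : Finset ℕ} (hS : S.Nonempty)
    (hSm : ∀ a ∈ S, a < m) : ∃ e ∈ S, ∀ x ∈ S, x = e ∨ B x e := by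
  induction hS using Finset.Nonempty.cons_induction with
  | singleton a => exact ⟨a, by simp, by simp⟩
  | cons a s ha _ ih =>
    obtain ⟨e, he, hmax⟩ := ih fun b hb => hSm b (mem_cons_of_mem hb)
    have ham := hSm a (mem_cons_self a s)
    have hem := hSm e (mem_cons_of_mem he)
    rcases htotal a ham e hem with h | h | h
    · exact absurd (h ▸ he) ha
    · refine ⟨e, mem_cons_of_mem he, fun x hx => ?_⟩
      rcases mem_cons.mp hx with rfl | hx
      exacts [Or.inr h, hmax x hx]
    · refine ⟨a, mem_cons_self a s, fun x hx => ?_⟩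
      rcases mem_cons.mp hx with rfl | hx
      · exact Or.inl rfl
      · have hxm := hSm x (mem_cons_of_mem hx)
        rcases hmax x hx with rfl | h'
        exacts [Or.inr h, Or.inr (htrans x hxm e hem a ham h' h)]

/-- Take for `e` the weakest member of `X`: fewest voters, and last in priority among those.
Comparison with `e` bounds every other candidate from below or above, and by transitivity these
bounds imply all the comparisons between members of `X` and others. -/
theorem leadFeasible_iff {n m : ℕ} {A : ℕ → ℕ → Prop} {X : ℕ → Prop} {B : ℕ → ℕ → Prop}
    (hm : 0 < m) (htrans : ∀ a < m, ∀ b < m, ∀ c < m, B a b → B b c → B a c)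
    (htotal : ∀ a < m, ∀ b < m, a = b ∨ B a b ∨ B b a) :
    LeadFeasible n m A X B ↔ ∃ s < n + 2, ∃ e < m,
      BoundFeasible n m A X (lowerBound B s e) (upperBound B s e) := by
  classical
  constructor
  · rintro ⟨f, hf, hlead⟩
    have hcard : ∀ x, ((range n).filter fun v => f v = x).card ≤ n := fun x =>
      (card_filter_le _ _).trans (card_range n).le
    by_cases hX : ∃ x < m, X x
    · obtain ⟨x₀, hx₀, hmin⟩ := exists_min_image ((range m).filter X)
        (fun x => ((range n).filter fun v => f v = x).card)
        (by obtain ⟨x, hx, hx'⟩ := hX; exact ⟨x, by simp [hx, hx']⟩)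
      simp only [mem_filter, mem_range] at hx₀ hmin
      set s := ((range n).filter fun v => f v = x₀).card with hs
      obtain ⟨e, he, hlast⟩ := exists_last htrans htotal
        (S := (range m).filter fun x => X x ∧ ((range n).filter fun v => f v = x).card = s)
        ⟨x₀, by simp [hx₀, hs]⟩ (fun a ha => by simp only [mem_filter, mem_range] at ha; exact ha.1)
      simp only [mem_filter, mem_range] at he hlast
      refine ⟨s, by have := hcard x₀; omega, e, he.1, f, hf, ?_, ?_⟩
      · intro x hx hxX
        have h1 := hmin x ⟨hx, hxX⟩
        rw [lowerBound]
        split_ifs with h2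
        · exact h1
        · refine lt_of_le_of_ne h1 fun h3 => h2 (hlast x ⟨hx, hxX, h3.symm⟩)
      · intro y hy hyX
        have h1 := hlead e he.1 he.2.1 y hy hyX
        rw [he.2.2] at h1
        rw [upperBound]
        split_ifs with h2
        · omega
        · have : ((range n).filter fun v => f v = y).card < s := by tauto
          omega
    -- Without members of `X`, the threshold `n + 1` makes every upper bound at least `n`, hence
    -- vacuous.
    · refine ⟨n + 1, by omega, 0, hm, f, hf, fun x hx hxX => absurd ⟨x, hx, hxX⟩ hX, ?_⟩
      intro y hy hyX
      have := hcard y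
      rw [upperBound]
      split_ifs <;> push_cast <;> omega
  -- Here `e` need not belong to `X`; the bounds suffice.
  · rintro ⟨s, -, e, he, f, hf, hL, hU⟩
    refine ⟨f, hf, fun x hx hxX y hy hyX => ?_⟩
    have h1 := hL x hx hxX
    have h2 := hU y hy hyX
    rw [lowerBound] at h1
    rw [upperBound] at h2
    split_ifs at h1 h2 with h3 h4 h4
    · rcases (show ((range n).filter fun v => f v = y).card ≤
        ((range n).filter fun v => f v = x).card by omega).lt_or_eq with h5 | h5
      · exact Or.inl h5
      · refine Or.inr ⟨h5, ?_⟩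
        rcases h3 with rfl | h3
        exacts [h4, htrans x hx e he y hy h3 h4]
    all_goals exact Or.inl (by omega)

/-- Voter `v` may be assigned to some candidate in `X`. -/
def CanReach (m : ℕ) (A : ℕ → ℕ → Prop) (X : ℕ → Prop) (v : ℕ) : Prop := ∃ x < m, X x ∧ A v x

/-- Allowed candidates after the addition of the candidate `m`, which takes the voters that the
candidates in `X` do not need. -/
def Allowed (m : ℕ) (A : ℕ → ℕ → Prop) (X : ℕ → Prop) (v c : ℕ) : Prop :=
  c = m ∧ CanReach m A X v ∨ c < m ∧ A v c ∧ (X c ∨ ¬ CanReach m A X v)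

open Classical in
/-- The capacities after the addition of the candidate `m`. -/
noncomputable def capacity (n m : ℕ) (A : ℕ → ℕ → Prop) (X : ℕ → Prop) (L : ℕ → ℕ) (U : ℕ → ℤ)
    (c : ℕ) : ℤ :=
  if c = m then countBelow n (CanReach m A X) - ∑ x ∈ range m, ((if X x then L x else 0 : ℕ) : ℤ)
  else if X c then L c else U c

theorem exists_allowed {n m : ℕ} {A : ℕ → ℕ → Prop} {X : ℕ → Prop}
    (hA : ∀ v < n, ∃ c < m, A v c) : ∀ v < n, ∃ c < m + 1, Allowed m A X v c := by
  intro v hv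
  by_cases h : CanReach m A X v
  · exact ⟨m, by omega, Or.inl ⟨rfl, h⟩⟩
  · obtain ⟨c, hc, hc'⟩ := hA v hv
    exact ⟨c, by omega, Or.inr ⟨hc, hc', Or.inr h⟩⟩

-- Allowed assignments send the voters that can reach `X` to `m` or to members of `X`, and send
-- nobody else there.
open Classical in
theorem card_canReach_eq_sum {n m : ℕ} {A : ℕ → ℕ → Prop} {X : ℕ → Prop} {f : ℕ → ℕ}
    (hf : ∀ v < n, Allowed m A X v (f v)) :
    countBelow n (CanReach m A X) = ((range n).filter fun v => f v = m).card +
      ∑ x ∈ (range m).filter X, ((range n).filter fun v => f v = x).card := by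
  have hm : m ∉ (range m).filter X := by simp
  rw [countBelow_eq_card, ← sum_insert (f := fun x => ((range n).filter fun v => f v = x).card) hm,
    card_eq_sum_card_fiberwise (f := f) (s := (range n).filter (CanReach m A X))
      (t := insert m ((range m).filter X))]
  · refine sum_congr rfl fun x hx => ?_
    rw [filter_filter]
    congr 1
    ext v
    simp only [mem_filter, mem_range]
    refine and_congr_right fun hv => and_iff_right_of_imp ?_
    rintro rfl
    rcases hf v hv with h | h
    · exact h.2
    · rcases mem_insert.mp hx with h' | h'
      · omega
      · exact ⟨f v, h.1, (mem_filter.mp h').2, h.2.1⟩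
  · intro v hv
    simp only [coe_filter, mem_range, Set.mem_ofPred_eq] at hv
    simp only [coe_insert, coe_filter, mem_range, Set.mem_insert_iff, Set.mem_ofPred_eq]
    rcases hf v hv.1 with h | ⟨h, -, h' | h'⟩
    exacts [Or.inl h.1, Or.inr ⟨h, h'⟩, absurd hv.2 h']

/-- Moving into `X` every voter that can reach it hurts no bound. Then exactly `L x` voters are kept
at each `x` in `X` and the surplus goes to `m`. Conversely, the capacities of `X` and `m` add up to
the number of voters that have to go there, so all of them are exhausted; voters at `m` return to
any member of `X` they can reach. -/
theorem boundFeasible_iff {n m : ℕ} {A : ℕ → ℕ → Prop} {X : ℕ → Prop} {L : ℕ → ℕ} {U : ℕ → ℤ} :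
    BoundFeasible n m A X L U ↔
      CapFeasible n (m + 1) (Allowed m A X) (capacity n m A X L U) := by
  classical
  have hsumL : ∑ x ∈ range m, ((if X x then L x else 0 : ℕ) : ℤ) =
      ∑ x ∈ (range m).filter X, (L x : ℤ) := by
    rw [sum_filter]
    push_cast
    rfl
  obtain ⟨g, hg⟩ : ∃ g : ℕ → ℕ, ∀ v, CanReach m A X v → g v < m ∧ X (g v) ∧ A v (g v) := by
    choose! g hg using fun v (h : CanReach m A X v) => h
    exact ⟨g, hg⟩
  constructor
  · rintro ⟨f, hf, hL, hU⟩
    -- In `f₁` every voter that can reach `X` is assigned to a member of `X`.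
    obtain ⟨f₁, hf₁, hmem, hL, hU⟩ : ∃ f₁ : ℕ → ℕ, (∀ v < n, f₁ v < m ∧ A v (f₁ v)) ∧
        (∀ v < n, CanReach m A X v → X (f₁ v)) ∧
        (∀ x < m, X x → L x ≤ ((range n).filter fun v => f₁ v = x).card) ∧
        ∀ y < m, ¬ X y → (((range n).filter fun v => f₁ v = y).card : ℤ) ≤ U y := by
      refine ⟨fun v => if CanReach m A X v ∧ ¬ X (f v) then g v else f v, ?_, ?_, ?_, ?_⟩
      · intro v hv
        beta_reduce
        split_ifs with h
        exacts [⟨(hg v h.1).1, (hg v h.1).2.2⟩, hf v hv]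
      · intro v hv hr
        beta_reduce
        split_ifs with h
        · exact (hg v hr).2.1
        · tauto
      · intro x hx hxX
        refine (hL x hx hxX).trans (card_le_card fun v hv => ?_)
        simp only [mem_filter] at hv ⊢
        rw [if_neg (by rw [hv.2]; tauto)]
        exact hv
      · intro y hy hyX
        refine le_trans ?_ (hU y hy hyX)
        rw [Nat.cast_le]
        refine card_le_card fun v hv => ?_
        simp only [mem_filter] at hv ⊢
        refine ⟨hv.1, ?_⟩
        have h1 := hv.2
        split_ifs at h1 with h
        · exact absurd (h1 ▸ (hg v h.1).2.1) hyX
        · exact h1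
    have hS : ∀ x, ∃ S : Finset ℕ, x < m → X x →
        S ⊆ ((range n).filter fun v => f₁ v = x) ∧ S.card = L x := by
      intro x
      by_cases hx : x < m ∧ X x
      · obtain ⟨S, h1, h2⟩ := exists_subset_card_eq (hL x hx.1 hx.2)
        exact ⟨S, fun _ _ => ⟨h1, h2⟩⟩
      · exact ⟨∅, fun h h' => absurd ⟨h, h'⟩ hx⟩
    choose S hS using hS
    set f₂ : ℕ → ℕ := fun v => if X (f₁ v) ∧ v ∉ S (f₁ v) then m else f₁ v with hf₂
    have hallowed : ∀ v < n, Allowed m A X v (f₂ v) := by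
      intro v hv
      obtain ⟨h1, h2⟩ := hf₁ v hv
      simp only [hf₂]
      split_ifs with h
      · exact Or.inl ⟨rfl, f₁ v, h1, h.1, h2⟩
      · refine Or.inr ⟨h1, h2, ?_⟩
        have := hmem v hv
        tauto
    have hX : ∀ x < m, X x → ((range n).filter fun v => f₂ v = x).card = L x := by
      intro x hx hxX
      obtain ⟨h1, h2⟩ := hS x hx hxX
      rw [← h2]
      congr 1
      ext v
      simp only [mem_filter, mem_range, hf₂]
      constructor
      · rintro ⟨hv, h3⟩
        split_ifs at h3 with h4
        · omega
        · rw [h3] at h4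
          tauto
      · intro hv
        have h3 := h1 hv
        simp only [mem_filter, mem_range] at h3
        rw [h3.2]
        exact ⟨h3.1, if_neg (by tauto)⟩
    refine ⟨f₂, fun v hv => ⟨?_, hallowed v hv⟩, fun c hc => ?_⟩
    · rcases hallowed v hv with h | h <;> omega
    · rw [capacity]
      split_ifs with h1 h2
      · rw [card_canReach_eq_sum hallowed, hsumL, h1]
        have : ∑ x ∈ (range m).filter X, ((range n).filter fun v => f₂ v = x).card =
            ∑ x ∈ (range m).filter X, L x := sum_congr rfl fun x hx => by
          simp only [mem_filter, mem_range] at hx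
          exact hX x hx.1 hx.2
        rw [this]
        push_cast
        omega
      · rw [hX c (by omega) h2]
      · refine le_trans ?_ (hU c (by omega) h2)
        rw [Nat.cast_le]
        refine card_le_card fun v hv => ?_
        simp only [mem_filter, hf₂] at hv ⊢
        refine ⟨hv.1, ?_⟩
        have h3 := hv.2
        split_ifs at h3 with h
        · exact absurd h3.symm h1
        · exact h3
  · rintro ⟨f, hf, hcap⟩
    have hallowed : ∀ v < n, Allowed m A X v (f v) := fun v hv => (hf v hv).2
    refine ⟨fun v => if f v = m then g v else f v, ?_, ?_, ?_⟩
    · intro v hv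
      beta_reduce
      split_ifs with h
      · rcases hallowed v hv with h' | h'
        · exact ⟨(hg v h'.2).1, (hg v h'.2).2.2⟩
        · omega
      · rcases hallowed v hv with h' | h'
        · omega
        · exact ⟨h'.1, h'.2.1⟩
    · intro x hx hxX
      have h1 := hcap m (by omega)
      rw [capacity, if_pos rfl, card_canReach_eq_sum hallowed, hsumL] at h1
      push_cast at h1
      have h2 : ∀ z ∈ (range m).filter X,
          (((range n).filter fun v => f v = z).card : ℤ) ≤ L z := by
        intro z hz
        simp only [mem_filter, mem_range] at hz
        have := hcap z (by omega)
        rwa [capacity, if_neg (by omega), if_pos hz.2] at this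
      -- The capacity of `m` forces the sum of the loads on `X` to be at least the sum of the `L x`,
      -- while each load is at most `L x`; so equality holds termwise.
      have h3 := (sum_eq_sum_iff_of_le h2).mp (le_antisymm (sum_le_sum h2) (by linarith)) x
        (by simp [hx, hxX])
      have h4 : ((range n).filter fun v => f v = x).card = L x := by exact_mod_cast h3
      rw [← h4]
      refine card_le_card fun v hv => ?_
      simp only [mem_filter] at hv ⊢
      exact ⟨hv.1, by rw [if_neg (by omega)]; exact hv.2⟩
    · intro y hy hyX
      have h1 := hcap y (by omega)
      rw [capacity, if_neg (by omega), if_neg hyX] at h1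
      refine le_trans ?_ h1
      rw [Nat.cast_le]
      refine card_le_card fun v hv => ?_
      simp only [mem_filter, mem_range] at hv ⊢
      refine ⟨hv.1, ?_⟩
      have h2 := hv.2
      split_ifs at h2 with h
      · rcases hallowed v hv.1 with h' | h'
        · exact absurd (h2 ▸ (hg v h'.2).2.1) hyX
        · omega
      · exact h2

/-- A decision procedure for assignments in which the candidates in `X` come first. -/
def LeadTest (n m : ℕ) (A : ℕ → ℕ → Prop) (X : ℕ → Prop) (B : ℕ → ℕ → Prop) : Prop :=
  ∃ s < n + 2, ∃ e < m, ∀ c < m + 1,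
    (PushRelabel.load n (PushRelabel.result n (m + 1) (Allowed m A X)
      (capacity n m A X (lowerBound B s e) (upperBound B s e))) c : ℤ) ≤
        capacity n m A X (lowerBound B s e) (upperBound B s e) c

theorem leadTest_iff {n m : ℕ} {A : ℕ → ℕ → Prop} {X : ℕ → Prop} {B : ℕ → ℕ → Prop}
    (hm : 0 < m) (htrans : ∀ a < m, ∀ b < m, ∀ c < m, B a b → B b c → B a c)
    (htotal : ∀ a < m, ∀ b < m, a = b ∨ B a b ∨ B b a) (hA : ∀ v < n, ∃ c < m, A v c) :
    LeadTest n m A X B ↔ LeadFeasible n m A X B := by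
  rw [leadFeasible_iff hm htrans htotal, LeadTest]
  simp only [boundFeasible_iff, PushRelabel.forall_load_result_le_iff (exists_allowed hA)]

end Voting

/-! ### The test for leading candidates in polynomially many steps. -/

namespace Voting

open Finset

/-- A predicate on a candidate, or on a voter, that is decidable in polynomial time. -/
def PolyPred (X : Input → ℕ → Prop) : Prop :=
  ∀ {Γ : Type} {K : Layout Γ} {c : Γ → ℕ}, K.CompN c → K.CompP fun γ => X (K.input γ) (c γ)

/-- A relation between candidates, or between voters and candidates, that is decidable in
polynomial time. -/
def PolyRel (A : Input → ℕ → ℕ → Prop) : Prop :=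
  ∀ {Γ : Type} {K : Layout Γ} {v c : Γ → ℕ}, K.CompN v → K.CompN c →
    K.CompP fun γ => A (K.input γ) (v γ) (c γ)

namespace Layout

variable {Γ : Type} {K : Layout Γ} {A : Input → ℕ → ℕ → Prop} {X : Input → ℕ → Prop}
  {B : Input → ℕ → ℕ → Prop}

theorem polyPred_canReach (hA : PolyRel A) (hX : PolyPred X) :
    PolyPred fun I => CanReach I.m (A I) (X I) := fun hv =>
  CompP.exists_lt compN_m polyBounded_m fun _ => (hX compN_var).and (hA hv.up compN_var)

theorem polyRel_allowed (hA : PolyRel A) (hX : PolyPred X) :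
    PolyRel fun I => Allowed I.m (A I) (X I) := fun hv hc =>
  ((CompP.eqN hc compN_m).and (polyPred_canReach hA hX hv)).or ((CompP.ltN hc compN_m).and
    ((hA hv hc).and ((hX hc).or (polyPred_canReach hA hX hv).not)))

open Classical in
theorem compN_lowerBound (hB : PolyRel B) {s e x : Γ → ℕ} (hs : K.CompN s) (he : K.CompN e)
    (hx : K.CompN x) : K.CompN fun γ => lowerBound (B (K.input γ)) (s γ) (e γ) (x γ) :=
  CompN.ite ((CompP.eqN hx he).or (hB hx he)) hs (hs.add (compN_const 1))

open Classical in
theorem comp_upperBound (hB : PolyRel B) {s e y : Γ → ℕ} (hs : K.CompN s) (he : K.CompN e)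
    (hy : K.CompN y) : K.Comp fun γ => upperBound (B (K.input γ)) (s γ) (e γ) (y γ) :=
  Comp.ite (hB he hy) hs (hs.sub (comp_const 1))

/-- The capacities for given thresholds. -/
noncomputable def leadCapacity (A : Input → ℕ → ℕ → Prop) (X : Input → ℕ → Prop)
    (B : Input → ℕ → ℕ → Prop) (I : Input) (s e : ℕ) : ℕ → ℤ :=
  capacity I.n I.m (A I) (X I) (lowerBound (B I) s e) (upperBound (B I) s e)

open Classical in
theorem comp_leadCapacity (hA : PolyRel A) (hX : PolyPred X) (hB : PolyRel B) {s e c : Γ → ℕ}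
    (hs : K.CompN s) (he : K.CompN e) (hc : K.CompN c) :
    K.Comp fun γ => leadCapacity A X B (K.input γ) (s γ) (e γ) (c γ) :=
  Comp.ite (CompP.eqN hc compN_m)
    (Comp.sub (CompN.countBelow (p := fun γ => CanReach (K.input γ).m (A (K.input γ))
        (X (K.input γ))) compN_n polyBounded_n fun _ => polyPred_canReach hA hX compN_var)
      (Comp.sum (g := fun γ x => ((if X (K.input γ) x then
          lowerBound (B (K.input γ)) (s γ) (e γ) x else 0 : ℕ) : ℤ)) compN_m polyBounded_m
        fun _ => CompN.ite (hX compN_var) (compN_lowerBound hB hs.up he.up compN_var)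
          (compN_const 0)))
    (Comp.ite (hX hc) (compN_lowerBound hB hs he hc) (comp_upperBound hB hs he hc))

theorem compN_m_succ : K.CompN fun γ => (K.input γ).m + 1 := compN_m.add (compN_const 1)

theorem polyBounded_m_succ : K.PolyBounded fun γ => (K.input γ).m + 1 :=
  polyBounded_m.add (polyBounded_const 1)

theorem compN_len : K.CompN fun γ => (K.input γ).n + ((K.input γ).m + 1) :=
  compN_n.add compN_m_succ

theorem polyBounded_len : K.PolyBounded fun γ => (K.input γ).n + ((K.input γ).m + 1) :=
  polyBounded_n.add polyBounded_m_succ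

/-- The array of the algorithm is in memory. -/
def HasState (K : Layout Γ) (a : Γ → ℕ → ℤ) : Prop :=
  K.HasArr (fun γ => (K.input γ).n + ((K.input γ).m + 1)) a

theorem hasState_pushArr {k : ℕ} :
    (K.pushArr (fun γ => (K.input γ).n + ((K.input γ).m + 1)) k).HasState fun γ => γ.2 :=
  hasArr_pushArr

theorem HasState.up' {a : Γ → ℕ → ℤ} (ha : K.HasState a) {k : ℕ} :
    (K.pushVar k).HasState fun γ => a γ.1 :=
  HasArr.up ha

theorem HasState.read {a : Γ → ℕ → ℤ} (ha : K.HasState a) {i : Γ → ℕ} (hi : K.CompN i) :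
    K.Comp fun γ => a γ (i γ) :=
  Comp.load compN_len ha hi

variable {a : Γ → ℕ → ℤ}

theorem compN_load (ha : K.HasState a) {c : Γ → ℕ} (hc : K.CompN c) :
    K.CompN fun γ => PushRelabel.load (K.input γ).n (a γ) (c γ) :=
  CompN.countBelow (p := fun γ v => a γ v = c γ) compN_n polyBounded_n fun _ =>
    CompP.eq (ha.up'.read compN_var) hc.up

theorem compN_active (hA : PolyRel A) (hX : PolyPred X) (hB : PolyRel B) {s e : Γ → ℕ}
    (hs : K.CompN s) (he : K.CompN e) (ha : K.HasState a) :
    K.CompN fun γ => PushRelabel.active (K.input γ).n ((K.input γ).m + 1)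
      (leadCapacity A X B (K.input γ) (s γ) (e γ)) (a γ) :=
  CompN.leastBelow (p := fun γ c => leadCapacity A X B (K.input γ) (s γ) (e γ) c <
      PushRelabel.load (K.input γ).n (a γ) c ∧
        a γ ((K.input γ).n + c) < ((K.input γ).m + 1 : ℕ)) compN_m_succ polyBounded_m_succ fun _ =>
    (CompP.lt (comp_leadCapacity hA hX hB hs.up he.up compN_var)
      (compN_load ha.up' compN_var)).and
      (CompP.lt (ha.up'.read (compN_n.add compN_var)) compN_m_succ)

theorem compP_canMove (hA : PolyRel A) (ha : K.HasState a) {x v c : Γ → ℕ} (hx : K.CompN x)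
    (hv : K.CompN v) (hc : K.CompN c) :
    K.CompP fun γ => PushRelabel.CanMove (K.input γ).n (A (K.input γ)) (a γ) (x γ) (v γ) (c γ) :=
  (CompP.eq (ha.read hv) hx).and ((hA hv hc).and
    (CompP.eq ((ha.read (compN_n.add hc)).add (comp_const 1)) (ha.read (compN_n.add hx))))

theorem compN_mover (hA : PolyRel A) (ha : K.HasState a) {x : Γ → ℕ} (hx : K.CompN x) :
    K.CompN fun γ => PushRelabel.mover (K.input γ).n ((K.input γ).m + 1) (A (K.input γ))
      (a γ) (x γ) :=
  CompN.leastBelow (p := fun γ v => ∃ c < (K.input γ).m + 1,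
      PushRelabel.CanMove (K.input γ).n (A (K.input γ)) (a γ) (x γ) v c) compN_n polyBounded_n
    fun _ => CompP.exists_lt compN_m_succ polyBounded_m_succ fun _ =>
      compP_canMove hA ha.up'.up' hx.up.up compN_var.up compN_var

theorem compN_target (hA : PolyRel A) (ha : K.HasState a) {x v : Γ → ℕ} (hx : K.CompN x)
    (hv : K.CompN v) :
    K.CompN fun γ => PushRelabel.target (K.input γ).n ((K.input γ).m + 1) (A (K.input γ))
      (a γ) (x γ) (v γ) :=
  CompN.leastBelow compN_m_succ polyBounded_m_succ fun _ =>
    compP_canMove hA ha.up' hx.up hv.up compN_var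

theorem comp_process (hA : PolyRel A) (ha : K.HasState a) {i x : Γ → ℕ} (hi : K.CompN i)
    (hx : K.CompN x) :
    K.Comp fun γ => PushRelabel.process (K.input γ).n ((K.input γ).m + 1) (A (K.input γ))
      (a γ) (i γ) (x γ) :=
  Comp.ite (CompP.ltN hx compN_m_succ)
    (Comp.ite (CompP.ltN (compN_mover hA ha hx) compN_n)
      (Comp.ite (CompP.eqN hi (compN_mover hA ha hx))
        (compN_target hA ha hx (compN_mover hA ha hx)) (ha.read hi))
      (Comp.ite (CompP.eqN hi (compN_n.add hx)) ((ha.read hi).add (comp_const 1)) (ha.read hi)))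
    (ha.read hi)

theorem comp_init (hA : PolyRel A) {i : Γ → ℕ} (hi : K.CompN i) :
    K.Comp fun γ => PushRelabel.init (K.input γ).n ((K.input γ).m + 1) (A (K.input γ)) (i γ) :=
  Comp.ite (CompP.ltN hi compN_n) (CompN.leastBelow compN_m_succ polyBounded_m_succ fun _ =>
    hA hi.up compN_var) (comp_const 0)

theorem compP_leadTest_aux (hA : PolyRel A) (hX : PolyPred X) (hB : PolyRel B) {s e : Γ → ℕ}
    (hs : K.CompN s) (he : K.CompN e) :
    K.CompP fun γ => ∀ c < (K.input γ).m + 1, (PushRelabel.load (K.input γ).n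
      (PushRelabel.result (K.input γ).n ((K.input γ).m + 1)
        (Allowed (K.input γ).m (A (K.input γ)) (X (K.input γ)))
        (leadCapacity A X B (K.input γ) (s γ) (e γ))) c : ℤ) ≤
          leadCapacity A X B (K.input γ) (s γ) (e γ) c := by
  classical
  have hA' : PolyRel fun I => Allowed I.m (A I) (X I) := polyRel_allowed hA hX
  -- `PushRelabel.result` unfolds to such an iteration with `M = m + 1`, and `f` is the indicator of
  -- the final capacity test.
  refine Comp.iterate (K := K) (len := fun γ => (K.input γ).n + ((K.input γ).m + 1))
    (T := fun γ => ((K.input γ).m + 1) * ((K.input γ).m + 1) * ((K.input γ).n + 1))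
    (g := fun γ => PushRelabel.init (K.input γ).n ((K.input γ).m + 1)
      (Allowed (K.input γ).m (A (K.input γ)) (X (K.input γ))))
    (s := fun γ a => PushRelabel.step (K.input γ).n ((K.input γ).m + 1)
      (Allowed (K.input γ).m (A (K.input γ)) (X (K.input γ)))
      (leadCapacity A X B (K.input γ) (s γ) (e γ)) a)
    (f := fun γ a => @ite _ (∀ c < (K.input γ).m + 1, (PushRelabel.load (K.input γ).n a c : ℤ) ≤
      leadCapacity A X B (K.input γ) (s γ) (e γ) c) (Classical.propDecidable _) 1 0)
    compN_len polyBounded_len ?_ ?_ ?_ ?_ ?_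
  · exact (compN_m_succ.mul polyBounded_m_succ compN_m_succ).mul
      (polyBounded_m_succ.mul polyBounded_m_succ) (compN_n.add (compN_const 1))
  · exact (polyBounded_m_succ.mul polyBounded_m_succ).mul
      (polyBounded_n.add (polyBounded_const 1))
  · exact fun _ => comp_init (A := fun I => Allowed I.m (A I) (X I)) hA' compN_var
  · exact fun j k => comp_process (A := fun I => Allowed I.m (A I) (X I)) hA'
      (hasState_pushArr (K := K) (k := j)).up' compN_var
      (compN_active hA hX hB hs.upArr.up he.upArr.up (hasState_pushArr (K := K) (k := j)).up')
  · exact fun j => CompP.forall_lt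
      (p := fun (γ : Γ × (ℕ → ℤ)) c => (PushRelabel.load (K.input γ.1).n γ.2 c : ℤ) ≤
        leadCapacity A X B (K.input γ.1) (s γ.1) (e γ.1) c)
      compN_m_succ polyBounded_m_succ fun _ =>
        CompP.le (compN_load (hasState_pushArr (K := K) (k := j)).up' compN_var)
          (comp_leadCapacity hA hX hB hs.upArr.up he.upArr.up compN_var)

theorem compP_leadTest (hA : PolyRel A) (hX : PolyPred X) (hB : PolyRel B) :
    K.CompP fun γ => LeadTest (K.input γ).n (K.input γ).m (A (K.input γ)) (X (K.input γ))
      (B (K.input γ)) :=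
  CompP.exists_lt (compN_n.add (compN_const 2)) (polyBounded_n.add (polyBounded_const 2)) fun _ =>
    CompP.exists_lt compN_m polyBounded_m fun _ =>
      compP_leadTest_aux hA hX hB compN_var.up compN_var

end Layout

theorem leadFeasible_iff_fin {n m : ℕ} {A : ℕ → ℕ → Prop} {X : ℕ → Prop} {B : ℕ → ℕ → Prop} :
    LeadFeasible n m A X B ↔ ∃ t : Fin n → Fin m, (∀ v : Fin n, A v (t v)) ∧
      ∀ x y : Fin m, X x → ¬ X y →
        (univ.filter fun v : Fin n => t v = y).card < (univ.filter fun v : Fin n => t v = x).card ∨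
        ((univ.filter fun v : Fin n => t v = y).card = (univ.filter fun v : Fin n => t v = x).card ∧ B x y) := by
  have hcard : ∀ (t : Fin n → Fin m) (f : ℕ → ℕ), (∀ v : Fin n, f v = t v) → ∀ x : Fin m,
      ((range n).filter fun v => f v = x).card = (univ.filter fun v : Fin n => t v = x).card := by
    intro t f hft x
    rw [← countBelow_eq_card]
    refine countBelow_fin _ _ _ fun v => ?_
    rw [hft, Fin.val_inj]
  constructor
  · rintro ⟨f, hf, h⟩
    refine ⟨fun v => ⟨f v, (hf v v.2).1⟩, fun v => (hf v v.2).2, fun x y hx hy => ?_⟩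
    have := h x x.2 hx y y.2 hy
    rwa [hcard (fun v => ⟨f v, (hf v v.2).1⟩) f (fun _ => rfl),
      hcard (fun v => ⟨f v, (hf v v.2).1⟩) f (fun _ => rfl)] at this
  · rintro ⟨t, ht, h⟩
    have hf : ∀ v : Fin n, (fun v => if hv : v < n then (t ⟨v, hv⟩ : ℕ) else 0) (v : ℕ) = t v :=
      fun v => by simp
    refine ⟨fun v => if hv : v < n then (t ⟨v, hv⟩ : ℕ) else 0, fun v hv => ?_,
      fun x hx hxX y hy hyX => ?_⟩
    · rw [hf ⟨v, hv⟩]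
      exact ⟨(t ⟨v, hv⟩).2, ht ⟨v, hv⟩⟩
    · have h1 := hcard t (fun v => if hv : v < n then (t ⟨v, hv⟩ : ℕ) else 0) hf ⟨x, hx⟩
      have h2 := hcard t (fun v => if hv : v < n then (t ⟨v, hv⟩ : ℕ) else 0) hf ⟨y, hy⟩
      simp only at h1 h2
      rw [h1, h2]
      exact h ⟨x, hx⟩ ⟨y, hy⟩ hxX hyX

/-! ### Possible top sets under plurality and veto -/

namespace Profile

variable {n m : ℕ} (T : Profile n m) {t : Fin n → Fin m}

theorem totalScore_plurality (ht : ∀ v a, ¬ T.prefers v a (t v)) (c : Fin m) :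
    T.totalScore plurality c = (univ.filter fun v : Fin n => t v = c).card := by
  classical
  rw [totalScore, card_filter]
  push_cast
  refine sum_congr rfl fun v _ => ?_
  have := T.isStrictTotalOrder v
  simp only [plurality, position, ncard_setOf, Nat.add_eq_right, card_eq_zero]
  refine if_congr ?_ rfl rfl
  rw [filter_eq_empty_iff]
  constructor
  · intro h
    by_contra hne
    rcases trichotomous_of (T.prefers v) (t v) c with h' | h' | h'
    exacts [h (mem_univ _) h', hne h', ht v c h']
  · rintro rfl a -
    exact ht v a

theorem totalScore_veto (ht : ∀ v a, ¬ T.prefers v (t v) a) (c : Fin m) :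
    T.totalScore veto c = n - (univ.filter fun v : Fin n => t v = c).card := by
  classical
  have hn : (n : ℤ) = ∑ _v : Fin n, 1 := by simp
  rw [totalScore, card_filter, hn]
  push_cast
  rw [← sum_sub_distrib]
  refine sum_congr rfl fun v _ => ?_
  have := T.isStrictTotalOrder v
  simp only [veto, position, ncard_setOf]
  have hm : (univ.erase c).card + 1 = m := by rw [card_erase_add_one (mem_univ c)]; simp
  by_cases h : t v = c
  · have : (univ.filter fun a => T.prefers v a c) = univ.erase c := by
      ext a
      simp only [mem_filter, mem_univ, true_and, mem_erase, and_true]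
      constructor
      · rintro h' rfl
        exact irrefl _ h'
      · intro hne
        rcases trichotomous_of (T.prefers v) a c with h' | h' | h'
        exacts [h', absurd h' hne, absurd h' (h ▸ ht v a)]
    rw [this, if_pos hm, if_pos h]
    norm_num
  -- Neither `c` nor the last candidate `t v` precedes `c`, so the position of `c` is less than `m`.
  · have : (univ.filter fun a => T.prefers v a c) ⊆ (univ.erase c).erase (t v) := by
      intro a ha
      simp only [mem_filter, mem_univ, true_and, mem_erase, and_true] at ha ⊢
      refine ⟨?_, ?_⟩
      · rintro rfl
        exact ht v c ha
      · rintro rfl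
        exact irrefl _ ha
    have h1 := card_le_card this
    have h2 := card_erase_add_one (mem_erase.mpr ⟨h, mem_univ (t v)⟩)
    rw [if_neg (by omega), if_neg h]
    norm_num

end Profile

namespace Input

variable (I : Input)

/-- Voter `v` may rank `c` first. -/
def MayBeFirst (v c : ℕ) : Prop := ∀ a < I.m, ¬ I.Prefers v a c

/-- Voter `v` may rank `c` last. -/
def MayBeLast (v c : ℕ) : Prop := ∀ a < I.m, ¬ I.Prefers v c a

theorem before_trans {a b c : ℕ} (h : I.Before a b) (h' : I.Before b c) : I.Before a c := by
  have := I.tie.isStrictTotalOrder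
  obtain ⟨ha, hb, h⟩ := h
  obtain ⟨_, hc, h'⟩ := h'
  exact ⟨ha, hc, _root_.trans h h'⟩

theorem before_total {a b : ℕ} (ha : a < I.m) (hb : b < I.m) :
    a = b ∨ I.Before a b ∨ I.Before b a := by
  have := I.tie.isStrictTotalOrder
  rcases trichotomous_of I.tie.before ⟨a, ha⟩ ⟨b, hb⟩ with h | h | h
  · exact Or.inr (Or.inl ⟨ha, hb, h⟩)
  · exact Or.inl (Fin.mk.inj h)
  · exact Or.inr (Or.inr ⟨hb, ha, h⟩)

theorem exists_mayBeFirst (hm : 0 < I.m) {v : ℕ} (hv : v < I.n) :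
    ∃ c < I.m, I.MayBeFirst v c := by
  have := I.profile.isStrictOrder ⟨v, hv⟩
  obtain ⟨c, -, hc⟩ := (Finite.wellFounded_of_trans_of_irrefl
    (I.profile.prefers ⟨v, hv⟩)).has_min Set.univ ⟨⟨0, hm⟩, trivial⟩
  exact ⟨c, c.2, fun a ha ⟨_, _, _, h⟩ => hc ⟨a, ha⟩ trivial h⟩

theorem exists_mayBeLast (hm : 0 < I.m) {v : ℕ} (hv : v < I.n) :
    ∃ c < I.m, I.MayBeLast v c := by
  have := I.profile.isStrictOrder ⟨v, hv⟩
  obtain ⟨c, -, hc⟩ := (Finite.wellFounded_of_trans_of_irrefl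
    (Function.swap (I.profile.prefers ⟨v, hv⟩))).has_min Set.univ ⟨⟨0, hm⟩, trivial⟩
  exact ⟨c, c.2, fun a ha ⟨_, _, _, h⟩ => hc ⟨a, ha⟩ trivial h⟩

theorem leadTest_mayBeFirst_iff (hm : 0 < I.m) :
    LeadTest I.n I.m I.MayBeFirst I.Mem I.Before ↔
      LeadFeasible I.n I.m I.MayBeFirst I.Mem I.Before :=
  leadTest_iff hm (fun _ _ _ _ _ _ => I.before_trans) (fun _ ha _ hb => I.before_total ha hb)
    fun _ hv => I.exists_mayBeFirst hm hv

/-- In terms of last places the losers lead, so the complement of the set and the reversed tie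
breaker take the roles of set and tie breaker. -/
theorem leadTest_mayBeLast_iff (hm : 0 < I.m) :
    LeadTest I.n I.m I.MayBeLast (fun c => ¬ I.Mem c) (fun a b => I.Before b a) ↔
      LeadFeasible I.n I.m I.MayBeLast (fun c => ¬ I.Mem c) fun a b => I.Before b a :=
  leadTest_iff hm (fun _ _ _ _ _ _ h h' => I.before_trans h' h)
    (fun _ ha _ hb => (I.before_total ha hb).imp_right Or.symm)
    fun _ hv => I.exists_mayBeLast hm hv

end Input

/-! ### Correctness of the tests for possible top sets. -/

section Correctness

variable {n m : ℕ} {P : PartialProfile n m} {tie : TieBreaker m} {D : Finset (Fin m)}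
  {table : ℕ → ℤ}

theorem mayBeFirst_iff (v : Fin n) (c : Fin m) :
    (⟨n, m, P, tie, D, table⟩ : Input).MayBeFirst v c ↔ ∀ a, ¬ P.prefers v a c := by
  refine ⟨fun h a ha => h a a.2 ((prefers_iff v a c).mpr ha), fun h a ha hp => ?_⟩
  exact h ⟨a, ha⟩ ((prefers_iff v ⟨a, ha⟩ c).mp hp)

theorem mayBeLast_iff (v : Fin n) (c : Fin m) :
    (⟨n, m, P, tie, D, table⟩ : Input).MayBeLast v c ↔ ∀ a, ¬ P.prefers v c a := by
  refine ⟨fun h a ha => h a a.2 ((prefers_iff v c a).mpr ha), fun h a ha hp => ?_⟩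
  exact h ⟨a, ha⟩ ((prefers_iff v c ⟨a, ha⟩).mp hp)

/-- A profile in which chosen candidates are ranked first. -/
theorem exists_completion_first {t : Fin n → Fin m} (ht : ∀ v a, ¬ P.prefers v a (t v)) :
    ∃ T : Profile n m, T.Completes P ∧ ∀ v a, ¬ T.prefers v a (t v) := by
  have : ∀ v, ∃ L, IsStrictTotalOrder (Fin m) L ∧ (∀ a b, P.prefers v a b → L a b) ∧
      ∀ a, ¬ L a (t v) := by
    intro v
    have := P.isStrictOrder v
    obtain ⟨L, hL, hext, hlev⟩ := exists_linearExtension (P.prefers v)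
      (fun a => if a = t v then 0 else 1) fun a b h => by
        have hb : b ≠ t v := by rintro rfl; exact ht v a h
        simp only [hb, if_false]
        split_ifs <;> omega
    refine ⟨L, hL, hext, fun a ha => ?_⟩
    by_cases h : a = t v
    · rw [h] at ha
      exact irrefl _ ha
    · exact asymm ha (hlev _ _ (by simp [h]))
  choose L hL hext hfirst using this
  exact ⟨⟨L, hL⟩, hext, hfirst⟩

/-- A profile in which chosen candidates are ranked last. -/
theorem exists_completion_last {t : Fin n → Fin m} (ht : ∀ v a, ¬ P.prefers v (t v) a) :
    ∃ T : Profile n m, T.Completes P ∧ ∀ v a, ¬ T.prefers v (t v) a := by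
  have : ∀ v, ∃ L, IsStrictTotalOrder (Fin m) L ∧ (∀ a b, P.prefers v a b → L a b) ∧
      ∀ a, ¬ L (t v) a := by
    intro v
    have := P.isStrictOrder v
    obtain ⟨L, hL, hext, hlev⟩ := exists_linearExtension (P.prefers v)
      (fun a => if a = t v then 1 else 0) fun a b h => by
        have ha : a ≠ t v := by rintro rfl; exact ht v b h
        simp only [ha, if_false]
        split_ifs <;> omega
    refine ⟨L, hL, hext, fun a ha => ?_⟩
    by_cases h : a = t v
    · rw [h] at ha
      exact irrefl _ ha
    · exact asymm ha (hlev _ _ (by simp [h]))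
  choose L hL hext hlast using this
  exact ⟨⟨L, hL⟩, hext, hlast⟩

/-- Scores count first places. A completion yields an allowed assignment of voters to their first
candidates, and `exists_completion_first` reverses this. -/
theorem isPossible_plurality_iff (hD : D.Nonempty) :
    LeadTest n m (⟨n, m, P, tie, D, table⟩ : Input).MayBeFirst
        (⟨n, m, P, tie, D, table⟩ : Input).Mem (⟨n, m, P, tie, D, table⟩ : Input).Before ↔
      IsPossibleTopSet plurality P tie D.card D := by
  have hm : 0 < m := hD.choose.pos
  refine (Input.leadTest_mayBeFirst_iff ⟨n, m, P, tie, D, table⟩ hm).trans ?_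
  refine leadFeasible_iff_fin.trans ?_
  simp only [mayBeFirst_iff, mem_iff, before_iff, IsPossibleTopSet,
    Profile.forall_mem_iff_isTopWinner]
  constructor
  · rintro ⟨t, ht, h⟩
    obtain ⟨T, hT, hfirst⟩ := exists_completion_first ht
    refine ⟨T, hT, fun c hc d hd => ?_⟩
    simp only [Profile.Defeats, T.totalScore_plurality hfirst, Nat.cast_lt, Nat.cast_inj]
    rcases h c d hc hd with h | ⟨h, h'⟩
    exacts [Or.inl h, Or.inr ⟨h.symm, h'⟩]
  · rintro ⟨T, hT, h⟩
    have : ∀ v, ∃ c, ∀ a, ¬ T.prefers v a c := fun v => by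
      have := T.isStrictTotalOrder v
      obtain ⟨c, -, hc⟩ := (Finite.wellFounded_of_trans_of_irrefl
        (T.prefers v)).has_min Set.univ ⟨⟨0, hm⟩, trivial⟩
      exact ⟨c, fun a => hc a trivial⟩
    choose t ht using this
    refine ⟨t, fun v a ha => ht v a (hT v _ _ ha), fun c d hc hd => ?_⟩
    have h := h c hc d hd
    simp only [Profile.Defeats, T.totalScore_plurality ht, Nat.cast_lt, Nat.cast_inj] at h
    rcases h with h | ⟨h, h'⟩
    exacts [Or.inl h, Or.inr ⟨h.symm, h'⟩]

/-- The score is `n` minus the number of last places, so comparisons of scores are reversed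
comparisons of last places. -/
theorem isPossible_veto_iff (hD : D.Nonempty) :
    LeadTest n m (⟨n, m, P, tie, D, table⟩ : Input).MayBeLast
        (fun c => ¬ (⟨n, m, P, tie, D, table⟩ : Input).Mem c)
        (fun a b => (⟨n, m, P, tie, D, table⟩ : Input).Before b a) ↔
      IsPossibleTopSet veto P tie D.card D := by
  have hm : 0 < m := hD.choose.pos
  refine (Input.leadTest_mayBeLast_iff ⟨n, m, P, tie, D, table⟩ hm).trans ?_
  refine leadFeasible_iff_fin.trans ?_
  simp only [mayBeLast_iff, mem_iff, before_iff, IsPossibleTopSet,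
    Profile.forall_mem_iff_isTopWinner, not_not]
  constructor
  · rintro ⟨t, ht, h⟩
    obtain ⟨T, hT, hlast⟩ := exists_completion_last ht
    refine ⟨T, hT, fun c hc d hd => ?_⟩
    simp only [Profile.Defeats, T.totalScore_veto hlast]
    rcases h d c hd hc with h | ⟨h, h'⟩
    exacts [Or.inl (by omega), Or.inr ⟨by omega, h'⟩]
  · rintro ⟨T, hT, h⟩
    have : ∀ v, ∃ c, ∀ a, ¬ T.prefers v c a := fun v => by
      have := T.isStrictTotalOrder v
      obtain ⟨c, -, hc⟩ := (Finite.wellFounded_of_trans_of_irrefl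
        (Function.swap (T.prefers v))).has_min Set.univ ⟨⟨0, hm⟩, trivial⟩
      exact ⟨c, fun a => hc a trivial⟩
    choose t ht using this
    refine ⟨t, fun v a ha => ht v a (hT v _ _ ha), fun d c hd hc => ?_⟩
    have h := h c hc d hd
    simp only [Profile.Defeats, T.totalScore_veto ht] at h
    rcases h with h | ⟨h, h'⟩
    exacts [Or.inl (by omega), Or.inr ⟨by omega, h'⟩]

end Correctness

/-- The possibility tests use no scores, and array `3` is initially `0`, so it already holds the
zero table; one instruction on an unprotected register serves as program. -/
theorem exists_trivial_prelude : ∃ (p : RAM.Prog) (T : Polynomial ℕ), ∀ (n m : ℕ)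
    (P : PartialProfile n m) (tie : TieBreaker m) (D : Finset (Fin m)),
    ∃ τ, RAM.Runs p (encode P tie D) (T.eval (n + m + 1)) τ ∧
      (⟨n, m, P, tie, D, fun _ => 0⟩ : Input).Holds τ :=
  ⟨.const 2 0, 1, fun _ _ P tie D => ⟨_, (RAM.Runs.const ..).mono (by simp),
    Layout.base.frame ((RAM.Preserves.refl 2 4 _).setReg le_rfl) (holds_encode P tie D)⟩⟩

theorem decidableInTime_isPossibleTopSet_plurality :
    DecidableInTime fun P tie D => IsPossibleTopSet plurality P tie D.card D :=
  decidableInTime_of_compP (table := fun _ _ => 0)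
    (Layout.compP_leadTest (K := Layout.base) (A := Input.MayBeFirst) (X := Input.Mem)
      (B := Input.Before)
      (fun hv hc => Layout.CompP.forall_lt Layout.compN_m Layout.polyBounded_m fun _ =>
        (Layout.compP_prefers hv.up Layout.compN_var hc.up).not)
      (fun hc => Layout.compP_mem hc) (fun ha hb => Layout.compP_before ha hb))
    exists_trivial_prelude fun _ _ _ _ _ hD => isPossible_plurality_iff hD

theorem decidableInTime_isPossibleTopSet_veto :
    DecidableInTime fun P tie D => IsPossibleTopSet veto P tie D.card D :=
  decidableInTime_of_compP (table := fun _ _ => 0)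
    (Layout.compP_leadTest (K := Layout.base) (A := Input.MayBeLast) (X := fun I c => ¬ I.Mem c)
      (B := fun I a b => I.Before b a)
      (fun hv hc => Layout.CompP.forall_lt Layout.compN_m Layout.polyBounded_m fun _ =>
        (Layout.compP_prefers hv.up hc.up Layout.compN_var).not)
      (fun hc => (Layout.compP_mem hc).not) (fun ha hb => Layout.compP_before hb ha))
    exists_trivial_prelude fun _ _ _ _ _ hD => isPossible_veto_iff hD

end Voting

theorem mainTheorem8 :
    (∀ r : Voting.PositionalScoringRule, r.PolyTimeComputable →
      Voting.DecidableInTime (fun P tie D => Voting.IsNecessaryTopSet r P tie D.card D)) ∧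
    Voting.DecidableInTime
      (fun P tie D => Voting.IsPossibleTopSet Voting.plurality P tie D.card D) ∧
    Voting.DecidableInTime
      (fun P tie D => Voting.IsPossibleTopSet Voting.veto P tie D.card D) :=
  ⟨fun _ hr => Voting.decidableInTime_isNecessaryTopSet hr,
    Voting.decidableInTime_isPossibleTopSet_plurality,
    Voting.decidableInTime_isPossibleTopSet_veto⟩
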